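/- **Conventions.** A *toric monoid* is a commutative monoid $P$ that is finitely generated, integral, torsion free and saturated; $P^\vee=\mathrm{Hom}(P;\mathbb N)$. A *face* of $P$ is a submonoid whose complement is a prime ideal; the *interior* $P^\circ$ is the complement of all proper faces; a homomorphism $\phi:P\to Q$ is *interior* if $\phi(P^\circ)\subset Q^\circ$. A *monoidal complex* is a category $\mathcal P$ whose objects are (labelled) toric monoids and whose arrows are homomorphisms that are isomorphisms onto faces, such that for every object $P$ and face $S\le P$ there is a unique object $Q$ and arrow $Q\to P$ with image $S$. A *morphism* $\phi:\mathcal P\to\mathcal Q$ assigns to each object $P$ an interior homomorphism $\phi_P:P\to Q$ to an object $Q$ of $\mathcal Q$, so that for every arrow $i:S\to P$ of $\mathcal P$ there is an arrow $j$ of $\mathcal Q$ with $\phi_P\circ i=j\circ\phi_S$. Let $\mathbb R_+=([0,\infty),\cdot)$ and $X_P=\mathrm{Hom}(P;\mathbb R_+)$, with the weakest topology making the functions $x_p(x)=x(p)$ continuous. A function is *smooth* if it is locally a smooth function of finitely many $x_p$; a *b-function* is a function which is locally $h\,x_p$ with $p\in P$ and $h>0$ smooth; a map to $X_Q$ is an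 *interior b-map* if it pulls back every $x_q$ to a b-function. A *manifold* $M$ here is a connected manifold with generalized corners and embedded boundary faces: a connected second countable Hausdorff space with a maximal atlas of charts onto open subsets of spaces $X_P$ ($P$ toric), whose transition maps are interior b-maps in both directions. b-functions on $M$ and interior b-maps (continuous) between manifolds are defined through charts. $\mathcal B_x$ is the multiplicative monoid of germs of b-functions at $x$, $\mathrm{codim}(x)$ is the rank of the group completion of $\mathcal B_x/\mathcal B_x^\times$, and $S^l(M)=\{x:\mathrm{codim}(x)=l\}$. A boundary face $F$ is the closure of its interior $F^\circ$, a connected component of some $S^l(M)$; embeddedness means that for each $x\in M$, different consistent choices, for all open $U\ni x$, of components of $S^l(M)\cap U$ lie in different components of $S^l(M)$. A germ in $\mathcal B_x$, $x\in F$, is *tangential* to $F$ if it does not vanish on any neighbourhood of $x$ in $F$; $\mathcal T(F,x)\subset\mathcal B_x$ is the set of these germs, and ${}^bM_xF=\mathrm{Hom}(\mathcal B_x/\mathcal T(F,x);\mathbb N)$, regarded as the monoid of homomorphisms $\mathcal B_x\to\mathbb N$ that are trivial on $\mathcal T(F,x)$. **Theorem.** There is a functor $M\mapsto\mathcal P_M$,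 $f\mapsto f_\natural$ from the category of manifolds and interior b-maps to the category of monoidal complexes, with the following properties. 1. The objects of $\mathcal P_M$ are indexed by the boundary faces $F$ of $M$. For each $F$ there are a toric monoid $W(F)$ and isomorphisms $\mathcal B_x/\mathcal T(F,x)\cong W(F)$ for all $x\in F$, locally constant in $x$ (for every local b-function $b$, the image of its germ $[b]_x$ in $W(F)$ is locally constant in $x\in F$). The monoid of $\mathcal P_M$ at $F$ is $W(F)^\vee$, and these isomorphisms induce a trivialization ${}^bM_xF\cong W(F)^\vee$, $x\in F$. 2. There is an arrow $W(F)^\vee\to W(G)^\vee$ in $\mathcal P_M$ if and only if $G\subset F$; for every $x\in G$ it corresponds, under the trivializations, to the inclusion ${}^bM_xF\subset{}^bM_xG$. 3. For an interior b-map $f:M\to N$ and a boundary face $F$ of $M$, $f_\natural$ maps $W(F)^\vee$ to $W(H)^\vee$, where $H$ is the boundary face of $N$ with $f(F^\circ)\subset H^\circ$; for every $x\in F$, the homomorphism $W(F)^\vee\to W(H)^\vee$ corresponds, under the trivializations, to the b-differential ${}^bM_xF\to{}^bM_{f(x)}H$, $v\mapsto v\circ f^*$, where $f^*:\mathcal B_{f(x)}\to\mathcal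 B_x$ is the pull-back of germs. -/

import Mathlib

open Filter Set CategoryTheory
open scoped Topology ContDiff

universe u

namespace GCorners

/-! ### Toric monoids -/

/-- A toric monoid: finitely generated, integral, torsion free and saturated.  Since `P` is
integral, `IsAddTorsionFree P` says that the group completion `P^gp` is torsion free, and the
saturation condition (an element `a - b` of `P^gp` with a positive multiple `c` in `P` lies in
`P`) is written out for representatives. -/
structure IsToric (P : Type u) [AddCommMonoid P] : Prop where
  fg : AddMonoid.FG P
  integral : IsCancelAdd P
  torsionFree : IsAddTorsionFree P
  saturated : ∀ (n : ℕ) (a b c : P), 0 < n → n • a = n • b + c → ∃ d, a = b + d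

/-- The type of toric monoids. -/
structure ToricMonoid : Type (u + 1) where
  carrier : Type u
  [addCommMonoid : AddCommMonoid carrier]
  toric : IsToric carrier

instance : CoeSort ToricMonoid.{u} (Type u) := ⟨ToricMonoid.carrier⟩

instance (P : ToricMonoid.{u}) : AddCommMonoid P := P.addCommMonoid

section Faces

variable {P : Type u} [AddCommMonoid P]

/-- A submonoid is a face if its complement is a prime ideal.  The complement is closed under
adding elements of `P` exactly when the condition below holds, it is proper because `0 ∈ S`, and
it is prime because `S` is closed under addition. -/
def IsFace (S : AddSubmonoid P) : Prop :=
  ∀ p q : P, p + q ∈ S → p ∈ S ∧ q ∈ S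

/-- The interior of a monoid: the complement of all proper faces. -/
def monoidInterior (P : Type u) [AddCommMonoid P] : Set P :=
  {p | ∀ S : AddSubmonoid P, IsFace S → S ≠ ⊤ → p ∉ S}

end Faces

/-- The dimension of a (not necessarily toric) monoid: the rank of its group completion. -/
noncomputable def monoidDim (P : Type u) [AddCommMonoid P] : ℕ :=
  Module.finrank ℤ (Algebra.GrothendieckAddGroup P)

/-! ### Model spaces -/

/-- The model space `X_P = Hom(P; ℝ₊)`, where `ℝ₊ = [0,∞)` with multiplication. -/
def Model (P : Type u) [AddCommMonoid P] : Type u := Multiplicative P →* NNReal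

section Models

variable {P Q : Type u} [AddCommMonoid P] [AddCommMonoid Q]

/-- The algebraic function `x_p : X_P → ℝ₊`, regarded as a real function. -/
def coord (p : P) (x : Model P) : ℝ :=
  ((show Multiplicative P →* NNReal from x) (Multiplicative.ofAdd p) : ℝ)

/-- The weakest topology for which all algebraic functions are continuous. -/
instance : TopologicalSpace (Model P) :=
  TopologicalSpace.induced (fun x (p : P) => coord p x) inferInstance

/-- `f` is a smooth function near `x`: on a neighbourhood of `x` it is a smooth function of
finitely many algebraic functions. -/
def SmoothAt (f : Model P → ℝ) (x : Model P) : Prop :=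
  ∃ (ι : Type) (_ : Fintype ι) (p : ι → P) (V : Set (ι → ℝ)) (g : (ι → ℝ) → ℝ),
    IsOpen V ∧ (fun i => coord (p i) x) ∈ V ∧ ContDiffOn ℝ ∞ g V ∧
      f =ᶠ[𝓝 x] fun y => g fun i => coord (p i) y

/-- `b` is a b-function near `x`: on a neighbourhood of `x` it is an algebraic function times a
smooth, strictly positive function. -/
def BFunAt (b : Model P → ℝ) (x : Model P) : Prop :=
  ∃ (p : P) (h : Model P → ℝ), SmoothAt h x ∧ 0 < h x ∧ b =ᶠ[𝓝 x] fun y => h y * coord p y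

/-- `f` is an interior b-map near `x`: it pulls back algebraic functions to b-functions. -/
def IntBMapAt (f : Model P → Model Q) (x : Model P) : Prop :=
  ∀ q : Q, BFunAt (fun y => coord q (f y)) x

theorem coord_zero (x : Model P) : coord (0 : P) x = 1 :=
  congrArg NNReal.toReal (MonoidHom.map_one (show Multiplicative P →* NNReal from x))

theorem coord_add (p q : P) (x : Model P) : coord (p + q) x = coord p x * coord q x :=
  congrArg NNReal.toReal (MonoidHom.map_mul (show Multiplicative P →* NNReal from x)
    (Multiplicative.ofAdd p) (Multiplicative.ofAdd q))

theorem continuous_coord (p : P) : Continuous (coord p : Model P → ℝ) :=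
  (continuous_apply p).comp
    (continuous_induced_dom (f := fun (x : Model P) (p : P) => coord p x))

theorem smoothAt_coord (p : P) (x : Model P) : SmoothAt (coord p) x :=
  ⟨Unit, inferInstance, fun _ => p, univ, fun z => z (), isOpen_univ, mem_univ _,
    (contDiff_apply ℝ ℝ ()).contDiffOn, EventuallyEq.rfl⟩

theorem SmoothAt.congr {f f' : Model P → ℝ} {x : Model P} (h : SmoothAt f x)
    (e : f' =ᶠ[𝓝 x] f) : SmoothAt f' x := by
  obtain ⟨ι, i1, p, V, g, h1, h2, h3, h4⟩ := h
  exact ⟨ι, i1, p, V, g, h1, h2, h3, e.trans h4⟩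

theorem BFunAt.congr {f f' : Model P → ℝ} {x : Model P} (h : BFunAt f x)
    (e : f' =ᶠ[𝓝 x] f) : BFunAt f' x := by
  obtain ⟨p, k, h1, h2, h3⟩ := h
  exact ⟨p, k, h1, h2, e.trans h3⟩

/-- A smooth function of finitely many smooth functions is smooth. -/
theorem SmoothAt.family {κ : Type} [Fintype κ] {f : κ → Model P → ℝ} {x : Model P}
    (hf : ∀ k, SmoothAt (f k) x) {V : Set (κ → ℝ)} {G : (κ → ℝ) → ℝ} (hV : IsOpen V)
    (hx : (fun k => f k x) ∈ V) (hG : ContDiffOn ℝ ∞ G V) :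
    SmoothAt (fun y => G fun k => f k y) x := by
  choose ι i1 p W g hW hm hg he using hf
  let A : ((Σ k, ι k) → ℝ) → κ → ℝ := fun z k => g k fun i => z ⟨k, i⟩
  let W' : Set ((Σ k, ι k) → ℝ) := ⋂ k, (fun z i => z ⟨k, i⟩) ⁻¹' W k
  have hW' : IsOpen W' := isOpen_iInter_of_finite fun k =>
    (hW k).preimage (continuous_pi fun i => continuous_apply _)
  have hA : ContDiffOn ℝ ∞ A W' := by
    refine contDiffOn_pi.2 fun k => (hg k).comp (t := W k) ?_ ?_
    · exact (contDiff_pi.2 fun i => contDiff_apply ℝ ℝ (⟨k, i⟩ : Σ k, ι k)).contDiffOn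
    · intro z hz
      exact mem_iInter.1 hz k
  have hval : (fun k => f k x) = A fun s => coord (p s.1 s.2) x :=
    funext fun k => (he k).eq_of_nhds
  refine ⟨Σ k, ι k, inferInstance, fun s => p s.1 s.2, W' ∩ A ⁻¹' V, fun z => G (A z),
    hA.continuousOn.isOpen_inter_preimage hW' hV, ⟨mem_iInter.2 fun k => hm k, ?_⟩,
    hG.comp (hA.mono inter_subset_left) fun z hz => hz.2, ?_⟩
  · rw [mem_preimage, ← hval]
    exact hx
  · filter_upwards [eventually_all.2 he] with y hy
    exact congrArg G (funext hy)

theorem SmoothAt.mul {f f' : Model P → ℝ} {x : Model P} (h : SmoothAt f x)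
    (h' : SmoothAt f' x) : SmoothAt (fun y => f y * f' y) x :=
  SmoothAt.family (κ := Bool) (f := fun k => if k then f else f') (V := univ)
    (G := fun z => z true * z false) (by intro k; cases k <;> assumption) isOpen_univ
    (mem_univ _) ((contDiff_apply ℝ ℝ true).mul (contDiff_apply ℝ ℝ false)).contDiffOn

theorem SmoothAt.one (x : Model P) : SmoothAt (fun _ => 1) x :=
  (smoothAt_coord (0 : P) x).congr (Eventually.of_forall fun y => (coord_zero y).symm)

theorem BFunAt.mul {f f' : Model P → ℝ} {x : Model P} (h : BFunAt f x)
    (h' : BFunAt f' x) : BFunAt (fun y => f y * f' y) x := by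
  obtain ⟨p, k, h1, h2, h3⟩ := h
  obtain ⟨p', k', h1', h2', h3'⟩ := h'
  refine ⟨p + p', fun y => k y * k' y, h1.mul h1', mul_pos h2 h2', ?_⟩
  filter_upwards [h3, h3'] with y hy hy'
  rw [hy, hy', coord_add]
  ring

theorem BFunAt.one (x : Model P) : BFunAt (fun _ => 1) x :=
  ⟨0, fun _ => 1, SmoothAt.one x, one_pos,
    Eventually.of_forall fun y => by simp [coord_zero]⟩

theorem BFunAt.smoothAt {b : Model P → ℝ} {x : Model P} (h : BFunAt b x) : SmoothAt b x := by
  obtain ⟨p, k, h1, _, h3⟩ := h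
  exact (h1.mul (smoothAt_coord p x)).congr h3

theorem SmoothAt.comp {φ : Model P → Model Q} {x : Model P} {f : Model Q → ℝ}
    (hf : SmoothAt f (φ x)) (hφ : IntBMapAt φ x) (hc : ContinuousAt φ x) :
    SmoothAt (fun y => f (φ y)) x := by
  obtain ⟨ι, i1, q, V, g, h1, h2, h3, h4⟩ := hf
  exact (SmoothAt.family (fun i => (hφ (q i)).smoothAt) h1 h2 h3).congr (hc.eventually h4)

theorem BFunAt.comp {φ : Model P → Model Q} {x : Model P} {b : Model Q → ℝ}
    (hb : BFunAt b (φ x)) (hφ : IntBMapAt φ x) (hc : ContinuousAt φ x) :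
    BFunAt (fun y => b (φ y)) x := by
  obtain ⟨q, h, h1, h2, h3⟩ := hb
  obtain ⟨p, k, k1, k2, k3⟩ := hφ q
  refine ⟨p, fun y => h (φ y) * k y, (h1.comp hφ hc).mul k1, mul_pos h2 k2, ?_⟩
  filter_upwards [hc.eventually h3, k3] with y hy hy'
  rw [hy, hy', mul_assoc]

end Models

/-! ### Manifolds with generalized corners -/

/-- A chart of a space `M`: a homeomorphism of an open subset of `M` onto an open subset of a
model space `X_P`. -/
abbrev Chart (M : Type u) [TopologicalSpace M] : Type (u + 1) :=
  Σ P : ToricMonoid.{u}, OpenPartialHomeomorph M (Model P)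

/-- The transition function from `c` to `c'` is an interior b-map.  Two charts are compatible if
this holds in both directions, i.e. if the transition function is a diffeomorphism. -/
def TransitionBMap {M : Type u} [TopologicalSpace M] (c c' : Chart M) : Prop :=
  ∀ x ∈ c.2.source ∩ c'.2.source, IntBMapAt (fun z => c'.2 (c.2.symm z)) (c.2 x)

/-- A connected manifold with generalized corners, whose boundary faces need not be embedded:
a connected second countable Hausdorff space with a maximal atlas. -/
structure PreManifold : Type (u + 1) where
  carrier : Type u
  [topology : TopologicalSpace carrier]
  [t2 : T2Space carrier]
  [secondCountable : SecondCountableTopology carrier]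
  [connected : ConnectedSpace carrier]
  atlas : Set (Chart carrier)
  cover : ∀ x : carrier, ∃ c ∈ atlas, x ∈ c.2.source
  compatible : ∀ c ∈ atlas, ∀ c' ∈ atlas, TransitionBMap c c'
  maximal : ∀ c : Chart carrier,
    (∀ c' ∈ atlas, TransitionBMap c c' ∧ TransitionBMap c' c) → c ∈ atlas

namespace PreManifold

instance : CoeSort PreManifold.{u} (Type u) := ⟨PreManifold.carrier⟩

instance (M : PreManifold.{u}) : TopologicalSpace M := M.topology

variable (M N K : PreManifold.{u})

/-- `b` is a b-function near `x`, i.e. its compositions with the charts are. -/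
def BAt (b : M → ℝ) (x : M) : Prop :=
  ∀ c ∈ M.atlas, x ∈ c.2.source → BFunAt (fun z => b (c.2.symm z)) (c.2 x)

/-- The stalk `B_x` of the sheaf of b-functions, a multiplicative monoid of germs. -/
def BStalk (x : M) : Submonoid (Germ (𝓝 x) ℝ) where
  carrier := {β | ∃ b : M → ℝ, (b : Germ (𝓝 x) ℝ) = β ∧ M.BAt b x}
  one_mem' := ⟨fun _ => 1, rfl, fun c _ _ => BFunAt.one (c.2 x)⟩
  mul_mem' := by
    rintro _ _ ⟨b, rfl, hb⟩ ⟨b', rfl, hb'⟩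
    exact ⟨fun y => b y * b' y, rfl, fun c hc hx => (hb c hc hx).mul (hb' c hc hx)⟩

variable {M N K}

/-- The germ at `x` of a function which is a b-function near `x`. -/
def germ (b : M → ℝ) (x : M) (hb : M.BAt b x) : M.BStalk x :=
  ⟨(b : Germ (𝓝 x) ℝ), b, rfl, hb⟩

/-- The codimension of a point: `codim(x) = dim(B_x^♯)`, where the sharpening
`B_x^♯ = B_x / B_x^×` is the monoid of classes of associated elements. -/
noncomputable def codim (x : M) : ℕ := monoidDim (Additive (Associates (M.BStalk x)))

variable (M) in
/-- The set `S^l(M)` of points of codimension `l`. -/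
def codimStratum (l : ℕ) : Set M := {x | codim x = l}

/-- A consistent choice `γ`, for all open neighbourhoods `U` of `x`, of a connected component of
`S^l(M) ∩ U`. -/
structure LocalCorner (l : ℕ) (x : M) where
  component : TopologicalSpace.OpenNhdsOf x → Set M
  isComponent : ∀ U : TopologicalSpace.OpenNhdsOf x, ∃ y ∈ M.codimStratum l ∩ (U : Set M),
    component U = connectedComponentIn (M.codimStratum l ∩ (U : Set M)) y
  mono : Monotone component

variable (M) in
/-- The boundary faces are embedded.  A boundary face of codimension `l` is a set of pairs
`(x, γ)` as above, and two such pairs belong to the same boundary face if `γ` and `γ'` choose,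
for `U = M`, the same component of `S^l(M)` (the interior of the boundary face).  The condition
is that `(x, γ) ↦ x` is injective on each boundary face. -/
def EmbeddedFaces : Prop :=
  ∀ (l : ℕ) (x : M) (γ γ' : LocalCorner l x), γ.component ⊤ = γ'.component ⊤ → γ = γ'

variable (M) in
/-- A boundary face `F`, recorded by its interior `F°`, a connected component of some `S^l(M)`. -/
structure Face where
  interior : Set M
  isComponent : ∃ l, ∃ x ∈ M.codimStratum l,
    interior = connectedComponentIn (M.codimStratum l) x

/-- The boundary face itself, the closure of its interior. -/
def Face.toSet (F : M.Face) : Set M := closure F.interior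

/-- The order of boundary faces is inclusion. -/
instance : LE M.Face := ⟨fun G F => G.toSet ⊆ F.toSet⟩

/-- A germ is tangential to `F` at `x` unless it vanishes on a neighbourhood of `x` in `F`. -/
def Tangential (F : M.Face) (x : M) (β : M.BStalk x) : Prop :=
  ∃ b : M → ℝ, (b : Germ (𝓝 x) ℝ) = β ∧ ¬ ∀ᶠ y in 𝓝[F.toSet] x, b y = 0

/-- Monoid homomorphisms `B_x → ℕ`. -/
abbrev StalkDual (x : M) : Type u := Additive (M.BStalk x) →+ ℕ

/-- The normal monoid `ᵇM_x F = Hom(B_x / T(F,x); ℕ)`, i.e. the homomorphisms `B_x → ℕ` which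
are trivial on the germs tangential to `F`. -/
def normalMonoid (F : M.Face) (x : M) : AddSubmonoid (StalkDual x) where
  carrier := {v | ∀ β : M.BStalk x, Tangential F x β → v (Additive.ofMul β) = 0}
  zero_mem' := fun _ _ => rfl
  add_mem' := fun hv hw β hβ => by simp [hv β hβ, hw β hβ]

/-- An interior b-map: a continuous map all of whose compositions with charts are interior
b-maps. -/
structure IsIntBMap (f : M → N) : Prop where
  continuous : Continuous f
  bmap : ∀ c ∈ M.atlas, ∀ c' ∈ N.atlas, ∀ x ∈ c.2.source, f x ∈ c'.2.source →
    IntBMapAt (fun z => c'.2 (f (c.2.symm z))) (c.2 x)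

theorem IsIntBMap.id : IsIntBMap (fun x : M => x) :=
  ⟨continuous_id, fun c hc c' hc' x hx hx' => M.compatible c hc c' hc' x ⟨hx, hx'⟩⟩

/-- An interior b-map in charts is continuous, and factors functions through a chart of the
target. -/
theorem chart_aux {f : M → N} (hf : Continuous f) {c : Chart M} {c' : Chart N} {x : M}
    (hx : x ∈ c.2.source) (hx' : f x ∈ c'.2.source) :
    ContinuousAt (fun z => c'.2 (f (c.2.symm z))) (c.2 x) ∧
      ∀ᶠ z in 𝓝 (c.2 x), c'.2.symm (c'.2 (f (c.2.symm z))) = f (c.2.symm z) := by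
  have h1 : ContinuousAt (fun z => f (c.2.symm z)) (c.2 x) :=
    hf.continuousAt.comp (c.2.continuousAt_symm (c.2.map_source hx))
  have h2 : f (c.2.symm (c.2 x)) ∈ c'.2.source := by rwa [c.2.left_inv hx]
  refine ⟨(c'.2.continuousAt h2).comp (f := fun z => f (c.2.symm z)) h1, ?_⟩
  filter_upwards [h1.eventually (c'.2.open_source.mem_nhds h2)] with z hz
  exact c'.2.left_inv hz

/-- Interior b-maps pull back b-functions to b-functions. -/
theorem IsIntBMap.bAt {f : M → N} (hf : IsIntBMap f) {b : N → ℝ} {x : M}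
    (hb : N.BAt b (f x)) : M.BAt (fun y => b (f y)) x := by
  intro c hc hx
  obtain ⟨c', hc', hx'⟩ := N.cover (f x)
  obtain ⟨h1, h2⟩ := chart_aux hf.continuous hx hx'
  have h3 := hb c' hc' hx'
  have e : c'.2 (f x) = c'.2 (f (c.2.symm (c.2 x))) := by rw [c.2.left_inv hx]
  rw [e] at h3
  refine (BFunAt.comp h3 (hf.bmap c hc c' hc' x hx hx') h1).congr ?_
  filter_upwards [h2] with z hz
  rw [hz]

theorem IsIntBMap.comp {g : N → K} {f : M → N} (hg : IsIntBMap g) (hf : IsIntBMap f) :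
    IsIntBMap (fun x => g (f x)) := by
  refine ⟨hg.continuous.comp hf.continuous, fun c hc c'' hc'' x hx hx'' q => ?_⟩
  obtain ⟨c', hc', hx'⟩ := N.cover (f x)
  obtain ⟨h1, h2⟩ := chart_aux hf.continuous hx hx'
  have h3 := hg.bmap c' hc' c'' hc'' (f x) hx' hx'' q
  have e : c'.2 (f x) = c'.2 (f (c.2.symm (c.2 x))) := by rw [c.2.left_inv hx]
  rw [e] at h3
  refine (BFunAt.comp h3 (hf.bmap c hc c' hc' x hx hx') h1).congr ?_
  filter_upwards [h2] with z hz
  rw [hz]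

/-- The pull-back of germs `f^* : B_{f(x)} → B_x`. -/
def stalkPullback {f : M → N} (hf : IsIntBMap f) (x : M) : N.BStalk (f x) →* M.BStalk x where
  toFun β := ⟨β.1.compTendsto f hf.continuous.continuousAt, by
    obtain ⟨_, b, rfl, hb⟩ := β
    exact ⟨fun y => b (f y), rfl, hf.bAt hb⟩⟩
  map_one' := rfl
  map_mul' := by
    rintro ⟨_, b, rfl, hb⟩ ⟨_, b', rfl, hb'⟩
    rfl

/-- The b-differential on homomorphisms `B_x → ℕ`, given by the pull-back of germs. -/
def bDifferential {f : M → N} (hf : IsIntBMap f) (x : M) (v : StalkDual x) :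
    StalkDual (f x) :=
  v.comp (MonoidHom.toAdditive (stalkPullback hf x))

end PreManifold

/-- A (connected) manifold with generalized corners and embedded boundary faces. -/
structure Manifold : Type (u + 1) extends PreManifold.{u} where
  embedded : toPreManifold.EmbeddedFaces

instance : CoeSort Manifold.{u} (Type u) := ⟨fun M => M.carrier⟩

open PreManifold

/-- Interior b-maps between manifolds with generalized corners. -/
@[ext]
structure Manifold.Hom (M N : Manifold.{u}) where
  toFun : M → N
  isIntBMap : IsIntBMap (M := M.toPreManifold) (N := N.toPreManifold) toFun

/-- The category of manifolds with generalized corners and interior b-maps. -/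
instance : Category Manifold.{u} where
  Hom := Manifold.Hom
  id _ := ⟨fun x => x, IsIntBMap.id⟩
  comp f g := ⟨fun x => g.toFun (f.toFun x), g.isIntBMap.comp f.isIntBMap⟩

/-! ### Monoidal complexes -/

/-- A monoidal complex: a category whose objects are (labelled) toric monoids and whose arrows
are monoid homomorphisms which are isomorphisms onto faces, such that for each object `b` and
each face `S` of its monoid there is a unique object with an arrow to `b` which is an isomorphism
onto `S`. -/
structure MonoidalComplex : Type (u + 1) where
  Obj : Type u
  mon : Obj → ToricMonoid.{u}
  Arrow : ∀ a b : Obj, Set (mon a →+ mon b)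
  id_mem : ∀ a, AddMonoidHom.id (mon a) ∈ Arrow a a
  comp_mem : ∀ {a b c} {i : mon a →+ mon b} {j : mon b →+ mon c},
    i ∈ Arrow a b → j ∈ Arrow b c → j.comp i ∈ Arrow a c
  arrow_injective : ∀ {a b} {i : mon a →+ mon b}, i ∈ Arrow a b → Function.Injective i
  arrow_isFace : ∀ {a b} {i : mon a →+ mon b}, i ∈ Arrow a b → IsFace (AddMonoidHom.mrange i)
  existsUnique_arrow : ∀ (b : Obj) (S : AddSubmonoid (mon b)), IsFace S →
    ∃! i : (Σ a : Obj, Arrow a b), AddMonoidHom.mrange i.2.1 = S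

/-- A morphism of monoidal complexes: interior homomorphisms commuting with arrows. -/
@[ext]
structure MonoidalComplex.Hom (P Q : MonoidalComplex.{u}) where
  obj : P.Obj → Q.Obj
  hom : ∀ a, P.mon a →+ Q.mon (obj a)
  interior : ∀ a, ∀ p ∈ monoidInterior (P.mon a), hom a p ∈ monoidInterior (Q.mon (obj a))
  comm : ∀ {a b} (i : P.mon a →+ P.mon b), i ∈ P.Arrow a b →
    ∃ j ∈ Q.Arrow (obj a) (obj b), (hom b).comp i = j.comp (hom a)

/-- The category of monoidal complexes. -/
instance : Category MonoidalComplex.{u} where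
  Hom := MonoidalComplex.Hom
  id P := ⟨fun a => a, fun a => AddMonoidHom.id (P.mon a), fun _ _ hp => hp,
    fun i hi => ⟨i, hi, rfl⟩⟩
  comp φ ψ := ⟨fun a => ψ.obj (φ.obj a), fun a => (ψ.hom (φ.obj a)).comp (φ.hom a),
    fun a p hp => ψ.interior _ _ (φ.interior a p hp), fun i hi => by
      obtain ⟨j, hj, e⟩ := φ.comm i hi
      obtain ⟨k, hk, e'⟩ := ψ.comm j hj
      exact ⟨k, hk, by rw [AddMonoidHom.comp_assoc, e, ← AddMonoidHom.comp_assoc, e',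
        AddMonoidHom.comp_assoc]⟩⟩

/-! ### The monoidal complex of a manifold -/

/-- Data exhibiting the monoidal complex `P` as the complex `{W(F)^∨}` of normal monoids of `M`,
indexed by the boundary faces `F` of `M`. -/
structure NormalComplexData (M : Manifold.{u}) (P : MonoidalComplex.{u}) where
  /-- The objects are indexed by the boundary faces. -/
  face : P.Obj ≃ M.Face
  /-- The conormal monoid `W(F)`. -/
  W : P.Obj → ToricMonoid.{u}
  /-- The projection `B_x → B_x / T(F,x) ≅ W(F)` for `x ∈ F`. -/
  proj : ∀ a, ∀ x ∈ (face a).toSet, Additive (M.BStalk x) →+ W a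
  proj_surjective : ∀ a x hx, Function.Surjective (proj a x hx)
  /-- Two germs have the same image if and only if they become equal after multiplication by
  tangential germs, i.e. if they are equal in the quotient `B_x / T(F,x)`. -/
  proj_eq_iff : ∀ a x hx (β β' : M.BStalk x),
    proj a x hx (Additive.ofMul β) = proj a x hx (Additive.ofMul β') ↔
      ∃ t t' : M.BStalk x, Tangential (face a) x t ∧ Tangential (face a) x t' ∧
        β * t = β' * t'
  /-- The identifications `B_x / T(F,x) ≅ W(F)` are locally constant in `x ∈ F`. -/
  proj_locallyConstant : ∀ a x hx (b : M → ℝ) (hb : M.BAt b x),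
    ∀ᶠ y in 𝓝[(face a).toSet] x, ∃ (hy : y ∈ (face a).toSet) (hb' : M.BAt b y),
      proj a y hy (Additive.ofMul (germ b y hb')) = proj a x hx (Additive.ofMul (germ b x hb))
  /-- The monoid indexed by `F` is the dual `W(F)^∨ = Hom(W(F); ℕ)`. -/
  dual : ∀ a, P.mon a ≃+ (W a →+ ℕ)
  /-- The trivialization `F × W(F)^∨ ≅ ᵇM F` of the bundle of normal monoids, over `x ∈ F`. -/
  triv : ∀ a, ∀ x ∈ (face a).toSet, P.mon a ≃+ normalMonoid (face a) x
  triv_apply : ∀ a x hx (w : P.mon a),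
    (triv a x hx w : StalkDual x) = (dual a w).comp (proj a x hx)
  /-- There is an arrow `W(F)^∨ ⇀ W(G)^∨` if and only if `G ≤ F`. -/
  arrow_nonempty_iff : ∀ a b, (P.Arrow a b).Nonempty ↔ face b ≤ face a
  /-- Over each `x ∈ G`, the arrow `W(F)^∨ ⇀ W(G)^∨` is the natural homomorphism
  `ᵇM_x F → ᵇM_x G` (the inclusion, as both consist of homomorphisms `B_x → ℕ`). -/
  arrow_apply : ∀ {a b} (i : P.mon a →+ P.mon b), i ∈ P.Arrow a b →
    ∀ x, ∀ (hb : x ∈ (face b).toSet), ∃ ha : x ∈ (face a).toSet,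
      ∀ w : P.mon a, (triv b x hb (i w) : StalkDual x) = triv a x ha w

/-- `φ : P_M → P_N` is the morphism `f_♮` induced by `f`: it maps the object of `F` to that of
the boundary face `G` with `f(F°) ⊆ G°`, and over each `x ∈ F` the homomorphism
`W(F)^∨ → W(G)^∨` is the b-differential `ᵇM_x F → ᵇM_{f(x)} G`. -/
structure IsInducedBy {M N : Manifold.{u}} {P Q : MonoidalComplex.{u}} (f : M ⟶ N)
    (A : NormalComplexData M P) (B : NormalComplexData N Q) (φ : P ⟶ Q) : Prop where
  mapsTo_interior : ∀ a, MapsTo f.toFun (A.face a).interior (B.face (φ.obj a)).interior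
  hom_apply : ∀ a x, ∀ (hx : x ∈ (A.face a).toSet),
    ∃ hy : f.toFun x ∈ (B.face (φ.obj a)).toSet, ∀ w : P.mon a,
      (B.triv (φ.obj a) (f.toFun x) hy (φ.hom a w) : StalkDual (f.toFun x)) =
        bDifferential f.isIntBMap x (A.triv a x hx w)

end GCorners

/-!
The complex of normal monoids of a manifold with generalized corners, and its functoriality.

*Local structure.*  Let `x` be a point of a chart with toric monoid `P`, and let `S` be its support,
the face of those `p` with `x_p ≠ 0`.  A b-function near `x` is a monomial `x_p` times a positive
smooth function, and `p` is unique modulo `S` (`HasMonomial.relMod`): along curves `E t^v` tending to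
`x`, with `v : P → ℕ` vanishing exactly on `S`, the b-function grows like `t^{v(p)}`.  Hence the
codimension of `x` is the rank of `P / S`.  The strata of constant support are connected near `x`
because suitable neighbourhoods are closed under geometric means.  If boundary faces are embedded,
it follows that the boundary faces through `x` correspond to the faces of `P` that contain `S`
(`exists_isLocalFace`, `exists_face_isLocalFace`), and if `F` corresponds to `T`, then a germ is
tangential to `F` when its monomial lies in `T`, so that `B_x / T(F,x) ≅ P / T`.

*Absence of monodromy.*  To identify the monoids `B_x / T(F,x)` for all `x ∈ F`, germs are compared
by their orders of vanishing along hypersurfaces.  For a hypersurface `H`, the isomorphism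
`B_x / T(H,x) ≅ ℕ` is unique, since `ℕ` has no automorphisms.  The primitive normals of the facets
that contain a face `T` of a toric monoid `P` separate the points of `P / T`
(`IsToric.relMod_of_facetNormal`), so that `B_x / T(F,x)` embeds into `ℕ^{H ⊇ F}`.  The image is
locally constant in `x`, hence constant on the connected set `F`; this is `W(F)`.  Passing from `G`
to a larger face `F` amounts to forgetting the hypersurfaces that contain `G` but not `F`, and the
arrow `W(F)^∨ → W(G)^∨` is dual to this restriction.  The faces of `W(G)^∨` are the images of these
arrows by the duality of faces of `P` and `P^∨`.

*Functoriality.*  An interior b-map `f` takes points of equal support to points of equal support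
locally, so it maps the connected set `F°` into a single `H°`.  Then a germ at `f(x)` is tangential
to `H` exactly when its pull-back is tangential to `F`, which gives `W(H) → W(F)`; this is again
locally constant in `x ∈ F`.  A morphism of complexes is determined by these pointwise conditions
(`IsInducedBy.unique`), and the functor laws follow.
-/

namespace GCorners

open Algebra

/-! ### Faces of toric monoids -/

section ToricFaces

variable {P : Type u} [AddCommMonoid P]

/-- Equality of `p` and `q` in the quotient `P / T`: they become equal after adding elements
of `T`. -/
def RelMod (T : AddSubmonoid P) (p q : P) : Prop :=
  ∃ t ∈ T, ∃ t' ∈ T, p + t = q + t'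

theorem RelMod.refl (T : AddSubmonoid P) (p : P) : RelMod T p p :=
  ⟨0, T.zero_mem, 0, T.zero_mem, rfl⟩

theorem RelMod.mono {S T : AddSubmonoid P} (hST : S ≤ T) {p q : P} (h : RelMod S p q) :
    RelMod T p q := by
  obtain ⟨t, ht, t', ht', e⟩ := h
  exact ⟨t, hST ht, t', hST ht', e⟩

theorem RelMod.trans {T : AddSubmonoid P} {p q r : P} (h : RelMod T p q) (h' : RelMod T q r) :
    RelMod T p r := by
  obtain ⟨t, ht, t', ht', e⟩ := h
  obtain ⟨s, hs, s', hs', e'⟩ := h'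
  refine ⟨t + s, T.add_mem ht hs, t' + s', T.add_mem ht' hs', ?_⟩
  rw [← add_assoc, e, add_right_comm, e', add_right_comm, ← add_assoc, add_right_comm]

theorem RelMod.map_eq {A : Type*} [AddMonoid A] {T : AddSubmonoid P} {p q : P}
    (h : RelMod T p q) (w : P →+ A) (hw : ∀ t ∈ T, w t = 0) : w p = w q := by
  obtain ⟨t, ht, t', ht', e⟩ := h
  simpa [hw t ht, hw t' ht'] using congrArg w e

theorem IsFace.mem_of_relMod {T : AddSubmonoid P} (hT : IsFace T) {p q : P}
    (h : RelMod T p q) (hq : q ∈ T) : p ∈ T := by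
  obtain ⟨t, _, t', ht', e⟩ := h
  exact (hT p t (e ▸ T.add_mem hq ht')).1

theorem IsFace.mem_of_nsmul_mem {T : AddSubmonoid P} (hT : IsFace T) {n : ℕ} (hn : 0 < n)
    {p : P} (h : n • p ∈ T) : p ∈ T := by
  obtain ⟨m, rfl⟩ := Nat.exists_eq_succ_of_ne_zero hn.ne'
  rw [succ_nsmul] at h
  exact (hT _ _ h).2

theorem IsFace.mem_of_sum_mem {T : AddSubmonoid P} (hT : IsFace T) {ι : Type*} {s : Finset ι}
    {p : ι → P} (h : ∑ i ∈ s, p i ∈ T) {i : ι} (hi : i ∈ s) : p i ∈ T := by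
  classical
  rw [← Finset.add_sum_erase s p hi] at h
  exact (hT _ _ h).1

theorem isFace_kernel {A : Type*} [AddCommMonoid A] [PartialOrder A] [IsOrderedAddMonoid A]
    (v : P →+ A) (hv : ∀ p, 0 ≤ v p) : IsFace (AddMonoidHom.mker v) := by
  intro p q h
  rw [AddMonoidHom.mem_mker, map_add] at h
  exact (add_eq_zero_iff_of_nonneg (hv p) (hv q)).1 h

/-- Saturation, modulo a face. -/
theorem IsToric.relMod_of_nsmul (hP : IsToric P) {T : AddSubmonoid P} (hT : IsFace T) {n : ℕ}
    (hn : 0 < n) {p q : P} (h : RelMod T (n • p) (n • q)) : RelMod T p q := by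
  have := hP.integral
  obtain ⟨m, rfl⟩ := Nat.exists_eq_succ_of_ne_zero hn.ne'
  obtain ⟨t, ht, t', ht', e⟩ := h
  have e1 : (m + 1) • (p + t) = (m + 1) • q + (t' + m • t) := by
    rw [nsmul_add, succ_nsmul t, add_comm (m • t), ← add_assoc]
    rw [Nat.succ_eq_add_one] at e
    rw [e, add_assoc]
  obtain ⟨d, hd⟩ := hP.saturated _ _ _ _ hn e1
  refine ⟨t, ht, d, ?_, hd⟩
  rw [hd, nsmul_add] at e1
  refine hT.mem_of_nsmul_mem hn ?_
  rw [add_left_cancel e1]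
  exact T.add_mem ht' (T.nsmul_mem ht m)

theorem IsFace.eq_closure_inter {T : AddSubmonoid P} (hT : IsFace T) {A : Set P}
    (hA : AddSubmonoid.closure A = ⊤) : T = AddSubmonoid.closure (A ∩ T) := by
  refine le_antisymm (fun p hp => ?_) ((AddSubmonoid.closure_le).2 inter_subset_right)
  have hpA : p ∈ AddSubmonoid.closure A := hA ▸ AddSubmonoid.mem_top p
  revert hp
  induction hpA using AddSubmonoid.closure_induction with
  | mem a ha => exact fun h => AddSubmonoid.subset_closure ⟨ha, h⟩
  | zero => exact fun _ => AddSubmonoid.zero_mem _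
  | add a b _ _ iha ihb =>
    exact fun h => AddSubmonoid.add_mem _ (iha (hT _ _ h).1) (ihb (hT _ _ h).2)

theorem IsToric.exists_generators (hP : IsToric P) :
    ∃ A : Finset P, AddSubmonoid.closure (A : Set P) = ⊤ :=
  hP.fg.fg_top

theorem IsFace.fg (hP : IsToric P) {T : AddSubmonoid P} (hT : IsFace T) : T.FG := by
  obtain ⟨A, hA⟩ := hP.exists_generators
  rw [AddSubmonoid.fg_iff]
  exact ⟨_, (hT.eq_closure_inter hA).symm, A.finite_toSet.inter_of_left _⟩

/-- A finitely generated monoid has finitely many faces, as a face is generated by the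
generators it contains. -/
theorem IsToric.finite_faces (hP : IsToric P) : {T : AddSubmonoid P | IsFace T}.Finite := by
  obtain ⟨A, hA⟩ := hP.exists_generators
  refine (A.finite_toSet.finite_subsets.image AddSubmonoid.closure).subset fun T hT => ?_
  exact ⟨_, inter_subset_left, (IsFace.eq_closure_inter hT hA).symm⟩

/-! ### Homomorphisms to groups -/

theorem exists_eq_of_sub_of (x : GrothendieckAddGroup P) :
    ∃ a b : P, x = GrothendieckAddGroup.of a - GrothendieckAddGroup.of b := by
  obtain ⟨⟨a, b⟩, h⟩ := (AddLocalization.addMonoidOf (⊤ : AddSubmonoid P)).surj x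
  exact ⟨a, b, eq_sub_of_add_eq h⟩

theorem of_eq_of_iff [IsCancelAdd P] {a b : P} :
    GrothendieckAddGroup.of a = GrothendieckAddGroup.of b ↔ a = b :=
  GrothendieckAddGroup.of_injective.eq_iff

theorem exists_of_mem_closure_image_of (T : AddSubmonoid P) {x : GrothendieckAddGroup P}
    (hx : x ∈ AddSubgroup.closure (GrothendieckAddGroup.of '' (T : Set P))) :
    ∃ t ∈ T, ∃ t' ∈ T, x = GrothendieckAddGroup.of t' - GrothendieckAddGroup.of t := by
  induction hx using AddSubgroup.closure_induction with
  | mem x hx =>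
    obtain ⟨t, ht, rfl⟩ := hx
    exact ⟨0, T.zero_mem, t, ht, by rw [map_zero, sub_zero]⟩
  | zero => exact ⟨0, T.zero_mem, 0, T.zero_mem, by rw [sub_self]⟩
  | add x y _ _ hx hy =>
    obtain ⟨t, ht, t', ht', rfl⟩ := hx
    obtain ⟨s, hs, s', hs', rfl⟩ := hy
    exact ⟨t + s, T.add_mem ht hs, t' + s', T.add_mem ht' hs', by
      rw [map_add, map_add, sub_add_sub_comm]⟩
  | neg x _ hx =>
    obtain ⟨t, ht, t', ht', rfl⟩ := hx
    exact ⟨t', ht', t, ht, by rw [neg_sub]⟩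

/-- Homomorphisms from a submonoid of an integral monoid to a divisible group extend. -/
theorem exists_extension [IsCancelAdd P] {A : Type} [AddCommGroup A] [DivisibleBy A ℤ]
    (S : AddSubmonoid P) (l : S →+ A) : ∃ L : P →+ A, ∀ s : S, L s = l s := by
  have hi : Function.Injective
      (GrothendieckAddGroup.lift (GrothendieckAddGroup.of.comp S.subtype)) := by
    rw [injective_iff_map_eq_zero]
    intro x hx
    obtain ⟨a, b, rfl⟩ := exists_eq_of_sub_of x
    have h : ∀ s : S, GrothendieckAddGroup.lift (GrothendieckAddGroup.of.comp S.subtype)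
        (GrothendieckAddGroup.of s) = GrothendieckAddGroup.of (s : P) := fun s =>
      DFunLike.congr_fun (GrothendieckAddGroup.lift.symm_apply_apply
        (GrothendieckAddGroup.of.comp S.subtype)) s
    rw [map_sub, h, h, sub_eq_zero, of_eq_of_iff, Subtype.coe_inj] at hx
    rw [hx, sub_self]
  obtain ⟨L, hL⟩ := (Module.Baer.of_divisible A).extension_property_addMonoidHom _ hi
    (GrothendieckAddGroup.lift l)
  refine ⟨L.comp GrothendieckAddGroup.of, fun s => ?_⟩
  have h1 := DFunLike.congr_fun hL (GrothendieckAddGroup.of s)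
  have h2 := DFunLike.congr_fun (GrothendieckAddGroup.lift.symm_apply_apply
        (GrothendieckAddGroup.of.comp S.subtype)) s
  have h3 := DFunLike.congr_fun (GrothendieckAddGroup.lift.symm_apply_apply l) s
  exact (congrArg L h2).symm.trans (h1.trans h3)

/-- The rational functionals on `P` that vanish on `T`. -/
def annihilator (T : AddSubmonoid P) : Submodule ℚ (P →+ ℚ) where
  carrier := {w | ∀ t ∈ T, w t = 0}
  zero_mem' := fun _ _ => rfl
  add_mem' := fun ha hb t ht => by simp [ha t ht, hb t ht]
  smul_mem' := fun c w hw t ht => by simp [hw t ht]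

/-- Rational functionals separate the points of `P / T`. -/
theorem IsToric.relMod_of_annihilator (hP : IsToric P) {T : AddSubmonoid P} (hT : IsFace T)
    {p q : P} (h : ∀ w ∈ annihilator T, w p = w q) : RelMod T p q := by
  have := hP.integral
  let N := AddSubgroup.closure (GrothendieckAddGroup.of '' (T : Set P))
  let π : P →+ GrothendieckAddGroup P ⧸ N := (QuotientAddGroup.mk' N).comp GrothendieckAddGroup.of
  have hπ : ∀ t ∈ T, π t = 0 := fun t ht =>
    (QuotientAddGroup.eq_zero_iff _).2 (AddSubgroup.subset_closure ⟨t, ht, rfl⟩)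
  have key : ∃ n : ℤ, n ≠ 0 ∧ n • (π p - π q) = 0 := by
    by_contra! hcon
    have hi : Function.Injective (zmultiplesHom _ (π p - π q)) := by
      rw [injective_iff_map_eq_zero]
      intro n hn
      by_contra hn0
      exact hcon n hn0 (by simpa using hn)
    obtain ⟨L, hL⟩ := (Module.Baer.of_divisible ℚ).extension_property_addMonoidHom _ hi
      (Int.castAddHom ℚ)
    have h1 : L (π p - π q) = 1 := by simpa using DFunLike.congr_fun hL 1
    have h2 := h (L.comp π) fun t ht => by simp [hπ t ht]
    rw [map_sub] at h1
    simp only [AddMonoidHom.comp_apply] at h2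
    rw [h2, sub_self] at h1
    exact zero_ne_one h1
  obtain ⟨n, hn, e⟩ := key
  have e' : n.natAbs • (π p - π q) = 0 := by
    rcases Int.natAbs_eq n with h | h
    · rw [h, natCast_zsmul] at e
      exact e
    · rw [h, neg_smul, neg_eq_zero, natCast_zsmul] at e
      exact e
  have hk : 0 < n.natAbs := Int.natAbs_pos.2 hn
  refine hP.relMod_of_nsmul hT hk ?_
  have e2 :
      (GrothendieckAddGroup.of (n.natAbs • p) - GrothendieckAddGroup.of (n.natAbs • q)) ∈ N := by
    rw [← QuotientAddGroup.eq_zero_iff]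
    rw [nsmul_sub, ← map_nsmul, ← map_nsmul] at e'
    exact e'
  obtain ⟨t, ht, t', ht', e3⟩ := exists_of_mem_closure_image_of T e2
  refine ⟨t, ht, t', ht', of_eq_of_iff.1 ?_⟩
  rw [map_add, map_add, add_comm _ (GrothendieckAddGroup.of t')]
  exact sub_eq_sub_iff_add_eq_add.1 e3

end ToricFaces

/-! ### Functionals positive on a toric monoid -/

theorem exists_pos_add_mul {ι : Type*} [Finite ι] (x y : ι → ℚ) (hx : ∀ i, 0 < x i) :
    ∃ ε : ℚ, 0 < ε ∧ ∀ i, 0 < x i + ε * y i := by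
  have h : ∀ᶠ ε in 𝓝[>] (0 : ℚ), ∀ i, 0 < x i + ε * y i := by
    refine eventually_all.2 fun i => ?_
    have hc : Tendsto (fun ε : ℚ => x i + ε * y i) (𝓝[>] 0) (𝓝 (x i + 0 * y i)) :=
      (Continuous.tendsto (by fun_prop) 0).mono_left nhdsWithin_le_nhds
    refine hc.eventually_const_lt ?_
    simpa using hx i
  obtain ⟨ε, h1, h2⟩ := (h.and self_mem_nhdsWithin).exists
  exact ⟨ε, h2, h1⟩

/-- Gordan's alternative: finitely many vectors without a nontrivial nonnegative relation are
all positive on some functional.  The proof is by induction on the number of vectors: if the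
functional that is positive on all vectors but `a 0` is not positive on `a 0`, then the other
vectors have no nonnegative relation modulo `a 0` either. -/
theorem exists_dual_pos (n : ℕ) : ∀ (V : Type u) [AddCommGroup V] [Module ℚ V] (a : Fin n → V),
    (∀ c : Fin n → ℚ, (∀ i, 0 ≤ c i) → ∑ i, c i • a i = 0 → c = 0) →
      ∃ f : Module.Dual ℚ V, ∀ i, 0 < f (a i) := by
  induction n with
  | zero => exact fun V _ _ a _ => ⟨0, fun i => i.elim0⟩
  | succ n ih =>
    intro V _ _ a ha
    have htail : ∀ (e : ℚ) (d : Fin n → ℚ), 0 ≤ e → (∀ i, 0 ≤ d i) →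
        e • a 0 + ∑ i, d i • a i.succ = 0 → e = 0 ∧ d = 0 := by
      intro e d he hd h
      have h1 := ha (Fin.cons e d) (fun i => by refine Fin.cases ?_ ?_ i <;> simp [he, hd])
        (by simpa [Fin.sum_univ_succ] using h)
      exact ⟨by simpa using congrFun h1 0, funext fun i => by simpa using congrFun h1 i.succ⟩
    obtain ⟨f, hf⟩ := ih V (fun i => a i.succ) fun d hd h =>
      (htail 0 d le_rfl hd (by simpa using h)).2
    by_cases hf0 : 0 < f (a 0)
    · exact ⟨f, fun i => by refine Fin.cases hf0 hf i⟩
    push Not at hf0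
    let W := ℚ ∙ a 0
    obtain ⟨g, hg⟩ := ih (V ⧸ W) (fun i => W.mkQ (a i.succ)) fun d hd h => by
      have h1 : ∑ i, d i • a i.succ ∈ W := by
        rw [← Submodule.Quotient.mk_eq_zero, ← Submodule.mkQ_apply, map_sum]
        simpa using h
      obtain ⟨e, he⟩ := Submodule.mem_span_singleton.1 h1
      by_cases he0 : e ≤ 0
      · refine (htail (-e) d (by linarith) hd ?_).2
        rw [← he, neg_smul, neg_add_cancel]
      · have h2 := congrArg f he
        rw [map_smul, map_sum, smul_eq_mul] at h2
        have h3 : ∀ i ∈ Finset.univ, 0 ≤ f (d i • a i.succ) := fun i _ => by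
          rw [map_smul]
          exact mul_nonneg (hd i) (hf i).le
        have h4 : ∑ i, f (d i • a i.succ) = 0 :=
          le_antisymm (h2 ▸ mul_nonpos_of_nonneg_of_nonpos (by linarith) hf0)
            (Finset.sum_nonneg h3)
        funext i
        have h5 := (Finset.sum_eq_zero_iff_of_nonneg h3).1 h4 i (Finset.mem_univ i)
        rw [map_smul, smul_eq_mul] at h5
        exact (mul_eq_zero.1 h5).resolve_right (hf i).ne'
    have ha0 : a 0 ≠ 0 := by
      intro h0
      exact one_ne_zero (htail 1 0 zero_le_one (fun _ => le_rfl) (by simp [h0])).1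
    obtain ⟨h, hh⟩ : ∃ h : Module.Dual ℚ V, 0 < h (a 0) := by
      by_contra! hcon
      refine ha0 ((Module.forall_dual_apply_eq_zero_iff ℚ (a 0)).1 fun φ => ?_)
      have := hcon (-φ)
      rw [LinearMap.neg_apply] at this
      linarith [hcon φ]
    obtain ⟨ε, hε, hε'⟩ := exists_pos_add_mul (fun i : Fin n => g (W.mkQ (a i.succ)))
      (fun i : Fin n => h (a i.succ)) hg
    have hW : W.mkQ (a 0) = 0 :=
      (Submodule.Quotient.mk_eq_zero W).2 (Submodule.mem_span_singleton_self _)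
    refine ⟨g.comp W.mkQ + ε • h, fun i => ?_⟩
    refine Fin.cases ?_ (fun i => ?_) i
    · rw [LinearMap.add_apply, LinearMap.comp_apply, hW, map_zero, zero_add, LinearMap.smul_apply,
        smul_eq_mul]
      exact mul_pos hε hh
    · exact hε' i

section ToricFaces

variable {P : Type u} [AddCommMonoid P]

theorem nonneg_of_generators {A : Finset P} (hA : AddSubmonoid.closure (A : Set P) = ⊤)
    {w : P →+ ℚ} (h : ∀ a ∈ A, 0 ≤ w a) (p : P) : 0 ≤ w p := by
  have hp : p ∈ AddSubmonoid.closure (A : Set P) := hA ▸ AddSubmonoid.mem_top p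
  induction hp using AddSubmonoid.closure_induction with
  | mem a ha => exact h a ha
  | zero => exact (map_zero w).ge
  | add a b _ _ iha ihb => rw [map_add]; exact add_nonneg iha ihb

theorem eq_zero_of_generators {B : Type*} [AddMonoid B] {A : Finset P}
    (hA : AddSubmonoid.closure (A : Set P) = ⊤) {w : P →+ B} (h : ∀ a ∈ A, w a = 0) : w = 0 :=
  AddMonoidHom.eq_of_eqOn_denseM hA fun a ha => h a ha

theorem IsToric.finiteDimensional_annihilator (hP : IsToric P) (T : AddSubmonoid P) :
    FiniteDimensional ℚ (annihilator T) := by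
  obtain ⟨A, hA⟩ := hP.exists_generators
  let e : annihilator T →ₗ[ℚ] (A → ℚ) :=
    { toFun := fun w a => (w : P →+ ℚ) a
      map_add' := fun _ _ => rfl
      map_smul' := fun _ _ => rfl }
  refine FiniteDimensional.of_injective e ((injective_iff_map_eq_zero e).2 fun w hw => ?_)
  exact Subtype.ext (eq_zero_of_generators hA fun a ha => congrFun hw ⟨a, ha⟩)

/-- Every face of a toric monoid is the zero set of a nonnegative rational functional. -/
theorem IsToric.exists_rat_kernel_eq (hP : IsToric P) {T : AddSubmonoid P} (hT : IsFace T) :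
    ∃ w ∈ annihilator T, (∀ p, 0 ≤ w p) ∧ ∀ p, w p = 0 → p ∈ T := by
  classical
  obtain ⟨A, hA⟩ := hP.exists_generators
  have := hP.finiteDimensional_annihilator T
  let B := A.filter (· ∉ T)
  let ev : P → Module.Dual ℚ (annihilator T) := fun p =>
    { toFun := fun w => (w : P →+ ℚ) p
      map_add' := fun _ _ => rfl
      map_smul' := fun _ _ => rfl }
  let b : Fin B.card → P := fun i => (B.equivFin.symm i : P)
  have hb : ∀ i, b i ∉ T := fun i => (Finset.mem_filter.1 (B.equivFin.symm i).2).2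
  obtain ⟨f, hf⟩ := exists_dual_pos B.card (Module.Dual ℚ (annihilator T)) (fun i => ev (b i)) (by
    intro c hc h
    -- Clear the denominators of the relation to obtain an element of `P`.
    let D : ℕ := ∏ i, (c i).den
    have hD : 0 < D := Finset.prod_pos fun i _ => (c i).den_pos
    have hn : ∀ i, ∃ n : ℕ, (n : ℚ) = D * c i := by
      intro i
      obtain ⟨m, hm⟩ := Finset.dvd_prod_of_mem (fun i => (c i).den) (Finset.mem_univ i)
      refine ⟨m * (c i).num.toNat, ?_⟩
      have h1 : (((c i).num.toNat : ℤ) : ℚ) = (c i).num := by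
        rw [Int.toNat_of_nonneg (Rat.num_nonneg.2 (hc i))]
      have h2 : (D : ℚ) = (c i).den * m := by exact_mod_cast hm
      push_cast at h1 ⊢
      rw [h1, h2, ← Rat.den_mul_eq_num]
      ring
    choose n hn using hn
    have hq : ∑ i, n i • b i ∈ T := by
      refine hT.mem_of_relMod (hP.relMod_of_annihilator hT (q := 0) fun w hw => ?_) T.zero_mem
      have h1 := DFunLike.congr_fun h ⟨w, hw⟩
      have h2 : ∑ i, c i * w (b i) = 0 := by
        simpa [ev, LinearMap.sum_apply] using h1
      rw [map_sum, map_zero]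
      calc ∑ i, w (n i • b i) = ∑ i, D * (c i * w (b i)) := by
            refine Finset.sum_congr rfl fun i _ => ?_
            rw [map_nsmul, nsmul_eq_mul, hn i, mul_assoc]
        _ = 0 := by rw [← Finset.mul_sum, h2, mul_zero]
    funext i
    by_contra hci
    have hni : 0 < n i := by
      rw [Nat.pos_iff_ne_zero]
      intro h0
      have := hn i
      rw [h0, Nat.cast_zero, eq_comm, mul_eq_zero] at this
      exact this.elim (by exact_mod_cast hD.ne') hci
    exact hb i (hT.mem_of_nsmul_mem hni (hT.mem_of_sum_mem hq (Finset.mem_univ i))))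
  -- As `annihilator T` is finite dimensional, the functional `f` on its dual is an element of it.
  obtain ⟨w, hw⟩ := (Module.evalEquiv ℚ (annihilator T)).surjective f
  have hpos : ∀ a ∈ A, a ∉ T → 0 < (w : P →+ ℚ) a := by
    intro a ha haT
    have h1 := hf (B.equivFin ⟨a, Finset.mem_filter.2 ⟨ha, haT⟩⟩)
    rw [← hw] at h1
    simpa [ev, b] using h1
  have h0 : ∀ a ∈ A, 0 ≤ (w : P →+ ℚ) a := by
    intro a ha
    by_cases haT : a ∈ T
    · exact (w.2 a haT).ge
    · exact (hpos a ha haT).le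
  refine ⟨w, w.2, nonneg_of_generators hA h0, fun p hp => ?_⟩
  have hpA : p ∈ AddSubmonoid.closure (A : Set P) := hA ▸ AddSubmonoid.mem_top p
  revert hp
  induction hpA using AddSubmonoid.closure_induction with
  | mem a ha => exact fun h => by_contra fun haT => (hpos a ha haT).ne' h
  | zero => exact fun _ => T.zero_mem
  | add a b _ _ iha ihb =>
    intro h
    rw [map_add, add_eq_zero_iff_of_nonneg (nonneg_of_generators hA h0 a)
      (nonneg_of_generators hA h0 b)] at h
    exact T.add_mem (iha h.1) (ihb h.2)

/-- Clearing denominators of a nonnegative rational functional. -/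
theorem IsToric.exists_nat_multiple (hP : IsToric P) {w : P →+ ℚ} (hw : ∀ p, 0 ≤ w p) :
    ∃ (n : ℕ) (v : P →+ ℕ), 0 < n ∧ ∀ p, (v p : ℚ) = n * w p := by
  obtain ⟨A, hA⟩ := hP.exists_generators
  let D : ℕ := ∏ a ∈ A, (w a).den
  have hD : 0 < D := Finset.prod_pos fun a _ => (w a).den_pos
  have h : ∀ p, ∃ m : ℕ, (m : ℚ) = D * w p := by
    intro p
    have hp : p ∈ AddSubmonoid.closure (A : Set P) := hA ▸ AddSubmonoid.mem_top p
    induction hp using AddSubmonoid.closure_induction with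
    | mem a ha =>
      obtain ⟨m, hm⟩ := Finset.dvd_prod_of_mem (fun a => (w a).den) ha
      refine ⟨m * (w a).num.toNat, ?_⟩
      have h1 : (((w a).num.toNat : ℤ) : ℚ) = (w a).num := by
        rw [Int.toNat_of_nonneg (Rat.num_nonneg.2 (hw a))]
      have h2 : (D : ℚ) = (w a).den * m := by exact_mod_cast hm
      push_cast at h1 ⊢
      rw [h1, h2, ← Rat.den_mul_eq_num]
      ring
    | zero => exact ⟨0, by simp⟩
    | add a b _ _ iha ihb =>
      obtain ⟨m, hm⟩ := iha
      obtain ⟨m', hm'⟩ := ihb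
      exact ⟨m + m', by rw [map_add, mul_add, ← hm, ← hm', Nat.cast_add]⟩
  choose v hv using h
  refine ⟨D, ⟨⟨v, ?_⟩, fun p q => ?_⟩, hD, hv⟩
  · have := hv 0
    rw [map_zero, mul_zero] at this
    exact_mod_cast this
  · have : (v (p + q) : ℚ) = v p + v q := by rw [hv, hv, hv, map_add, mul_add]
    exact_mod_cast this

/-- Every face of a toric monoid is the kernel of a homomorphism to `ℕ`. -/
theorem IsToric.exists_kernel_eq (hP : IsToric P) {T : AddSubmonoid P} (hT : IsFace T) :
    ∃ v : P →+ ℕ, ∀ p, v p = 0 ↔ p ∈ T := by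
  obtain ⟨w, hw, h0, hker⟩ := hP.exists_rat_kernel_eq hT
  obtain ⟨n, v, hn, hv⟩ := hP.exists_nat_multiple h0
  refine ⟨v, fun p => ⟨fun h => hker p ?_, fun h => ?_⟩⟩
  · have := hv p
    rw [h, Nat.cast_zero, eq_comm, mul_eq_zero] at this
    exact this.resolve_left (by exact_mod_cast hn.ne')
  · have := hv p
    rw [hw p h, mul_zero] at this
    exact_mod_cast this

/-! ### Facets -/

/-- `v` identifies `P / T` with `ℕ`; for a face `T` this means that `T` is a facet and that `v` is
its primitive normal. -/
structure IsFacetNormal (T : AddSubmonoid P) (v : P →+ ℕ) : Prop where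
  surjective : Function.Surjective v
  eq_iff : ∀ p q, v p = v q ↔ RelMod T p q

/-- A facet has only one primitive normal, as `ℕ` has no automorphisms. -/
theorem IsFacetNormal.unique {T : AddSubmonoid P} {v v' : P →+ ℕ} (h : IsFacetNormal T v)
    (h' : IsFacetNormal T v') : v = v' := by
  obtain ⟨p, hp⟩ := h.surjective 1
  have h1 : ∀ q, v' q = v q * v' p := fun q => by
    have h2 : v q = v (v q • p) := by rw [map_nsmul, hp, smul_eq_mul, mul_one]
    rw [(h'.eq_iff _ _).2 ((h.eq_iff _ _).1 h2), map_nsmul, smul_eq_mul]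
  obtain ⟨q, hq⟩ := h'.surjective 1
  have h2 : v' p = 1 := Nat.eq_one_of_mul_eq_one_left (h1 q ▸ hq)
  ext q
  rw [h1, h2, mul_one]

/-- A nonnegative functional spanning an extremal ray of the cone of nonnegative functionals that
vanish on `T`. -/
structure IsExtremal (T : AddSubmonoid P) (u : P →+ ℚ) : Prop where
  mem : u ∈ annihilator T
  nonneg : ∀ p, 0 ≤ u p
  ne_zero : u ≠ 0
  eq_smul : ∀ w : P →+ ℚ, (∀ p, u p = 0 → w p = 0) → ∃ c : ℚ, w = c • u

/-- An extremal functional is a multiple of the primitive normal of a facet. -/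
theorem IsExtremal.exists_facetNormal (hP : IsToric P) {T : AddSubmonoid P} {u : P →+ ℚ}
    (hu : IsExtremal T u) : ∃ (F : AddSubmonoid P) (v : P →+ ℕ), IsFace F ∧ T ≤ F ∧
      IsFacetNormal F v ∧ ∃ c : ℚ, ∀ p, u p = c * v p := by
  have := hP.integral
  let F := AddMonoidHom.mker u
  have hF : IsFace F := isFace_kernel u hu.nonneg
  have hTF : T ≤ F := fun t ht => hu.mem t ht
  have hrel : ∀ p q, u p = u q → RelMod F p q := fun p q h =>
    hP.relMod_of_annihilator hF fun w hw => by
      obtain ⟨c, rfl⟩ := hu.eq_smul w fun p hp => hw p hp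
      simp [h]
  obtain ⟨n, v₁, hn, hv₁⟩ := hP.exists_nat_multiple hu.nonneg
  have hn' : (n : ℚ) ≠ 0 := by exact_mod_cast hn.ne'
  have huv : ∀ p q, v₁ p = v₁ q → u p = u q := fun p q h =>
    mul_left_cancel₀ hn' (by rw [← hv₁, ← hv₁, h])
  have hvu : ∀ p, u p = 0 → v₁ p = 0 := fun p h => by
    have := hv₁ p
    rw [h, mul_zero] at this
    exact_mod_cast this
  -- The smallest positive value of `v₁` divides all others, by saturation.
  have hex : ∃ m, 0 < m ∧ ∃ p, v₁ p = m := by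
    by_contra! hcon
    refine hu.ne_zero (AddMonoidHom.ext fun p => ?_)
    have h0 : v₁ p = v₁ 0 := by
      rw [map_zero]
      by_contra h
      exact hcon _ (Nat.pos_of_ne_zero h) p rfl
    rw [huv _ _ h0, map_zero, AddMonoidHom.zero_apply]
  classical
  obtain ⟨hm, p₀, hp₀⟩ := Nat.find_spec hex
  set m := Nat.find hex with hmdef
  have hdvd : ∀ p, m ∣ v₁ p := by
    intro p
    have h1 : v₁ (m • p) = v₁ (v₁ p • p₀) := by
      rw [map_nsmul, map_nsmul, hp₀, smul_eq_mul, smul_eq_mul, mul_comm]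
    obtain ⟨t, ht, t', ht', e⟩ := hrel _ _ (huv _ _ h1)
    have h2 : m • (p + t) = m • ((v₁ p / m) • p₀) + ((v₁ p % m) • p₀ + t' + (m - 1) • t) := by
      have h3 : m • t = t + (m - 1) • t := by
        conv_lhs => rw [← Nat.sub_add_cancel hm, succ_nsmul']
      have h4 : v₁ p • p₀ = m • ((v₁ p / m) • p₀) + (v₁ p % m) • p₀ := by
        rw [smul_smul, ← add_smul, Nat.div_add_mod]
      rw [nsmul_add, h3, ← add_assoc, e, h4]
      simp only [add_assoc]
    obtain ⟨d, hd⟩ := hP.saturated _ _ _ _ hm h2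
    have h5 := congrArg v₁ hd
    rw [map_add, map_add, map_nsmul, hp₀, hvu t ht, smul_eq_mul, add_zero] at h5
    have h6 : v₁ d = v₁ p % m := by
      have := Nat.div_add_mod (v₁ p) m
      rw [mul_comm] at this
      omega
    rw [Nat.dvd_iff_mod_eq_zero]
    by_contra h7
    exact Nat.find_min hex (h6 ▸ Nat.mod_lt _ hm) ⟨h6 ▸ Nat.pos_of_ne_zero h7, d, rfl⟩
  let v : P →+ ℕ :=
    { toFun := fun p => v₁ p / m
      map_zero' := by rw [map_zero, Nat.zero_div]
      map_add' := fun p q => by rw [map_add, Nat.add_div_of_dvd_right (hdvd p)] }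
  have hv : ∀ p, v₁ p = m * v p := fun p => (Nat.mul_div_cancel' (hdvd p)).symm
  refine ⟨F, v, hF, hTF, ⟨fun k => ⟨k • p₀, ?_⟩, fun p q => ⟨fun h => ?_, fun h => ?_⟩⟩,
    m / n, fun p => ?_⟩
  · rw [map_nsmul, smul_eq_mul]
    have : v p₀ = 1 := by
      show v₁ p₀ / m = 1
      rw [hp₀, Nat.div_self hm]
    rw [this, mul_one]
  · exact hrel p q (huv p q (by rw [hv, hv, h]))
  · refine h.map_eq v fun t ht => ?_
    show v₁ t / m = 0
    rw [hvu t ht, Nat.zero_div]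
  · have h1 := hv₁ p
    rw [hv, Nat.cast_mul] at h1
    field_simp
    linarith

/-- Nonnegative functionals are combinations of extremal ones.  If `v` is not extremal, then some
`w` which vanishes where `v` does is not a multiple of `v`.  Subtracting from `w` and then from
`v` multiples as large as nonnegativity permits writes `v` as a combination of two nonnegative
functionals, each vanishing at more generators than `v`. -/
theorem IsToric.mem_span_extremal (hP : IsToric P) (T : AddSubmonoid P) {v : P →+ ℚ}
    (hv : v ∈ annihilator T) (h0 : ∀ p, 0 ≤ v p) :
    v ∈ Submodule.span ℚ {u | IsExtremal T u} := by
  classical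
  obtain ⟨A, hA⟩ := hP.exists_generators
  induction hk : (A.filter (v · ≠ 0)).card using Nat.strong_induction_on generalizing v with
  | _ k ih =>
  subst hk
  by_cases hv0 : v = 0
  · rw [hv0]
    exact zero_mem _
  by_cases hext : IsExtremal T v
  · exact Submodule.subset_span hext
  obtain ⟨w, hw, hwc⟩ : ∃ w : P →+ ℚ, (∀ p, v p = 0 → w p = 0) ∧ ∀ c : ℚ, w ≠ c • v := by
    by_contra! hcon
    exact hext ⟨hv, h0, hv0, hcon⟩
  have hne : ∀ z : P →+ ℚ, (∀ p, 0 ≤ z p) → z ≠ 0 → (A.filter (0 < z ·)).Nonempty := by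
    intro z hz hz0
    by_contra hcon
    rw [Finset.not_nonempty_iff_eq_empty, Finset.filter_eq_empty_iff] at hcon
    exact hz0 (eq_zero_of_generators hA fun a ha => le_antisymm (not_lt.1 (hcon ha)) (hz a))
  obtain ⟨a₀, ha₀, hs⟩ := (A.filter (0 < v ·)).exists_min_image (fun a => w a / v a)
    (hne v h0 hv0)
  rw [Finset.mem_filter] at ha₀
  set s := w a₀ / v a₀ with hsdef
  let w' : P →+ ℚ := w - s • v
  have hw'p : ∀ p, w' p = w p - s * v p := fun p => rfl
  have hw'0 : ∀ p, v p = 0 → w' p = 0 := fun p hp => by rw [hw'p, hw p hp, hp]; ring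
  have hw'ne : w' ≠ 0 := fun h => hwc s (sub_eq_zero.1 h)
  have hw'pos : ∀ p, 0 ≤ w' p := nonneg_of_generators hA fun a ha => by
    rcases (h0 a).eq_or_lt with h | h
    · exact (hw'0 a h.symm).ge
    · have h1 := hs a (Finset.mem_filter.2 ⟨ha, h⟩)
      rw [le_div_iff₀ h] at h1
      rw [hw'p]
      linarith
  have hw'a : w' a₀ = 0 := by
    rw [hw'p, hsdef, div_mul_cancel₀ _ ha₀.2.ne', sub_self]
  obtain ⟨a₁, ha₁, ht⟩ := (A.filter (0 < w' ·)).exists_min_image (fun a => v a / w' a)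
    (hne w' hw'pos hw'ne)
  rw [Finset.mem_filter] at ha₁
  set t := v a₁ / w' a₁ with htdef
  let v' : P →+ ℚ := v - t • w'
  have hv'p : ∀ p, v' p = v p - t * w' p := fun p => rfl
  have hv'pos : ∀ p, 0 ≤ v' p := nonneg_of_generators hA fun a ha => by
    rcases (hw'pos a).eq_or_lt with h | h
    · rw [hv'p, ← h, mul_zero, sub_zero]
      exact h0 a
    · have h1 := ht a (Finset.mem_filter.2 ⟨ha, h⟩)
      rw [le_div_iff₀ h] at h1
      rw [hv'p]
      linarith
  have hv'a : v' a₁ = 0 := by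
    rw [hv'p, htdef, div_mul_cancel₀ _ ha₁.2.ne', sub_self]
  have hva₁ : v a₁ ≠ 0 := fun h => ha₁.2.ne' (hw'0 a₁ h)
  have hcard : ∀ z : P →+ ℚ, (∀ p, v p = 0 → z p = 0) → ∀ a ∈ A, v a ≠ 0 → z a = 0 →
      (A.filter (z · ≠ 0)).card < (A.filter (v · ≠ 0)).card := by
    intro z hz a ha hva hza
    refine Finset.card_lt_card ⟨fun b hb => ?_, fun hsub => ?_⟩
    · rw [Finset.mem_filter] at hb ⊢
      exact ⟨hb.1, fun h => hb.2 (hz b h)⟩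
    · exact (Finset.mem_filter.1 (hsub (Finset.mem_filter.2 ⟨ha, hva⟩))).2 hza
  have h1 := ih _ (hcard w' hw'0 a₀ ha₀.1 ha₀.2.ne' hw'a) (v := w')
    (fun p hp => hw'0 p (hv p hp)) hw'pos rfl
  have h2 := ih _ (hcard v' (fun p hp => by rw [hv'p, hw'0 p hp, hp]; ring) a₁ ha₁.1 hva₁ hv'a)
    (v := v') (fun p hp => by rw [hv'p, hw'0 p (hv p hp), hv p hp]; ring) hv'pos rfl
  have h3 : v = v' + t • w' := by simp [v']
  rw [h3]
  exact add_mem h2 (Submodule.smul_mem _ _ h1)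

/-- The primitive normals of the facets that contain a face `T` separate the points of `P / T`. -/
theorem IsToric.relMod_of_facetNormal (hP : IsToric P) {T : AddSubmonoid P} (hT : IsFace T)
    {p q : P} (h : ∀ (F : AddSubmonoid P) (v : P →+ ℕ), IsFace F → T ≤ F → IsFacetNormal F v →
      v p = v q) : RelMod T p q := by
  let E : Submodule ℚ (P →+ ℚ) :=
    { carrier := {w | w p = w q}
      zero_mem' := rfl
      add_mem' := fun {a b} (ha : a p = a q) (hb : b p = b q) => by
        rw [mem_ofPred_eq, AddMonoidHom.add_apply, AddMonoidHom.add_apply, ha, hb]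
      smul_mem' := fun c w (hw : w p = w q) => congrArg (c • ·) hw }
  have hE : Submodule.span ℚ {u | IsExtremal T u} ≤ E := Submodule.span_le.2 fun u hu => by
    obtain ⟨F, v, hF, hTF, hv, c, hc⟩ := IsExtremal.exists_facetNormal hP hu
    show u p = u q
    rw [hc, hc, h F v hF hTF hv]
  have hnn : ∀ w ∈ annihilator T, (∀ p, 0 ≤ w p) → w ∈ E := fun w hw hw0 =>
    hE (hP.mem_span_extremal T hw hw0)
  -- Every functional is the difference of two nonnegative ones, as `w₀` is positive off `T`.
  obtain ⟨A, hA⟩ := hP.exists_generators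
  obtain ⟨w₀, hw₀, hpos, hker⟩ := hP.exists_rat_kernel_eq hT
  refine hP.relMod_of_annihilator hT fun w hw => ?_
  obtain ⟨N, hN0, hN⟩ : ∃ N : ℚ, 0 ≤ N ∧ ∀ a ∈ A, |w a| / w₀ a ≤ N :=
    ⟨∑ a ∈ A, |w a| / w₀ a, Finset.sum_nonneg fun a _ => div_nonneg (abs_nonneg _) (hpos a),
      fun a ha => Finset.single_le_sum (f := fun a => |w a| / w₀ a)
        (fun a _ => div_nonneg (abs_nonneg _) (hpos a)) ha⟩
  have h1 : w + N • w₀ ∈ E := by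
    refine hnn _ (add_mem hw (Submodule.smul_mem _ _ hw₀)) (nonneg_of_generators hA fun a ha => ?_)
    show 0 ≤ w a + N * w₀ a
    rcases (hpos a).eq_or_lt with h0 | h0
    · rw [hw a (hker a h0.symm), ← h0, mul_zero, add_zero]
    · have h2 := hN a ha
      rw [div_le_iff₀ h0] at h2
      linarith [neg_abs_le (w a)]
  have h2 : w ∈ E := by
    have := sub_mem h1 (Submodule.smul_mem E N (hnn w₀ hw₀ hpos))
    rwa [add_sub_cancel_right] at this
  exact h2

end ToricFaces

/-! ### Duals and quotients of toric monoids -/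

section Duals

variable {W : Type u} [AddCommMonoid W]

/-- If a homomorphism to `ℕ` is dominated by another, the difference is a homomorphism. -/
theorem exists_eq_add_of_le {w w' : W →+ ℕ} (h : ∀ x, w' x ≤ w x) : ∃ d : W →+ ℕ, w = w' + d := by
  refine ⟨⟨⟨fun x => w x - w' x, by simp⟩, fun x y => ?_⟩, AddMonoidHom.ext fun x => ?_⟩
  · have h1 := h x
    have h2 := h y
    simp only [map_add]
    omega
  · exact (Nat.add_sub_cancel' (h x)).symm

/-- If `w'` vanishes where `w` does, then it is dominated by a multiple of `w`. -/
theorem exists_nsmul_eq_add (hW : AddMonoid.FG W) {w w' : W →+ ℕ}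
    (h : ∀ x, w x = 0 → w' x = 0) : ∃ (n : ℕ) (d : W →+ ℕ), n • w = w' + d := by
  obtain ⟨A, hA⟩ := hW.fg_top
  obtain ⟨n, hn⟩ : ∃ n, ∀ a ∈ A, w' a ≤ n :=
    ⟨∑ a ∈ A, w' a, fun a ha => Finset.single_le_sum (f := fun a => w' a) (fun _ _ => zero_le) ha⟩
  refine ⟨n, exists_eq_add_of_le fun x => ?_⟩
  have hx : x ∈ AddSubmonoid.closure (A : Set W) := hA ▸ AddSubmonoid.mem_top x
  rw [AddMonoidHom.nsmul_apply, smul_eq_mul]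
  induction hx using AddSubmonoid.closure_induction with
  | mem a ha =>
    rcases Nat.eq_zero_or_pos (w a) with h0 | h0
    · rw [h a h0]
      exact zero_le
    · exact (hn a ha).trans (Nat.le_mul_of_pos_right n h0)
  | zero => simp
  | add a b _ _ iha ihb =>
    rw [map_add, map_add, mul_add]
    exact add_le_add iha ihb

theorem mem_face_of_vanishing (hW : AddMonoid.FG W) {S : AddSubmonoid (W →+ ℕ)} (hS : IsFace S)
    {w w' : W →+ ℕ} (hw : w ∈ S) (h : ∀ x, w x = 0 → w' x = 0) : w' ∈ S := by
  obtain ⟨n, d, e⟩ := exists_nsmul_eq_add hW h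
  exact (hS w' d (e ▸ S.nsmul_mem hw n)).1

/-- A face of the dual has an element whose zeros are the common zeros of all its elements. -/
theorem exists_mem_forall_vanishing (hW : AddMonoid.FG W) (S : AddSubmonoid (W →+ ℕ)) :
    ∃ w ∈ S, ∀ x, w x = 0 → ∀ s ∈ S, s x = 0 := by
  classical
  obtain ⟨A, hA⟩ := hW.fg_top
  have h : ∀ a : W, ∃ s ∈ S, s a = 0 → ∀ s' ∈ S, s' a = 0 := by
    intro a
    by_cases ha : ∃ s ∈ S, s a ≠ 0
    · obtain ⟨s, hs, hsa⟩ := ha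
      exact ⟨s, hs, fun h => absurd h hsa⟩
    · push Not at ha
      exact ⟨0, S.zero_mem, fun _ => ha⟩
  choose s hs hs' using h
  refine ⟨∑ a ∈ A, s a, S.sum_mem fun a _ => hs a, fun x hx s' hs'S => ?_⟩
  have hxA : x ∈ AddSubmonoid.closure (A : Set W) := hA ▸ AddSubmonoid.mem_top x
  revert hx
  induction hxA using AddSubmonoid.closure_induction with
  | mem a ha =>
    intro h
    rw [AddMonoidHom.finsetSum_apply, Finset.sum_eq_zero_iff] at h
    exact hs' a (h a ha) s' hs'S
  | zero => exact fun _ => map_zero s'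
  | add a b _ _ iha ihb =>
    intro h
    rw [map_add, Nat.add_eq_zero_iff] at h
    rw [map_add, iha h.1, ihb h.2]

/-- An element of the dual is in the interior if and only if it vanishes only where all elements
vanish. -/
theorem mem_monoidInterior_dual_iff (hW : AddMonoid.FG W) (w : W →+ ℕ) :
    w ∈ monoidInterior (W →+ ℕ) ↔ ∀ x, w x = 0 → ∀ w' : W →+ ℕ, w' x = 0 := by
  refine ⟨fun h x hx => ?_, fun h S hS hne hw => hne (top_unique fun w' _ =>
    mem_face_of_vanishing hW hS hw fun x hx => h x hx w')⟩
  by_contra hcon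
  push Not at hcon
  obtain ⟨w', hw'⟩ := hcon
  refine h (AddMonoidHom.mker (AddMonoidHom.eval x)) (isFace_kernel _ fun _ => zero_le)
    (fun htop => hw' ?_) hx
  have : w' ∈ AddMonoidHom.mker (AddMonoidHom.eval (N := ℕ) x) := htop ▸ AddSubmonoid.mem_top w'
  exact this

/-- The dual of a finitely generated monoid is toric. -/
theorem isToric_dual (hW : AddMonoid.FG W) : IsToric (W →+ ℕ) where
  fg := by
    obtain ⟨A, hA⟩ := hW.fg_top
    let ρ : (W →+ ℕ) →+ (A → ℕ) :=
      { toFun := fun w a => w a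
        map_zero' := rfl
        map_add' := fun _ _ => rfl }
    have hρ : Function.Injective ρ := fun w w' h =>
      AddMonoidHom.eq_of_eqOn_denseM hA fun a ha => congrFun h ⟨a, ha⟩
    have hfg : (AddMonoidHom.mrange ρ).FG := by
      refine AddSubmonoid.fg_of_subtractive ?_
      rintro _ ⟨w, rfl⟩ y ⟨w', hw'⟩
      obtain ⟨d, hd⟩ := exists_eq_add_of_le (w := w') (w' := w) fun x => by
        have hx : x ∈ AddSubmonoid.closure (A : Set W) := hA ▸ AddSubmonoid.mem_top x
        induction hx using AddSubmonoid.closure_induction with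
        | mem a ha =>
          have : w' a = w a + y ⟨a, ha⟩ := congrFun hw' ⟨a, ha⟩
          omega
        | zero => simp
        | add a b _ _ iha ihb =>
          rw [map_add, map_add]
          exact add_le_add iha ihb
      refine ⟨d, add_left_cancel (a := ρ w) ?_⟩
      rw [← map_add, ← hd, hw']
    have := (AddMonoid.fg_iff_addSubmonoid_fg _).2 hfg
    let e := AddEquiv.ofBijective ρ.mrangeRestrict
      ⟨fun w w' h => hρ (congrArg Subtype.val h), ρ.mrangeRestrict_surjective⟩
    exact AddMonoid.fg_of_surjective e.symm.toAddMonoidHom e.symm.surjective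
  integral := inferInstance
  torsionFree := ⟨fun n hn a b h => AddMonoidHom.ext fun x => by
    have := DFunLike.congr_fun h x
    exact Nat.eq_of_mul_eq_mul_left (Nat.pos_of_ne_zero hn) this⟩
  saturated := fun n a b c hn h => by
    refine exists_eq_add_of_le fun x => ?_
    have h1 : n * a x = n * b x + c x := DFunLike.congr_fun h x
    exact Nat.le_of_mul_le_mul_left (h1 ▸ Nat.le_add_right _ _) hn

variable {P : Type u} [AddCommMonoid P]

/-- The quotient of a toric monoid by a face is toric. -/
theorem IsToric.of_quotient (hP : IsToric P) {T : AddSubmonoid P} (hT : IsFace T) {π : P →+ W}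
    (hs : Function.Surjective π) (hπ : ∀ p q, π p = π q ↔ RelMod T p q) : IsToric W := by
  have := hP.integral
  have := hP.fg
  have hπT : ∀ t ∈ T, π t = 0 := fun t ht => by
    rw [← map_zero π, hπ]
    exact ⟨0, T.zero_mem, t, ht, by rw [add_zero, zero_add]⟩
  have hcancel : ∀ a b c : W, a + b = a + c → b = c := by
    intro a b c h
    obtain ⟨a, rfl⟩ := hs a
    obtain ⟨b, rfl⟩ := hs b
    obtain ⟨c, rfl⟩ := hs c
    rw [← map_add, ← map_add, hπ] at h
    obtain ⟨t, ht, t', ht', e⟩ := h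
    rw [add_assoc, add_assoc] at e
    exact (hπ _ _).2 ⟨t, ht, t', ht', add_left_cancel e⟩
  refine ⟨AddMonoid.fg_of_surjective π hs, ?_, ⟨fun n hn a b h => ?_⟩, fun n a b c hn h => ?_⟩
  · exact
      { add_left_cancel := fun a b c h => hcancel a b c h
        add_right_cancel := fun a b c h => hcancel a b c (by simpa only [add_comm a] using h) }
  · obtain ⟨a, rfl⟩ := hs a
    obtain ⟨b, rfl⟩ := hs b
    change n • π a = n • π b at h
    rw [← map_nsmul, ← map_nsmul, hπ] at h
    exact (hπ _ _).2 (hP.relMod_of_nsmul hT (Nat.pos_of_ne_zero hn) h)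
  · obtain ⟨a, rfl⟩ := hs a
    obtain ⟨b, rfl⟩ := hs b
    obtain ⟨c, rfl⟩ := hs c
    rw [← map_nsmul, ← map_nsmul, ← map_add, hπ] at h
    obtain ⟨t, ht, t', ht', e⟩ := h
    have h2 : n • (a + t) = n • b + (c + t' + (n - 1) • t) := by
      have h3 : n • t = t + (n - 1) • t := by
        conv_lhs => rw [← Nat.sub_add_cancel hn, succ_nsmul']
      rw [nsmul_add, h3, ← add_assoc, e]
      simp only [add_assoc]
    obtain ⟨d, hd⟩ := hP.saturated _ _ _ _ hn h2
    refine ⟨π d, ?_⟩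
    rw [← map_add, ← hd, map_add, hπT t ht, add_zero]

/-! ### Ranks of quotients -/

/-- The rank of the group completion of `P / S`. -/
noncomputable def corank (S : AddSubmonoid P) : ℕ :=
  Module.finrank ℤ (GrothendieckAddGroup P ⧸
    Submodule.span ℤ (GrothendieckAddGroup.of '' (S : Set P)))

theorem exists_of_mem_span_image_of (T : AddSubmonoid P) {x : GrothendieckAddGroup P}
    (hx : x ∈ Submodule.span ℤ (GrothendieckAddGroup.of '' (T : Set P))) :
    ∃ t ∈ T, ∃ t' ∈ T, x = GrothendieckAddGroup.of t' - GrothendieckAddGroup.of t := by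
  refine exists_of_mem_closure_image_of T ?_
  rw [← Submodule.span_int_eq_addSubgroupClosure]
  exact hx

theorem monoidDim_eq_corank [IsCancelAdd P] {S : AddSubmonoid P} {π : P →+ W}
    (hs : Function.Surjective π) (hπ : ∀ p q, π p = π q ↔ RelMod S p q) :
    monoidDim W = corank S := by
  let φ : GrothendieckAddGroup P →+ GrothendieckAddGroup W :=
    GrothendieckAddGroup.lift (GrothendieckAddGroup.of.comp π)
  have hφ : ∀ p, φ (GrothendieckAddGroup.of p) = GrothendieckAddGroup.of (π p) := fun p =>
    DFunLike.congr_fun (GrothendieckAddGroup.lift.symm_apply_apply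
      (GrothendieckAddGroup.of.comp π)) p
  have hφs : Function.Surjective φ := by
    intro y
    obtain ⟨a, b, rfl⟩ := exists_eq_of_sub_of y
    obtain ⟨a, rfl⟩ := hs a
    obtain ⟨b, rfl⟩ := hs b
    exact ⟨GrothendieckAddGroup.of a - GrothendieckAddGroup.of b, by rw [map_sub, hφ, hφ]⟩
  have hker : LinearMap.ker φ.toIntLinearMap =
      Submodule.span ℤ (GrothendieckAddGroup.of '' (S : Set P)) := by
    refine le_antisymm (fun x hx => ?_) (Submodule.span_le.2 ?_)
    · obtain ⟨a, b, rfl⟩ := exists_eq_of_sub_of x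
      have h1 : φ (GrothendieckAddGroup.of a - GrothendieckAddGroup.of b) = 0 := hx
      rw [map_sub, hφ, hφ, sub_eq_zero] at h1
      obtain ⟨c, hc⟩ := (AddLocalization.addMonoidOf (⊤ : AddSubmonoid W)).exists_of_eq h1
      obtain ⟨c', hc'⟩ := hs c
      rw [← hc', ← map_add, ← map_add, hπ] at hc
      obtain ⟨t, ht, t', ht', e⟩ := hc
      rw [add_assoc, add_assoc] at e
      have e' := congrArg GrothendieckAddGroup.of (add_left_cancel e)
      rw [map_add, map_add, add_comm _ (GrothendieckAddGroup.of t')] at e'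
      rw [sub_eq_sub_iff_add_eq_add.2 e']
      exact sub_mem (Submodule.subset_span ⟨t', ht', rfl⟩) (Submodule.subset_span ⟨t, ht, rfl⟩)
    · rintro _ ⟨s, hsS, rfl⟩
      show φ _ = 0
      rw [hφ, (hπ s 0).2 ⟨0, S.zero_mem, s, hsS, by rw [add_zero, zero_add]⟩, map_zero, map_zero]
  rw [corank, ← hker]
  exact (LinearEquiv.finrank_eq (φ.toIntLinearMap.quotKerEquivOfSurjective hφs)).symm

/-- The corank of a face determines it among the faces containing it. -/
theorem corank_lt_of_lt (hP : IsToric P) {S S' : AddSubmonoid P} (hS : IsFace S) (h : S < S') :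
    corank S' < corank S := by
  have := hP.integral
  have := hP.fg
  have hfin : Module.Finite ℤ (GrothendieckAddGroup P) :=
    Module.Finite.iff_addGroup_fg.2 (AddGroup.fg_iff_addMonoid_fg.2 inferInstance)
  obtain ⟨hle, hnle⟩ := h
  obtain ⟨p, hp, hpS⟩ := SetLike.not_le_iff_exists.1 hnle
  set N := Submodule.span ℤ (GrothendieckAddGroup.of '' (S : Set P)) with hN
  set N' := Submodule.span ℤ (GrothendieckAddGroup.of '' (S' : Set P)) with hN'
  have hNN : N ≤ N' := Submodule.span_mono (image_mono hle)
  have h1 := Submodule.finrank_quotient_add_finrank N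
  have h2 := Submodule.finrank_quotient_add_finrank N'
  have h3 := Submodule.finrank_quotient_add_finrank (Submodule.submoduleOf N N')
  have h4 : Module.finrank ℤ (Submodule.submoduleOf N N') = Module.finrank ℤ N :=
    LinearEquiv.finrank_eq (Submodule.submoduleOfEquivOfLe hNN)
  have h5 : Module.finrank ℤ (N' ⧸ Submodule.submoduleOf N N') ≠ 0 := by
    intro h0
    rw [Module.finrank_eq_zero_iff_isTorsion] at h0
    have hpN : GrothendieckAddGroup.of p ∈ N' := Submodule.subset_span ⟨p, hp, rfl⟩
    obtain ⟨⟨n, hn⟩, hn'⟩ := @h0 (Submodule.Quotient.mk ⟨_, hpN⟩)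
    have hn0 : n ≠ 0 := nonZeroDivisors.ne_zero hn
    change n • Submodule.Quotient.mk (p := Submodule.submoduleOf N N')
      (⟨_, hpN⟩ : N') = 0 at hn'
    rw [← Submodule.Quotient.mk_smul, Submodule.Quotient.mk_eq_zero] at hn'
    have hn1 : n • GrothendieckAddGroup.of p ∈ N := hn'
    have hn2 : (n.natAbs : ℤ) • GrothendieckAddGroup.of p ∈ N := by
      rcases Int.natAbs_eq n with h | h
      · rwa [← h]
      · have h6 := N.neg_mem hn1
        rwa [← neg_smul, (show -n = (n.natAbs : ℤ) by omega)] at h6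
    rw [natCast_zsmul, ← map_nsmul] at hn2
    obtain ⟨t, ht, t', ht', e⟩ := exists_of_mem_span_image_of S hn2
    rw [eq_sub_iff_add_eq, ← map_add, of_eq_of_iff] at e
    exact hpS (hS.mem_of_nsmul_mem (Int.natAbs_pos.2 hn0) (hS _ t (e ▸ ht')).1)
  rw [corank, corank, ← hN, ← hN']
  omega

end Duals

/-! ### Supports of points of model spaces -/

section ModelSpaces

variable {P : Type u} [AddCommMonoid P]

theorem coord_nonneg (p : P) (x : Model P) : 0 ≤ coord p x := NNReal.coe_nonneg _

/-- The point of `X_P` with prescribed coordinates. -/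
def Model.ofCoord (f : P → ℝ) (h : ∀ p, 0 ≤ f p) (h0 : f 0 = 1)
    (hadd : ∀ p q, f (p + q) = f p * f q) : Model P :=
  show Multiplicative P →* NNReal from
    { toFun := fun p => ⟨f p.toAdd, h _⟩
      map_one' := NNReal.eq h0
      map_mul' := fun p q => NNReal.eq (hadd p.toAdd q.toAdd) }

theorem tendsto_model_iff {α : Type*} {l : Filter α} {γ : α → Model P} {z : Model P} :
    Tendsto γ l (𝓝 z) ↔ ∀ p, Tendsto (fun t => coord p (γ t)) l (𝓝 (coord p z)) := by
  rw [nhds_induced, tendsto_comap_iff, tendsto_pi_nhds]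
  rfl

theorem continuous_model_iff {α : Type*} [TopologicalSpace α] {γ : α → Model P} :
    Continuous γ ↔ ∀ p, Continuous fun t => coord p (γ t) := by
  rw [continuous_induced_rng, continuous_pi_iff]
  rfl

/-- The support of a point of `X_P`: the elements of `P` on which it does not vanish. -/
def supp (x : Model P) : AddSubmonoid P where
  carrier := {p | coord p x ≠ 0}
  zero_mem' := by rw [mem_ofPred_eq, coord_zero]; exact one_ne_zero
  add_mem' := fun {p q} hp hq => by rw [mem_ofPred_eq, coord_add]; exact mul_ne_zero hp hq

theorem mem_supp {x : Model P} {p : P} : p ∈ supp x ↔ coord p x ≠ 0 := Iff.rfl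

theorem coord_pos_iff {x : Model P} {p : P} : 0 < coord p x ↔ p ∈ supp x :=
  (coord_nonneg p x).lt_iff_ne'.trans Iff.rfl

theorem coord_eq_zero {x : Model P} {p : P} (h : p ∉ supp x) : coord p x = 0 :=
  not_not.1 h

theorem isFace_supp (x : Model P) : IsFace (supp x) := by
  intro p q h
  rw [mem_supp, coord_add] at h
  exact ⟨left_ne_zero_of_mul h, right_ne_zero_of_mul h⟩

theorem isOpen_le_supp {T : AddSubmonoid P} (hT : T.FG) : IsOpen {x : Model P | T ≤ supp x} := by
  obtain ⟨A, rfl⟩ := hT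
  have : {x : Model P | AddSubmonoid.closure (A : Set P) ≤ supp x} =
      ⋂ a ∈ A, {x | coord a x ≠ 0} := by
    ext x
    simp only [mem_ofPred_eq, AddSubmonoid.closure_le, mem_iInter]
    rfl
  rw [this]
  exact isOpen_biInter_finset fun a _ => isOpen_ne_fun (continuous_coord a) continuous_const

theorem eventually_supp_le (hP : IsToric P) (x : Model P) : ∀ᶠ y in 𝓝 x, supp x ≤ supp y :=
  (isOpen_le_supp ((isFace_supp x).fg hP)).mem_nhds (le_refl (supp x))

/-- A curve `t ↦ E t^v` through points with support `T`, tending to a point `x` whose support is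
the zero set of `v`. -/
theorem exists_curve (hP : IsToric P) (x : Model P) {T : AddSubmonoid P} (hT : IsFace T)
    (hxT : supp x ≤ T) {v : P →+ ℕ} (hv : ∀ p, v p = 0 ↔ p ∈ supp x) :
    ∃ (E : P → ℝ) (γ : ℝ → Model P), (∀ p, 0 < E p) ∧
      (∀ t p, p ∈ T → coord p (γ t) = E p * |t| ^ v p) ∧ (∀ t p, p ∉ T → coord p (γ t) = 0) ∧
        Tendsto γ (𝓝[>] 0) (𝓝 x) := by
  classical
  have := hP.integral
  let l : supp x →+ ℝ :=
    { toFun := fun s => Real.log (coord (s : P) x)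
      map_zero' := by simp [coord_zero]
      map_add' := fun s s' => by
        rw [AddSubmonoid.coe_add, coord_add]
        exact Real.log_mul s.2 s'.2 }
  obtain ⟨L, hL⟩ := exists_extension (supp x) l
  have hE : ∀ p ∈ supp x, Real.exp (L p) = coord p x := fun p hp => by
    rw [show L p = Real.log (coord p x) from hL ⟨p, hp⟩, Real.exp_log (coord_pos_iff.2 hp)]
  let γ : ℝ → Model P := fun t =>
    Model.ofCoord (fun p => if p ∈ T then Real.exp (L p) * |t| ^ v p else 0)
      (fun p => by split_ifs <;> positivity) (by simp [T.zero_mem]) fun p q => by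
        by_cases h : p + q ∈ T
        · rw [if_pos h, if_pos (hT p q h).1, if_pos (hT p q h).2, map_add, map_add, Real.exp_add,
            pow_add]
          ring
        · rw [if_neg h]
          by_cases hp : p ∈ T
          · rw [if_neg fun hq => h (T.add_mem hp hq), mul_zero]
          · rw [if_neg hp, zero_mul]
  have h1 : ∀ t p, p ∈ T → coord p (γ t) = Real.exp (L p) * |t| ^ v p := fun t p hp => if_pos hp
  have h2 : ∀ t p, p ∉ T → coord p (γ t) = 0 := fun t p hp => if_neg hp
  refine ⟨fun p => Real.exp (L p), γ, fun p => Real.exp_pos _, h1, h2, ?_⟩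
  rw [tendsto_model_iff]
  intro p
  by_cases hpT : p ∈ T
  · simp only [h1 _ p hpT]
    have hc : Tendsto (fun t : ℝ => Real.exp (L p) * |t| ^ v p) (𝓝[>] 0)
        (𝓝 (Real.exp (L p) * |0| ^ v p)) :=
      (Continuous.tendsto (by fun_prop) 0).mono_left nhdsWithin_le_nhds
    convert! hc using 2
    by_cases hp : p ∈ supp x
    · rw [(hv p).2 hp, pow_zero, mul_one, hE p hp]
    · rw [abs_zero, zero_pow fun h => hp ((hv p).1 h), mul_zero, coord_eq_zero hp]
  · simp only [h2 _ p hpT]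
    rw [coord_eq_zero fun h => hpT (hxT h)]
    exact tendsto_const_nhds

/-- Near a point `x` there are points with any given support containing that of `x`. -/
theorem frequently_supp_eq (hP : IsToric P) (x : Model P) {T : AddSubmonoid P} (hT : IsFace T)
    (hxT : supp x ≤ T) : ∃ᶠ y in 𝓝 x, supp y = T := by
  obtain ⟨v, hv⟩ := hP.exists_kernel_eq (isFace_supp x)
  obtain ⟨E, γ, hE, h1, h2, h3⟩ := exists_curve hP x hT hxT hv
  refine h3.frequently (Eventually.frequently ?_)
  filter_upwards [self_mem_nhdsWithin] with t ht
  ext p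
  by_cases hp : p ∈ T
  · refine iff_of_true ?_ hp
    rw [mem_supp, h1 t p hp]
    exact (mul_pos (hE p) (pow_pos (abs_pos.2 (ne_of_gt ht)) _)).ne'
  · exact iff_of_false (fun h => h (h2 t p hp)) hp

/-- The weighted geometric mean of two points of `X_P`. -/
noncomputable def geomMean (x y : Model P) (t : ℝ) : Model P :=
  Model.ofCoord (fun p => coord p x ^ (1 - t) * coord p y ^ t)
    (fun p => mul_nonneg (Real.rpow_nonneg (coord_nonneg p x) _)
      (Real.rpow_nonneg (coord_nonneg p y) _))
    (by simp [coord_zero]) fun p q => by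
      rw [coord_add, coord_add, Real.mul_rpow (coord_nonneg _ _) (coord_nonneg _ _),
        Real.mul_rpow (coord_nonneg _ _) (coord_nonneg _ _)]
      ring

theorem coord_geomMean (x y : Model P) (t : ℝ) (p : P) :
    coord p (geomMean x y t) = coord p x ^ (1 - t) * coord p y ^ t := rfl

theorem coord_geomMean_of_notMem {x y : Model P} (h : supp x = supp y) {p : P} (hp : p ∉ supp x)
    (t : ℝ) : coord p (geomMean x y t) = 0 := by
  rw [coord_geomMean, coord_eq_zero hp, coord_eq_zero (h ▸ hp)]
  rcases eq_or_ne t 0 with rfl | ht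
  · simp
  · rw [Real.zero_rpow ht, mul_zero]

theorem supp_geomMean {x y : Model P} (h : supp x = supp y) (t : ℝ) :
    supp (geomMean x y t) = supp x := by
  ext p
  by_cases hp : p ∈ supp x
  · refine iff_of_true ?_ hp
    rw [mem_supp, coord_geomMean]
    exact (mul_pos (Real.rpow_pos_of_pos (coord_pos_iff.2 hp) _)
      (Real.rpow_pos_of_pos (coord_pos_iff.2 (h ▸ hp)) _)).ne'
  · exact iff_of_false (fun h' => h' (coord_geomMean_of_notMem h hp t)) hp

theorem continuous_geomMean {x y : Model P} (h : supp x = supp y) :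
    Continuous (geomMean x y) := by
  rw [continuous_model_iff]
  intro p
  by_cases hp : p ∈ supp x
  · simp only [coord_geomMean]
    exact (continuous_const.rpow (by fun_prop) fun t => Or.inl hp).mul
      (continuous_const.rpow continuous_id fun t => Or.inl (h ▸ hp : p ∈ supp y))
  · simp only [coord_geomMean_of_notMem h hp]
    exact continuous_const

theorem coord_geomMean_mem_Ioo {x y : Model P} (h : supp x = supp y) {a b : ℝ} {p : P}
    (hx : coord p x ∈ Ioo a b) (hy : coord p y ∈ Ioo a b) {t : ℝ} (ht : t ∈ Icc (0 : ℝ) 1) :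
    coord p (geomMean x y t) ∈ Ioo a b := by
  by_cases hp : p ∈ supp x
  · have hx0 := coord_pos_iff.2 hp
    have hy0 := coord_pos_iff.2 (h ▸ hp : p ∈ supp y)
    have key : ∀ c : ℝ, 0 < c → c ^ (1 - t) * c ^ t = c := fun c hc => by
      rw [← Real.rpow_add hc, sub_add_cancel, Real.rpow_one]
    rw [coord_geomMean]
    constructor
    · refine (lt_min hx.1 hy.1).trans_le ?_
      have hm : 0 < min (coord p x) (coord p y) := lt_min hx0 hy0
      rw [← key _ hm]
      exact mul_le_mul (Real.rpow_le_rpow hm.le (min_le_left _ _) (by linarith [ht.2]))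
        (Real.rpow_le_rpow hm.le (min_le_right _ _) ht.1) (Real.rpow_nonneg hm.le _)
        (Real.rpow_nonneg hx0.le _)
    · refine lt_of_le_of_lt ?_ (max_lt hx.2 hy.2)
      have hm : 0 < max (coord p x) (coord p y) := lt_max_of_lt_left hx0
      rw [← key (max _ _) hm]
      exact mul_le_mul (Real.rpow_le_rpow hx0.le (le_max_left _ _) (by linarith [ht.2]))
        (Real.rpow_le_rpow hy0.le (le_max_right _ _) ht.1) (Real.rpow_nonneg hy0.le _)
        (Real.rpow_nonneg hm.le _)
  · rwa [coord_geomMean_of_notMem h hp, ← coord_eq_zero hp]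

/-- A point of `X_P` has arbitrarily small neighbourhoods which meet each stratum of constant
support in a connected set: those given by conditions `a < x_p < b` are closed under geometric
means. -/
theorem exists_isPreconnected_nhds {x : Model P} {N : Set (Model P)} (hN : N ∈ 𝓝 x) :
    ∃ V, IsOpen V ∧ x ∈ V ∧ V ⊆ N ∧
      ∀ T : AddSubmonoid P, IsPreconnected {y ∈ V | supp y = T} := by
  have hb := (Filter.hasBasis_pi fun p : P => nhds_basis_Ioo (coord p x)).comap
    (fun (x : Model P) (p : P) => coord p x)
  rw [nhds_induced, nhds_pi, hb.mem_iff] at hN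
  obtain ⟨⟨I, f⟩, ⟨hI, hf⟩, hV⟩ := hN
  refine ⟨⋂ p ∈ I, {y | coord p y ∈ Ioo (f p).1 (f p).2},
    hI.isOpen_biInter fun p _ => isOpen_Ioo.preimage (continuous_coord p),
    mem_iInter₂.2 fun p hp => hf p hp, fun y hy => hV fun p hp => ?_, fun T => ?_⟩
  · exact mem_iInter₂.1 hy p hp
  · refine isPreconnected_of_forall_pair fun y hy z hz => ?_
    have hyz : supp y = supp z := hy.2.trans hz.2.symm
    refine ⟨geomMean y z '' Icc 0 1, ?_, ⟨0, ⟨le_rfl, zero_le_one⟩, ?_⟩,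
      ⟨1, ⟨zero_le_one, le_rfl⟩, ?_⟩, isPreconnected_Icc.image _
        (continuous_geomMean hyz).continuousOn⟩
    · rintro _ ⟨t, ht, rfl⟩
      exact ⟨mem_iInter₂.2 fun p hp => coord_geomMean_mem_Ioo hyz (mem_iInter₂.1 hy.1 p hp)
        (mem_iInter₂.1 hz.1 p hp) ht, (supp_geomMean hyz t).trans hy.2⟩
    · refine MonoidHom.ext fun p => NNReal.eq ?_
      show coord p.toAdd (geomMean y z 0) = coord p.toAdd y
      simp [coord_geomMean]
    · refine MonoidHom.ext fun p => NNReal.eq ?_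
      show coord p.toAdd (geomMean y z 1) = coord p.toAdd z
      simp [coord_geomMean]

/-! ### The monomial of a b-function -/

theorem SmoothAt.continuousAt {f : Model P → ℝ} {x : Model P} (h : SmoothAt f x) :
    ContinuousAt f x := by
  obtain ⟨ι, _, p, V, g, hV, hx, hg, e⟩ := h
  have h1 : ContinuousAt g (fun i => coord (p i) x) := hg.continuousOn.continuousAt (hV.mem_nhds hx)
  have h2 : ContinuousAt (fun y : Model P => fun i => coord (p i) y) x :=
    (continuous_pi fun i => continuous_coord (p i)).continuousAt
  exact (ContinuousAt.comp (g := g) h1 h2).congr_of_eventuallyEq e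

theorem SmoothAt.eventually {f : Model P → ℝ} {x : Model P} (h : SmoothAt f x) :
    ∀ᶠ y in 𝓝 x, SmoothAt f y := by
  obtain ⟨ι, _, p, V, g, hV, hx, hg, e⟩ := h
  have h2 : Continuous (fun y : Model P => fun i => coord (p i) y) :=
    continuous_pi fun i => continuous_coord (p i)
  filter_upwards [h2.continuousAt.preimage_mem_nhds (hV.mem_nhds hx), e.eventually_nhds]
    with y hy he
  exact ⟨ι, inferInstance, p, V, g, hV, hy, hg, he⟩

theorem SmoothAt.inv {f : Model P → ℝ} {x : Model P} (h : SmoothAt f x) (h0 : f x ≠ 0) :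
    SmoothAt (fun y => (f y)⁻¹) x := by
  refine SmoothAt.family (κ := Unit) (f := fun _ => f) (V := {z | z () ≠ 0})
    (G := fun z => (z ())⁻¹) (fun _ => h)
    (isOpen_ne_fun (continuous_apply ()) continuous_const) h0 ?_
  exact (contDiff_apply ℝ ℝ ()).contDiffOn.inv fun z hz => hz

/-- Near `x`, the function `b` is the monomial `x_p` times a smooth, positive function. -/
def HasMonomial (b : Model P → ℝ) (x : Model P) (p : P) : Prop :=
  ∃ h : Model P → ℝ, SmoothAt h x ∧ 0 < h x ∧ b =ᶠ[𝓝 x] fun y => h y * coord p y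

theorem bFunAt_iff {b : Model P → ℝ} {x : Model P} : BFunAt b x ↔ ∃ p, HasMonomial b x p := Iff.rfl

theorem HasMonomial.congr {b b' : Model P → ℝ} {x : Model P} {p : P} (h : HasMonomial b x p)
    (e : b' =ᶠ[𝓝 x] b) : HasMonomial b' x p := by
  obtain ⟨k, h1, h2, h3⟩ := h
  exact ⟨k, h1, h2, e.trans h3⟩

theorem hasMonomial_coord (p : P) (x : Model P) : HasMonomial (coord p) x p :=
  ⟨fun _ => 1, SmoothAt.one x, one_pos, Eventually.of_forall fun _ => (one_mul _).symm⟩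

theorem HasMonomial.mul {b b' : Model P → ℝ} {x : Model P} {p p' : P} (h : HasMonomial b x p)
    (h' : HasMonomial b' x p') : HasMonomial (fun y => b y * b' y) x (p + p') := by
  obtain ⟨k, h1, h2, h3⟩ := h
  obtain ⟨k', h1', h2', h3'⟩ := h'
  refine ⟨fun y => k y * k' y, h1.mul h1', mul_pos h2 h2', ?_⟩
  filter_upwards [h3, h3'] with y hy hy'
  rw [hy, hy', coord_add]
  ring

theorem SmoothAt.hasMonomial_zero {b : Model P → ℝ} {x : Model P} (h : SmoothAt b x)
    (h0 : 0 < b x) : HasMonomial b x 0 :=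
  ⟨b, h, h0, Eventually.of_forall fun y => by
    show b y = b y * coord 0 y
    rw [coord_zero, mul_one]⟩

theorem HasMonomial.eventually {b : Model P → ℝ} {x : Model P} {p : P} (h : HasMonomial b x p) :
    ∀ᶠ y in 𝓝 x, HasMonomial b y p := by
  obtain ⟨k, h1, h2, h3⟩ := h
  filter_upwards [h1.eventually, h1.continuousAt.eventually_const_lt h2, h3.eventually_nhds]
    with _ k1 k2 k3
  exact ⟨k, k1, k2, k3⟩

theorem HasMonomial.ne_zero_iff {b : Model P → ℝ} {x : Model P} {p : P} (h : HasMonomial b x p) :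
    b x ≠ 0 ↔ p ∈ supp x := by
  obtain ⟨k, _, h2, h3⟩ := h
  rw [h3.eq_of_nhds, mem_supp, mul_ne_zero_iff, and_iff_right h2.ne']

theorem HasMonomial.nonneg {b : Model P → ℝ} {x : Model P} {p : P} (h : HasMonomial b x p) :
    0 ≤ b x := by
  obtain ⟨k, _, h2, h3⟩ := h
  rw [h3.eq_of_nhds]
  exact mul_nonneg h2.le (coord_nonneg p x)

theorem BFunAt.inv {b : Model P → ℝ} {x : Model P} (h : BFunAt b x) (h0 : b x ≠ 0) :
    BFunAt (fun y => (b y)⁻¹) x := by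
  obtain ⟨p, hp⟩ := bFunAt_iff.1 h
  exact ⟨0, (h.smoothAt.inv h0).hasMonomial_zero (inv_pos.2 (hp.nonneg.lt_of_ne' h0))⟩

/-- The monomial of a b-function near `x` is unique up to monomials which are positive at `x`:
along curves `E t^v` tending to `x`, the b-function grows like `t^{v(p)}`. -/
theorem HasMonomial.relMod (hP : IsToric P) {b : Model P → ℝ} {x : Model P} {p q : P}
    (hp : HasMonomial b x p) (hq : HasMonomial b x q) : RelMod (supp x) p q := by
  have key : ∀ (v : P →+ ℕ), (∀ s, v s = 0 ↔ s ∈ supp x) → ∀ {p q : P}, HasMonomial b x p →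
      HasMonomial b x q → v q ≤ v p := by
    intro v hv p q ⟨h, h1, h2, h3⟩ ⟨k, k1, k2, k3⟩
    obtain ⟨E, γ, hE, hγ, -, hγx⟩ := exists_curve hP x (T := ⊤) (fun _ _ _ => ⟨trivial, trivial⟩)
      le_top hv
    by_contra! hlt
    obtain ⟨n, hn⟩ := Nat.exists_eq_add_of_lt hlt
    have e : ∀ᶠ t in 𝓝[>] (0 : ℝ), h (γ t) * E p = k (γ t) * E q * t ^ (n + 1) := by
      filter_upwards [hγx.eventually h3, hγx.eventually k3, self_mem_nhdsWithin] with t e1 e2 ht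
      rw [e1, hγ t p trivial, hγ t q trivial, abs_of_pos ht, hn, add_assoc, pow_add] at e2
      have ht0 : t ^ v p ≠ 0 := pow_ne_zero _ (ne_of_gt ht)
      apply mul_right_cancel₀ ht0
      linarith
    have l1 : Tendsto (fun t => h (γ t) * E p) (𝓝[>] (0 : ℝ)) (𝓝 (h x * E p)) :=
      (h1.continuousAt.tendsto.comp hγx).mul_const _
    have l2 : Tendsto (fun t => k (γ t) * E q * t ^ (n + 1)) (𝓝[>] (0 : ℝ))
        (𝓝 (k x * E q * 0 ^ (n + 1))) :=
      ((k1.continuousAt.tendsto.comp hγx).mul_const _).mul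
        ((Continuous.tendsto (by fun_prop) 0).mono_left nhdsWithin_le_nhds)
    have l3 := tendsto_nhds_unique (l1.congr' e) l2
    rw [zero_pow n.succ_ne_zero, mul_zero] at l3
    exact (mul_pos h2 (hE p)).ne' l3
  obtain ⟨v₀, hv₀⟩ := hP.exists_kernel_eq (isFace_supp x)
  have h0 : v₀ p = v₀ q := le_antisymm (key v₀ hv₀ hq hp) (key v₀ hv₀ hp hq)
  refine hP.relMod_of_facetNormal (isFace_supp x) fun F v _ hF hv => ?_
  -- `v` vanishes on `supp x`, so that `v₀ + v` has the same zeros as `v₀`.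
  have hvS : ∀ s ∈ supp x, v s = 0 := fun s hs => by
    rw [← map_zero v, hv.eq_iff]
    exact ⟨0, F.zero_mem, s, hF hs, by rw [add_zero, zero_add]⟩
  have h1 : ∀ s, (v₀ + v) s = 0 ↔ s ∈ supp x := fun s => by
    rw [AddMonoidHom.add_apply, Nat.add_eq_zero_iff, hv₀]
    exact ⟨fun h => h.1, fun h => ⟨h, hvS s h⟩⟩
  have h2 : (v₀ + v) p = (v₀ + v) q := le_antisymm (key _ h1 hq hp) (key _ h1 hp hq)
  rw [AddMonoidHom.add_apply, AddMonoidHom.add_apply, h0] at h2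
  exact Nat.add_left_cancel h2

end ModelSpaces

namespace PreManifold

/-! ### b-functions in a chart -/

section Charts

variable {M : PreManifold.{u}}

/-- The support, in the monoid of the chart `c`, of the point corresponding to `y`. -/
def chartSupp (c : Chart M) (y : M) : AddSubmonoid c.1 := supp (c.2 y)

/-- The monomial `x_p` of the chart `c`. -/
def chartCoord (c : Chart M) (p : c.1) (y : M) : ℝ := coord p (c.2 y)

/-- In the chart `c`, the function `b` is near `y` the monomial `x_p` times a smooth, positive
function. -/
def HasMono (c : Chart M) (b : M → ℝ) (y : M) (p : c.1) : Prop :=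
  HasMonomial (fun z => b (c.2.symm z)) (c.2 y) p

theorem isFace_chartSupp (c : Chart M) (y : M) : IsFace (chartSupp c y) := isFace_supp _

variable {c : Chart M} {y : M}

theorem tendsto_chart_symm (hy : y ∈ c.2.source) : Tendsto c.2.symm (𝓝 (c.2 y)) (𝓝 y) := by
  have := c.2.continuousAt_symm (c.2.map_source hy)
  rwa [ContinuousAt, c.2.left_inv hy] at this

theorem HasMono.congr {b b' : M → ℝ} {p : c.1} (hy : y ∈ c.2.source) (h : HasMono c b y p)
    (e : b' =ᶠ[𝓝 y] b) : HasMono c b' y p :=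
  HasMonomial.congr h ((tendsto_chart_symm hy).eventually e)

theorem HasMono.eventually {b : M → ℝ} {p : c.1} (hy : y ∈ c.2.source) (h : HasMono c b y p) :
    ∀ᶠ z in 𝓝 y, HasMono c b z p :=
  (c.2.continuousAt hy).eventually (HasMonomial.eventually h)

theorem HasMono.ne_zero_iff {b : M → ℝ} {p : c.1} (hy : y ∈ c.2.source) (h : HasMono c b y p) :
    b y ≠ 0 ↔ p ∈ chartSupp c y := by
  have := HasMonomial.ne_zero_iff h
  rwa [c.2.left_inv hy] at this

theorem HasMono.mul {b b' : M → ℝ} {p p' : c.1} (h : HasMono c b y p) (h' : HasMono c b' y p') :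
    HasMono c (fun z => b z * b' z) y (p + p') :=
  HasMonomial.mul h h'

theorem HasMono.relMod {b : M → ℝ} {p q : c.1} (hp : HasMono c b y p) (hq : HasMono c b y q) :
    RelMod (chartSupp c y) p q :=
  HasMonomial.relMod c.1.toric hp hq

theorem hasMono_chartCoord (hy : y ∈ c.2.source) (p : c.1) : HasMono c (chartCoord c p) y p := by
  refine (hasMonomial_coord p (c.2 y)).congr ?_
  filter_upwards [c.2.open_target.mem_nhds (c.2.map_source hy)] with z hz
  show coord p (c.2 (c.2.symm z)) = coord p z
  rw [c.2.right_inv hz]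

/-- It suffices to check in one chart that a function is a b-function. -/
theorem bAt_of_chart (hc : c ∈ M.atlas) (hy : y ∈ c.2.source) {b : M → ℝ}
    (hb : BFunAt (fun z => b (c.2.symm z)) (c.2 y)) : M.BAt b y := by
  intro c' hc' hy'
  obtain ⟨h1, h2⟩ := chart_aux (M := M) (N := M) continuous_id hy' hy
  have e : c.2 y = c.2 (c'.2.symm (c'.2 y)) := by rw [c'.2.left_inv hy']
  rw [e] at hb
  refine (BFunAt.comp hb (M.compatible c' hc' c hc y ⟨hy', hy⟩) h1).congr ?_
  filter_upwards [h2] with z hz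
  exact congrArg b hz.symm

theorem bAt_iff (hc : c ∈ M.atlas) (hy : y ∈ c.2.source) {b : M → ℝ} :
    M.BAt b y ↔ ∃ p, HasMono c b y p :=
  ⟨fun h => h c hc hy, fun h => bAt_of_chart hc hy h⟩

theorem BAt.eventually {b : M → ℝ} (h : M.BAt b y) : ∀ᶠ z in 𝓝 y, M.BAt b z := by
  obtain ⟨c, hc, hy⟩ := M.cover y
  obtain ⟨p, hp⟩ := (bAt_iff hc hy).1 h
  filter_upwards [hp.eventually hy, c.2.open_source.mem_nhds hy] with z hz hz'
  exact (bAt_iff hc hz').2 ⟨p, hz⟩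

theorem eventually_chartSupp_le (hy : y ∈ c.2.source) :
    ∀ᶠ z in 𝓝 y, chartSupp c y ≤ chartSupp c z :=
  (c.2.continuousAt hy).eventually (eventually_supp_le c.1.toric _)

theorem frequently_chartSupp_eq (hy : y ∈ c.2.source) {T : AddSubmonoid c.1} (hT : IsFace T)
    (h : chartSupp c y ≤ T) : ∃ᶠ z in 𝓝 y, chartSupp c z = T := by
  refine (tendsto_chart_symm hy).frequently ?_
  refine ((frequently_supp_eq c.1.toric (c.2 y) hT h).and_eventually
    (c.2.open_target.mem_nhds (c.2.map_source hy))).mono fun z hz => ?_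
  show supp (c.2 (c.2.symm z)) = T
  rw [c.2.right_inv hz.2, hz.1]

theorem exists_good_nhds (hy : y ∈ c.2.source) {N : Set M} (hN : N ∈ 𝓝 y) :
    ∃ U, IsOpen U ∧ y ∈ U ∧ U ⊆ N ∧ U ⊆ c.2.source ∧ (∀ z ∈ U, chartSupp c y ≤ chartSupp c z) ∧
      ∀ T : AddSubmonoid c.1, IsPreconnected {z ∈ U | chartSupp c z = T} := by
  have hN' : c.2.symm ⁻¹' (N ∩ {z | chartSupp c y ≤ chartSupp c z}) ∩ c.2.target ∈ 𝓝 (c.2 y) :=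
    inter_mem (tendsto_chart_symm hy (inter_mem hN (eventually_chartSupp_le hy)))
      (c.2.open_target.mem_nhds (c.2.map_source hy))
  obtain ⟨V, hV, hyV, hVN, hT⟩ := exists_isPreconnected_nhds hN'
  have hsub : ∀ z ∈ c.2.source ∩ c.2 ⁻¹' V, z ∈ N ∩ {z | chartSupp c y ≤ chartSupp c z} :=
    fun z hz => by
      have := (hVN hz.2).1
      rwa [mem_preimage, c.2.left_inv hz.1] at this
  refine ⟨c.2.source ∩ c.2 ⁻¹' V, c.2.isOpen_inter_preimage hV, ⟨hy, hyV⟩,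
    fun z hz => (hsub z hz).1, inter_subset_left, fun z hz => (hsub z hz).2, fun T => ?_⟩
  have e : {z ∈ c.2.source ∩ c.2 ⁻¹' V | chartSupp c z = T} =
      c.2.symm '' {w ∈ V | supp w = T} := by
    ext z
    constructor
    · rintro ⟨⟨hz, hzV⟩, hzT⟩
      exact ⟨c.2 z, ⟨hzV, hzT⟩, c.2.left_inv hz⟩
    · rintro ⟨w, ⟨hw, hwT⟩, rfl⟩
      have ht := (hVN hw).2
      refine ⟨⟨c.2.map_target ht, ?_⟩, ?_⟩
      · rwa [mem_preimage, c.2.right_inv ht]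
      · rwa [chartSupp, c.2.right_inv ht]
  rw [e]
  exact (hT T).image _ (c.2.continuousOn_symm.mono fun w hw => (hVN hw.1).2)

/-! ### Stalks in a chart -/

theorem exists_eq_germ (β : M.BStalk y) : ∃ (b : M → ℝ) (hb : M.BAt b y), β = germ b y hb := by
  obtain ⟨_, b, rfl, hb⟩ := β
  exact ⟨b, hb, rfl⟩

theorem germ_eq_germ_iff {b b' : M → ℝ} (hb : M.BAt b y) (hb' : M.BAt b' y) :
    germ b y hb = germ b' y hb' ↔ b =ᶠ[𝓝 y] b' :=
  Subtype.ext_iff.trans Germ.coe_eq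

theorem germ_mul {b b' : M → ℝ} (hb : M.BAt b y) (hb' : M.BAt b' y) :
    ∃ h, germ b y hb * germ b' y hb' = germ (fun z => b z * b' z) y h :=
  ⟨fun c hc hx => (hb c hc hx).mul (hb' c hc hx), rfl⟩

/-- The monomial `p` represents the germ `β` up to a positive smooth factor. -/
def StalkMono (c : Chart M) (β : M.BStalk y) (p : c.1) : Prop :=
  ∃ (b : M → ℝ) (hb : M.BAt b y), β = germ b y hb ∧ HasMono c b y p

theorem stalkMono_germ_iff (hy : y ∈ c.2.source) {b : M → ℝ} (hb : M.BAt b y) {p : c.1} :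
    StalkMono c (germ b y hb) p ↔ HasMono c b y p := by
  constructor
  · rintro ⟨b', hb', e, h⟩
    exact h.congr hy ((germ_eq_germ_iff hb hb').1 e)
  · exact fun h => ⟨b, hb, rfl, h⟩

theorem exists_stalkMono (hc : c ∈ M.atlas) (hy : y ∈ c.2.source) (β : M.BStalk y) :
    ∃ p, StalkMono c β p := by
  obtain ⟨b, hb, rfl⟩ := exists_eq_germ β
  obtain ⟨p, hp⟩ := (bAt_iff hc hy).1 hb
  exact ⟨p, b, hb, rfl, hp⟩

theorem StalkMono.mul {β β' : M.BStalk y} {p p' : c.1} (h : StalkMono c β p)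
    (h' : StalkMono c β' p') : StalkMono c (β * β') (p + p') := by
  obtain ⟨b, hb, rfl, hp⟩ := h
  obtain ⟨b', hb', rfl, hp'⟩ := h'
  obtain ⟨hbb, e⟩ := germ_mul hb hb'
  exact ⟨_, hbb, e, hp.mul hp'⟩

theorem StalkMono.relMod (hy : y ∈ c.2.source) {β : M.BStalk y} {p q : c.1}
    (h : StalkMono c β p) (h' : StalkMono c β q) : RelMod (chartSupp c y) p q := by
  obtain ⟨b, hb, rfl, hp⟩ := h
  exact hp.relMod ((stalkMono_germ_iff hy hb).1 h')

/-- The monomials of a chart, as germs at `y`. -/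
def stalkCoord (hc : c ∈ M.atlas) (hy : y ∈ c.2.source) : c.1 →+ Additive (M.BStalk y) where
  toFun p := Additive.ofMul (germ (chartCoord c p) y
    ((bAt_iff hc hy).2 ⟨p, hasMono_chartCoord hy p⟩))
  map_zero' := congrArg Additive.ofMul (Subtype.ext
    (congrArg (fun f : M → ℝ => (f : Germ (𝓝 y) ℝ)) (funext fun z => coord_zero (c.2 z))))
  map_add' p q := congrArg Additive.ofMul (Subtype.ext
    (congrArg (fun f : M → ℝ => (f : Germ (𝓝 y) ℝ)) (funext fun z => coord_add p q (c.2 z))))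

theorem stalkMono_stalkCoord (hc : c ∈ M.atlas) (hy : y ∈ c.2.source) (p : c.1) :
    StalkMono c (stalkCoord hc hy p).toMul p :=
  ⟨_, (bAt_iff hc hy).2 ⟨p, hasMono_chartCoord hy p⟩, rfl, hasMono_chartCoord hy p⟩

/-- Germs with the same monomial become equal after multiplication by positive smooth germs. -/
theorem StalkMono.exists_mul_eq (hc : c ∈ M.atlas) (hy : y ∈ c.2.source) {β β' : M.BStalk y}
    {p : c.1} (h : StalkMono c β p) (h' : StalkMono c β' p) :
    ∃ η η' : M.BStalk y, StalkMono c η 0 ∧ StalkMono c η' 0 ∧ β * η = β' * η' := by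
  obtain ⟨b, hb, rfl, k, h1, h2, h3⟩ := h
  obtain ⟨b', hb', rfl, k', h1', h2', h3'⟩ := h'
  have hz : ∀ {k : Model c.1 → ℝ}, SmoothAt k (c.2 y) → 0 < k (c.2 y) →
      HasMono c (fun z => k (c.2 z)) y 0 := fun {k} h1 h2 => by
    refine (h1.hasMonomial_zero h2).congr ?_
    filter_upwards [c.2.open_target.mem_nhds (c.2.map_source hy)] with z hz
    rw [c.2.right_inv hz]
  have hk := hz h1 h2
  have hk' := hz h1' h2'
  refine ⟨germ _ y ((bAt_iff hc hy).2 ⟨0, hk'⟩), germ _ y ((bAt_iff hc hy).2 ⟨0, hk⟩),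
    ⟨_, _, rfl, hk'⟩, ⟨_, _, rfl, hk⟩, ?_⟩
  obtain ⟨hbb, e⟩ := germ_mul hb ((bAt_iff hc hy).2 ⟨0, hk'⟩)
  obtain ⟨hbb', e'⟩ := germ_mul hb' ((bAt_iff hc hy).2 ⟨0, hk⟩)
  rw [e, e', germ_eq_germ_iff]
  filter_upwards [(c.2.continuousAt hy).eventually h3, (c.2.continuousAt hy).eventually h3',
    c.2.open_source.mem_nhds hy] with z e1 e2 hz
  rw [c.2.left_inv hz] at e1 e2
  rw [e1, e2]
  ring

theorem StalkMono.isUnit_iff (hy : y ∈ c.2.source) {β : M.BStalk y}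
    {p : c.1} (h : StalkMono c β p) : IsUnit β ↔ p ∈ chartSupp c y := by
  obtain ⟨b, hb, rfl, hp⟩ := h
  rw [← hp.ne_zero_iff hy]
  constructor
  · intro h
    obtain ⟨β', h'⟩ := h.exists_right_inv
    obtain ⟨b', hb', rfl⟩ := exists_eq_germ β'
    have e : (fun z => b z * b' z) =ᶠ[𝓝 y] fun _ => 1 := Germ.coe_eq.1 (congrArg Subtype.val h')
    exact left_ne_zero_of_mul (e.eq_of_nhds.trans_ne one_ne_zero)
  · intro h0
    have hb' : M.BAt (fun z => (b z)⁻¹) y := fun c' hc' hy' =>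
      (hb c' hc' hy').inv (by rwa [c'.2.left_inv hy'])
    refine IsUnit.of_mul_eq_one (germ _ y hb') ?_
    obtain ⟨hbb, e⟩ := germ_mul hb hb'
    rw [e]
    refine Subtype.ext (Germ.coe_eq.2 ?_)
    have hne : ∀ᶠ z in 𝓝 y, b z ≠ 0 := by
      have hpy : p ∈ chartSupp c y := (hp.ne_zero_iff hy).1 h0
      filter_upwards [hp.eventually hy, eventually_chartSupp_le hy, c.2.open_source.mem_nhds hy]
        with z h1 h2 h3
      exact (h1.ne_zero_iff h3).2 (h2 hpy)
    filter_upwards [hne] with z hz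
    exact mul_inv_cancel₀ hz

/-- The codimension of a point is the rank of `P / S`, where `P` is the monoid of a chart and `S`
the support of the point. -/
theorem codim_eq_corank (hc : c ∈ M.atlas) (hy : y ∈ c.2.source) :
    codim y = corank (chartSupp c y) := by
  have := c.1.toric.integral
  let π : c.1 →+ Additive (Associates (M.BStalk y)) :=
    (MonoidHom.toAdditive (Associates.mkMonoidHom (M := M.BStalk y))).comp (stalkCoord hc hy)
  have hπ : ∀ p, π p = Additive.ofMul (Associates.mk (stalkCoord hc hy p).toMul) := fun p => rfl
  have hunit : ∀ s ∈ chartSupp c y, IsUnit (stalkCoord hc hy s).toMul := fun s hs =>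
    ((stalkMono_stalkCoord hc hy s).isUnit_iff hy).2 hs
  have h0 : ∀ η : M.BStalk y, StalkMono c η 0 → IsUnit η := fun η h =>
    (h.isUnit_iff hy).2 (chartSupp c y).zero_mem
  have hassoc : ∀ {α β η η' : M.BStalk y}, IsUnit η → IsUnit η' → α * η = β * η' →
      Associates.mk α = Associates.mk β := fun {α β η η'} h h' e => by
    rw [Associates.mk_eq_mk_iff_associated]
    exact (associated_mul_unit_right α η h).trans
      (e ▸ (associated_mul_unit_right β η' h').symm)
  refine monoidDim_eq_corank (π := π) (fun x => ?_) fun p q => ?_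
  · obtain ⟨β, hβ⟩ := Associates.mk_surjective x.toMul
    obtain ⟨p, hp⟩ := exists_stalkMono hc hy β
    obtain ⟨η, η', hη, hη', e⟩ := (stalkMono_stalkCoord hc hy p).exists_mul_eq hc hy hp
    refine ⟨p, ?_⟩
    rw [hπ, hassoc (h0 η hη) (h0 η' hη') e, hβ]
    rfl
  · rw [hπ, hπ, Additive.ofMul.apply_eq_iff_eq, Associates.mk_eq_mk_iff_associated]
    constructor
    · rintro ⟨⟨η, η', h1, h2⟩, e⟩
      have hη : IsUnit η := IsUnit.of_mul_eq_one η' h1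
      obtain ⟨r, hr⟩ := exists_stalkMono hc hy η
      have hrS := (hr.isUnit_iff hy).1 hη
      have h3 := (stalkMono_stalkCoord hc hy p).mul hr
      rw [show (stalkCoord hc hy p).toMul * η = (stalkCoord hc hy q).toMul from e] at h3
      exact RelMod.trans ⟨r, hrS, 0, AddSubmonoid.zero_mem _, by rw [add_zero]⟩
        (h3.relMod hy (stalkMono_stalkCoord hc hy q))
    · rintro ⟨t, ht, t', ht', e⟩
      rw [← Associates.mk_eq_mk_iff_associated]
      refine hassoc (hunit t ht) (hunit t' ht') ?_
      have := congrArg (stalkCoord hc hy) e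
      rw [map_add, map_add] at this
      exact this

theorem codim_lt_of_chartSupp_lt (hc : c ∈ M.atlas) {z : M} (hy : y ∈ c.2.source)
    (hz : z ∈ c.2.source) (h : chartSupp c y < chartSupp c z) : codim z < codim y := by
  rw [codim_eq_corank hc hy, codim_eq_corank hc hz]
  exact corank_lt_of_lt c.1.toric (isFace_chartSupp c y) h

end Charts

/-! ### Boundary faces in a chart -/

section LocalFaces

variable {M : PreManifold.{u}} {c : Chart M} {x : M}

/-- An open neighbourhood of `x` which meets every stratum of constant support in a connected
set, and in which all supports contain that of `x`. -/
structure IsGoodNhd (c : Chart M) (x : M) (U : Set M) : Prop where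
  isOpen : IsOpen U
  mem : x ∈ U
  subset_source : U ⊆ c.2.source
  le_supp : ∀ z ∈ U, chartSupp c x ≤ chartSupp c z
  isPreconnected : ∀ T : AddSubmonoid c.1, IsPreconnected {z ∈ U | chartSupp c z = T}

theorem exists_isGoodNhd (hx : x ∈ c.2.source) {N : Set M} (hN : N ∈ 𝓝 x) :
    ∃ U ⊆ N, IsGoodNhd c x U := by
  obtain ⟨U, h1, h2, h3, h4, h5, h6⟩ := exists_good_nhds hx hN
  exact ⟨U, h3, h1, h2, h4, h5, h6⟩

theorem chartSupp_eq_of_le (hc : c ∈ M.atlas) {y z : M} (hy : y ∈ c.2.source)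
    (hz : z ∈ c.2.source) (h : chartSupp c y ≤ chartSupp c z) (hyz : codim y = codim z) :
    chartSupp c y = chartSupp c z := by
  by_contra hne
  exact (codim_lt_of_chartSupp_lt hc hy hz (lt_of_le_of_ne h hne)).ne' hyz

theorem codim_eq_of_chartSupp_eq (hc : c ∈ M.atlas) {y z : M} (hy : y ∈ c.2.source)
    (hz : z ∈ c.2.source) (h : chartSupp c y = chartSupp c z) : codim y = codim z := by
  rw [codim_eq_corank hc hy, codim_eq_corank hc hz, h]

theorem isOpen_le_chartSupp (c : Chart M) {T : AddSubmonoid c.1} (hT : IsFace T) :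
    IsOpen {z ∈ c.2.source | T ≤ chartSupp c z} :=
  c.2.isOpen_inter_preimage (isOpen_le_supp (hT.fg c.1.toric))

theorem IsGoodNhd.subset_codimStratum (hc : c ∈ M.atlas) {U : Set M} (hU : IsGoodNhd c x U)
    {z : M} (hz : z ∈ U) :
    {w ∈ U | chartSupp c w = chartSupp c z} ⊆ M.codimStratum (codim z) := fun _ hw =>
  codim_eq_of_chartSupp_eq hc (hU.subset_source hw.1) (hU.subset_source hz) hw.2

/-- In a good neighbourhood, the components of the strata of constant codimension are the strata
of constant support. -/
theorem IsGoodNhd.connectedComponentIn_eq (hc : c ∈ M.atlas) {U : Set M} (hU : IsGoodNhd c x U)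
    {z : M} (hz : z ∈ U) :
    connectedComponentIn (M.codimStratum (codim z) ∩ U) z =
      {w ∈ U | chartSupp c w = chartSupp c z} := by
  have hzF : z ∈ M.codimStratum (codim z) ∩ U := ⟨rfl, hz⟩
  refine Subset.antisymm (fun w hw => ?_)
    ((hU.isPreconnected _).subset_connectedComponentIn ⟨hz, rfl⟩
      (subset_inter (hU.subset_codimStratum hc hz) (sep_subset _ _)))
  have hwF := connectedComponentIn_subset _ _ hw
  refine ⟨hwF.2, ?_⟩
  by_contra hne
  let u : Set M := {y ∈ c.2.source | chartSupp c z ≤ chartSupp c y}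
  let v : Set M := ⋃ T ∈ {T : AddSubmonoid c.1 | IsFace T ∧ corank T = codim z ∧
    T ≠ chartSupp c z}, {y ∈ c.2.source | T ≤ chartSupp c y}
  have hu : IsOpen u := isOpen_le_chartSupp c (isFace_chartSupp c z)
  have hv : IsOpen v := isOpen_biUnion fun T hT => isOpen_le_chartSupp c hT.1
  have hmem : ∀ y ∈ M.codimStratum (codim z) ∩ U, chartSupp c y ≠ chartSupp c z → y ∈ v := by
    intro y hy hne
    refine mem_iUnion₂.2 ⟨chartSupp c y, ⟨isFace_chartSupp c y, ?_, hne⟩,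
      hU.subset_source hy.2, le_rfl⟩
    rw [← codim_eq_corank hc (hU.subset_source hy.2)]
    exact hy.1
  obtain ⟨y, hy, ⟨_, hyu⟩, hyv⟩ := isPreconnected_connectedComponentIn
    (x := z) (F := M.codimStratum (codim z) ∩ U) u v hu hv (fun y hy => by
      have hyF := connectedComponentIn_subset _ _ hy
      by_cases h : chartSupp c y = chartSupp c z
      · exact Or.inl ⟨hU.subset_source hyF.2, h.ge⟩
      · exact Or.inr (hmem y hyF h))
    ⟨z, mem_connectedComponentIn hzF, hU.subset_source hz, le_rfl⟩ ⟨w, hw, hmem w hwF hne⟩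
  have hyF := connectedComponentIn_subset _ _ hy
  obtain ⟨T, ⟨hT, hTr, hTne⟩, hys, hTy⟩ := mem_iUnion₂.1 hyv
  have h1 : chartSupp c z = chartSupp c y :=
    chartSupp_eq_of_le hc (hU.subset_source hz) hys hyu hyF.1.symm
  refine hTne ?_
  rw [h1]
  by_contra h2
  have h3 := corank_lt_of_lt c.1.toric hT (lt_of_le_of_ne hTy h2)
  rw [hTr, ← codim_eq_corank hc hys] at h3
  exact h3.ne hyF.1

theorem IsGoodNhd.exists_mem {U : Set M} (hU : IsGoodNhd c x U) {T : AddSubmonoid c.1}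
    (hT : IsFace T) (h : chartSupp c x ≤ T) : ∃ z ∈ U, chartSupp c z = T := by
  obtain ⟨z, hz, hzU⟩ := ((frequently_chartSupp_eq (hU.subset_source hU.mem) hT h).and_eventually
    (hU.isOpen.mem_nhds hU.mem)).exists
  exact ⟨z, hzU, hz⟩

theorem Face.interior_eq (K : M.Face) {y : M} (hy : y ∈ K.interior) :
    K.interior = connectedComponentIn (M.codimStratum (codim y)) y := by
  obtain ⟨l, x, hx, e⟩ := K.isComponent
  rw [e] at hy ⊢
  have hl : codim y = l := connectedComponentIn_subset (M.codimStratum l) x hy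
  rw [hl]
  exact _root_.connectedComponentIn_eq hy

theorem Face.codim_eq (K : M.Face) {y z : M} (hy : y ∈ K.interior) (hz : z ∈ K.interior) :
    codim z = codim y := by
  rw [K.interior_eq hy] at hz
  exact connectedComponentIn_subset (M.codimStratum (codim y)) y hz

theorem Face.ext {K K' : M.Face} (h : K.interior = K'.interior) : K = K' := by
  cases K
  cases K'
  cases h
  rfl

theorem Face.eq_of_mem_of_mem {K K' : M.Face} {y : M} (hy : y ∈ K.interior)
    (hy' : y ∈ K'.interior) : K = K' :=
  Face.ext (by rw [K.interior_eq hy, K'.interior_eq hy'])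

theorem Face.interior_subset (K : M.Face) : K.interior ⊆ K.toSet := subset_closure

theorem Face.interior_nonempty (K : M.Face) : K.interior.Nonempty := by
  obtain ⟨l, x, hx, e⟩ := K.isComponent
  exact ⟨x, e ▸ mem_connectedComponentIn hx⟩

theorem Face.isPreconnected_interior (K : M.Face) : IsPreconnected K.interior := by
  obtain ⟨l, x, hx, e⟩ := K.isComponent
  exact e ▸ isPreconnected_connectedComponentIn

theorem Face.isPreconnected (K : M.Face) : IsPreconnected K.toSet :=
  K.isPreconnected_interior.closure

/-- The boundary face whose interior contains a given point. -/
def faceOf (y : M) : M.Face :=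
  ⟨connectedComponentIn (M.codimStratum (codim y)) y, codim y, y, rfl, rfl⟩

theorem mem_interior_faceOf (y : M) : y ∈ (faceOf y).interior :=
  mem_connectedComponentIn (F := M.codimStratum (codim y)) rfl

theorem IsGoodNhd.subset_interior (hc : c ∈ M.atlas) {U : Set M} (hU : IsGoodNhd c x U)
    {K : M.Face} {z : M} (hz : z ∈ U) (hzK : z ∈ K.interior) :
    {w ∈ U | chartSupp c w = chartSupp c z} ⊆ K.interior := by
  rw [K.interior_eq hzK]
  exact (hU.isPreconnected _).subset_connectedComponentIn ⟨hz, rfl⟩ (hU.subset_codimStratum hc hz)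

/-- The face `T` of the monoid of a chart selects a component of the stratum of codimension
`corank T` in every neighbourhood of `x`. -/
theorem exists_localCorner (hc : c ∈ M.atlas) (hx : x ∈ c.2.source) {T : AddSubmonoid c.1}
    (hT : IsFace T) (h : chartSupp c x ≤ T) {l : ℕ} (hl : corank T = l) :
    ∃ γ : LocalCorner l x,
      ∀ (U : TopologicalSpace.OpenNhdsOf x) (V : Set M) (z : M), IsGoodNhd c x V →
        V ⊆ (U : Set M) → z ∈ V → chartSupp c z = T →
          γ.component U = connectedComponentIn (M.codimStratum l ∩ (U : Set M)) z := by
  have hcod : ∀ {V : Set M} {z : M}, IsGoodNhd c x V → z ∈ V → chartSupp c z = T →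
      codim z = l := fun hV hz hzT => by
    rw [codim_eq_corank hc (hV.subset_source hz), hzT, hl]
  have key : ∀ {U V V' : Set M} {z z' : M}, IsGoodNhd c x V → V ⊆ U → IsGoodNhd c x V' →
      V' ⊆ U → z ∈ V → z' ∈ V' → chartSupp c z = T → chartSupp c z' = T →
      connectedComponentIn (M.codimStratum l ∩ U) z =
        connectedComponentIn (M.codimStratum l ∩ U) z' := by
    intro U V V' z z' hV hVU hV' hVU' hz hz' hzT hzT'
    obtain ⟨y, hyT, hy, hy'⟩ := ((frequently_chartSupp_eq hx hT h).and_eventually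
      (inter_mem (hV.isOpen.mem_nhds hV.mem) (hV'.isOpen.mem_nhds hV'.mem))).exists
    have aux : ∀ {V : Set M} {z : M}, IsGoodNhd c x V → V ⊆ U → z ∈ V → chartSupp c z = T →
        y ∈ V → connectedComponentIn (M.codimStratum l ∩ U) z =
          connectedComponentIn (M.codimStratum l ∩ U) y := by
      intro V z hV hVU hz hzT hy
      have hsub : {w ∈ V | chartSupp c w = T} ⊆ M.codimStratum l ∩ U := fun w hw =>
        ⟨hcod hV hw.1 hw.2, hVU hw.1⟩
      exact _root_.connectedComponentIn_eq ((hV.isPreconnected T).subset_connectedComponentIn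
        ⟨hz, hzT⟩ hsub ⟨hy, hyT⟩)
    rw [aux hV hVU hz hzT hy, aux hV' hVU' hz' hzT' hy']
  have hex : ∀ U : TopologicalSpace.OpenNhdsOf x, ∃ (V : Set M) (z : M), IsGoodNhd c x V ∧
      V ⊆ (U : Set M) ∧ z ∈ V ∧ chartSupp c z = T := fun U => by
    obtain ⟨V, hVU, hV⟩ := exists_isGoodNhd hx (U.isOpen.mem_nhds U.mem)
    obtain ⟨z, hz, hzT⟩ := hV.exists_mem hT h
    exact ⟨V, z, hV, hVU, hz, hzT⟩
  choose V z hV hVU hz hzT using hex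
  refine ⟨⟨fun U => connectedComponentIn (M.codimStratum l ∩ (U : Set M)) (z U),
    fun U => ⟨z U, ⟨hcod (hV U) (hz U) (hzT U), hVU U (hz U)⟩, rfl⟩, fun U U' hUU' => ?_⟩,
    fun U W w hW hWU hw hwT => key (hV U) (hVU U) hW hWU (hz U) hw (hzT U) hwT⟩
  have hle : (U : Set M) ⊆ (U' : Set M) := hUU'
  show connectedComponentIn _ (z U) ⊆ connectedComponentIn _ (z U')
  rw [key (hV U') (hVU U') (hV U) ((hVU U).trans hle) (hz U') (hz U) (hzT U') (hzT U)]
  exact connectedComponentIn_mono _ (inter_subset_inter_right _ hle)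

/-- Near `x`, the boundary face `K` corresponds to the face `T` of the monoid of the chart: `K`
and its interior consist of the points whose support is contained in and equal to `T`. -/
structure IsLocalFace (K : M.Face) (c : Chart M) (x : M) (T : AddSubmonoid c.1) : Prop where
  isFace : IsFace T
  le : chartSupp c x ≤ T
  eventually : ∀ᶠ y in 𝓝 x, (y ∈ K.interior ↔ chartSupp c y = T) ∧
    (y ∈ K.toSet ↔ chartSupp c y ≤ T)

theorem IsLocalFace.of_interior (hx : x ∈ c.2.source) {K : M.Face} {T : AddSubmonoid c.1}
    (hT : IsFace T) (h : chartSupp c x ≤ T)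
    (hK : ∀ᶠ y in 𝓝 x, y ∈ K.interior ↔ chartSupp c y = T) : IsLocalFace K c x T := by
  refine ⟨hT, h, ?_⟩
  filter_upwards [hK, hK.eventually_nhds, c.2.open_source.mem_nhds hx] with y hy hy' hys
  refine ⟨hy, ?_⟩
  rw [Face.toSet, mem_closure_iff_frequently]
  constructor
  · intro hf
    obtain ⟨z, hzK, hzT, hz⟩ := (hf.and_eventually (hy'.and (eventually_chartSupp_le hys))).exists
    exact hz.trans (hzT.1 hzK).le
  · intro hle
    exact ((frequently_chartSupp_eq hys hT hle).and_eventually hy').mono fun z hz => hz.2.2 hz.1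

/-- Near each of its points, a boundary face corresponds to a single face of the monoid of a
chart: two different ones would give two local corners in the same boundary face. -/
theorem exists_isLocalFace (hM : M.EmbeddedFaces) (hc : c ∈ M.atlas) (hx : x ∈ c.2.source)
    {K : M.Face} (hxK : x ∈ K.toSet) : ∃ T, IsLocalFace K c x T := by
  obtain ⟨U, -, hU⟩ := exists_isGoodNhd hx univ_mem
  obtain ⟨y, hyK, hyU⟩ := ((mem_closure_iff_frequently.1 hxK).and_eventually
    (hU.isOpen.mem_nhds hU.mem)).exists
  have hsub := hU.subset_interior hc hyU hyK
  refine ⟨chartSupp c y, IsLocalFace.of_interior hx (isFace_chartSupp c y) (hU.le_supp y hyU) ?_⟩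
  filter_upwards [hU.isOpen.mem_nhds hU.mem] with z hzU
  refine ⟨fun hzK => ?_, fun h => hsub ⟨hzU, h⟩⟩
  have hy := codim_eq_corank hc (hU.subset_source hyU)
  have hz := (codim_eq_corank hc (hU.subset_source hzU)).symm.trans (K.codim_eq hyK hzK)
  obtain ⟨γ, hγ⟩ := exists_localCorner hc hx (isFace_chartSupp c y) (hU.le_supp y hyU) hy.symm
  obtain ⟨γ', hγ'⟩ := exists_localCorner hc hx (isFace_chartSupp c z) (hU.le_supp z hzU) hz
  have hzK' : K.interior = connectedComponentIn (M.codimStratum (codim y)) z := by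
    rw [← K.codim_eq hyK hzK]
    exact K.interior_eq hzK
  have htop : γ.component ⊤ = γ'.component ⊤ := by
    rw [hγ ⊤ U y hU (subset_univ U) hyU rfl, hγ' ⊤ U z hU (subset_univ U) hzU rfl]
    rw [show ((⊤ : TopologicalSpace.OpenNhdsOf x) : Set M) = univ from rfl, inter_univ,
      ← K.interior_eq hyK, ← hzK']
  have hγγ : γ = γ' := hM _ x γ γ' htop
  let U' : TopologicalSpace.OpenNhdsOf x := ⟨⟨U, hU.isOpen⟩, hU.mem⟩
  have h1 := hγ U' U y hU Subset.rfl hyU rfl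
  have h2 := hγ' U' U z hU Subset.rfl hzU rfl
  rw [hγγ, h2, show ((U' : TopologicalSpace.OpenNhdsOf x) : Set M) = U from rfl,
    hU.connectedComponentIn_eq hc hyU] at h1
  have h3 : z ∈ {w ∈ U | chartSupp c w = chartSupp c y} := by
    rw [← h1]
    exact mem_connectedComponentIn ⟨K.codim_eq hyK hzK, hzU⟩
  exact h3.2

theorem IsLocalFace.frequently (hx : x ∈ c.2.source) {K : M.Face} {T : AddSubmonoid c.1}
    (h : IsLocalFace K c x T) : ∃ᶠ y in 𝓝 x, y ∈ K.interior ∧ chartSupp c y = T :=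
  ((frequently_chartSupp_eq hx h.isFace h.le).and_eventually h.eventually).mono
    fun _ hy => ⟨hy.2.1.2 hy.1, hy.1⟩

theorem IsLocalFace.face_unique (hx : x ∈ c.2.source) {K K' : M.Face} {T : AddSubmonoid c.1}
    (h : IsLocalFace K c x T) (h' : IsLocalFace K' c x T) : K = K' := by
  obtain ⟨y, ⟨hy, hyT⟩, hy'⟩ := ((h.frequently hx).and_eventually h'.eventually).exists
  exact Face.eq_of_mem_of_mem hy (hy'.1.2 hyT)

theorem IsLocalFace.mem {K : M.Face} {T : AddSubmonoid c.1} (h : IsLocalFace K c x T) :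
    x ∈ K.toSet :=
  h.eventually.self_of_nhds.2.2 h.le

theorem IsLocalFace.eventually_isLocalFace {K : M.Face} {T : AddSubmonoid c.1}
    (h : IsLocalFace K c x T) : ∀ᶠ y in 𝓝 x, y ∈ K.toSet → IsLocalFace K c y T := by
  filter_upwards [h.eventually, h.eventually.eventually_nhds] with y hy hy' hyK
  exact ⟨h.isFace, hy.2.1 hyK, hy'⟩

/-- Every face of the monoid of a chart that contains the support of `x` comes from a boundary
face. -/
theorem exists_face_isLocalFace (hM : M.EmbeddedFaces) (hc : c ∈ M.atlas) (hx : x ∈ c.2.source)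
    {T : AddSubmonoid c.1} (hT : IsFace T) (h : chartSupp c x ≤ T) :
    ∃ K : M.Face, IsLocalFace K c x T := by
  obtain ⟨U, -, hU⟩ := exists_isGoodNhd hx univ_mem
  obtain ⟨y, hyU, rfl⟩ := hU.exists_mem hT h
  have hsub := hU.subset_interior hc hyU (mem_interior_faceOf y)
  have hf : ∃ᶠ z in 𝓝 x, z ∈ (faceOf y).interior ∧ chartSupp c z = chartSupp c y :=
    ((frequently_chartSupp_eq hx hT h).and_eventually (hU.isOpen.mem_nhds hU.mem)).mono
      fun z hz => ⟨hsub ⟨hz.2, hz.1⟩, hz.1⟩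
  obtain ⟨T, hT'⟩ := exists_isLocalFace hM hc hx (K := faceOf y)
    (mem_closure_iff_frequently.2 (hf.mono fun _ hz => hz.1))
  obtain ⟨z, ⟨hz, hzT⟩, hz'⟩ := (hf.and_eventually hT'.eventually).exists
  rw [hz'.1.1 hz] at hzT
  exact ⟨faceOf y, hzT ▸ hT'⟩

/-- A boundary face that meets the interior of another one contains it. -/
theorem Face.le_of_mem_of_mem (hM : M.EmbeddedFaces) {G F : M.Face} {y : M}
    (hG : y ∈ G.interior) (hF : y ∈ F.toSet) : G ≤ F := by
  have hcl : IsClosed F.toSet := isClosed_closure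
  -- `G.interior ∩ F` is open and closed in `G.interior`.
  let O : Set M := {z | ∀ᶠ w in 𝓝 z, w ∈ G.interior → w ∈ F.toSet}
  have hO : IsOpen O := isOpen_iff_mem_nhds.2 fun z hz => Eventually.eventually_nhds hz
  have hmem : ∀ z ∈ G.interior, z ∈ F.toSet → z ∈ O := by
    intro z hzG hzF
    obtain ⟨c, hc, hz⟩ := M.cover z
    obtain ⟨T, hT⟩ := exists_isLocalFace hM hc hz (G.interior_subset hzG)
    obtain ⟨T', hT'⟩ := exists_isLocalFace hM hc hz hzF
    have hzT : chartSupp c z = T := hT.eventually.self_of_nhds.1.1 hzG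
    filter_upwards [hT.eventually, hT'.eventually] with w hw hw' hwG
    rw [hw'.2, hw.1.1 hwG, ← hzT]
    exact hT'.le
  have hsub : G.interior ⊆ F.toSet := by
    by_contra hcon
    obtain ⟨z, hzG, hzF⟩ := not_subset.1 hcon
    obtain ⟨w, hwG, hwO, hwF⟩ := G.isPreconnected_interior O F.toSetᶜ hO hcl.isOpen_compl
      (fun w hw => (em (w ∈ F.toSet)).imp (hmem w hw) id) ⟨y, hG, hmem y hG hF⟩ ⟨z, hzG, hzF⟩
    exact hwF (hwO.self_of_nhds hwG)
  exact closure_minimal hsub hcl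

theorem Face.le_refl (F : M.Face) : F ≤ F := Subset.rfl

theorem Face.le_trans {F G H : M.Face} (h : F ≤ G) (h' : G ≤ H) : F ≤ H := Subset.trans h h'

theorem IsLocalFace.le_iff (hM : M.EmbeddedFaces) (hx : x ∈ c.2.source)
    {K K' : M.Face} {T T' : AddSubmonoid c.1} (h : IsLocalFace K c x T)
    (h' : IsLocalFace K' c x T') : K ≤ K' ↔ T ≤ T' := by
  obtain ⟨y, ⟨hy, hyT⟩, hy'⟩ := ((h.frequently hx).and_eventually h'.eventually).exists
  rw [← hyT, ← hy'.2]
  exact ⟨fun hle => hle (K.interior_subset hy), fun hyK => Face.le_of_mem_of_mem hM hy hyK⟩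

/-- Only finitely many boundary faces contain a given point. -/
theorem finite_faces_mem (hM : M.EmbeddedFaces) (x : M) : {K : M.Face | x ∈ K.toSet}.Finite := by
  obtain ⟨c, hc, hx⟩ := M.cover x
  have h : ∀ K : {K : M.Face | x ∈ K.toSet}, ∃ T, IsLocalFace K.1 c x T := fun K =>
    exists_isLocalFace hM hc hx K.2
  choose T hT using h
  have := c.1.toric.finite_faces.to_subtype
  refine Finite.of_injective (β := {T : AddSubmonoid c.1 | IsFace T})
    (fun K => ⟨T K, (hT K).isFace⟩) fun K K' e => ?_
  have e' : T K = T K' := congrArg Subtype.val e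
  exact Subtype.ext ((hT K).face_unique hx (e' ▸ hT K'))

/-- A germ is tangential to a boundary face if and only if its monomial lies in the corresponding
face of the monoid of a chart. -/
theorem IsLocalFace.tangential_iff (hx : x ∈ c.2.source) {K : M.Face} {T : AddSubmonoid c.1}
    (h : IsLocalFace K c x T) {β : M.BStalk x} {p : c.1} (hp : StalkMono c β p) :
    Tangential K x β ↔ p ∈ T := by
  obtain ⟨b, hb, rfl, hp⟩ := hp
  have hev : ∀ᶠ y in 𝓝 x, (b y ≠ 0 ↔ p ∈ chartSupp c y) := by
    filter_upwards [hp.eventually hx, c.2.open_source.mem_nhds hx] with y h1 h2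
    exact h1.ne_zero_iff h2
  constructor
  · rintro ⟨b', hb', hne⟩
    have e : b' =ᶠ[𝓝 x] b := Germ.coe_eq.1 hb'
    by_contra hpT
    refine hne ?_
    rw [eventually_nhdsWithin_iff]
    filter_upwards [e, hev, h.eventually] with y h1 h2 h3 hyK
    by_contra h0
    exact hpT (h3.2.1 hyK (h2.1 (h1 ▸ h0)))
  · intro hpT
    refine ⟨b, rfl, fun h0 => ?_⟩
    rw [eventually_nhdsWithin_iff] at h0
    obtain ⟨y, ⟨hyK, hyT⟩, h1, h2⟩ := ((h.frequently hx).and_eventually (h0.and hev)).exists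
    exact h2.2 (hyT ▸ hpT) (h1 (K.interior_subset hyK))

end LocalFaces

/-! ### Orders of vanishing along hypersurfaces -/

section Orders

variable {M : PreManifold.{u}} {c : Chart M} {x : M}

/-- Equality of two germs in the quotient `B_x / T(K,x)`. -/
def StalkRel (K : M.Face) (x : M) (β β' : M.BStalk x) : Prop :=
  ∃ t t' : M.BStalk x, Tangential K x t ∧ Tangential K x t' ∧ β * t = β' * t'

theorem IsLocalFace.stalkRel_iff (hc : c ∈ M.atlas) (hx : x ∈ c.2.source) {K : M.Face}
    {T : AddSubmonoid c.1} (h : IsLocalFace K c x T) {β β' : M.BStalk x} {p p' : c.1}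
    (hp : StalkMono c β p) (hp' : StalkMono c β' p') : StalkRel K x β β' ↔ RelMod T p p' := by
  constructor
  · rintro ⟨t, t', ht, ht', e⟩
    obtain ⟨r, hr⟩ := exists_stalkMono hc hx t
    obtain ⟨r', hr'⟩ := exists_stalkMono hc hx t'
    have h1 := (h.tangential_iff hx hr).1 ht
    have h2 := (h.tangential_iff hx hr').1 ht'
    have h3 := ((e ▸ hp.mul hr).relMod hx (hp'.mul hr')).mono h.le
    exact RelMod.trans ⟨r, h1, 0, T.zero_mem, (add_zero _).symm⟩
      (h3.trans ⟨0, T.zero_mem, r', h2, add_zero _⟩)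
  · rintro ⟨t, ht, t', ht', e⟩
    have h1 := hp.mul (stalkMono_stalkCoord hc hx t)
    have h2 := hp'.mul (stalkMono_stalkCoord hc hx t')
    obtain ⟨η, η', hη, hη', e'⟩ := h1.exists_mul_eq hc hx (e ▸ h2)
    refine ⟨_, _, ?_, ?_, (mul_assoc _ _ _).symm.trans (e'.trans (mul_assoc _ _ _))⟩
    · refine (h.tangential_iff hx ((stalkMono_stalkCoord hc hx t).mul hη)).2 ?_
      rwa [add_zero]
    · refine (h.tangential_iff hx ((stalkMono_stalkCoord hc hx t').mul hη')).2 ?_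
      rwa [add_zero]

/-- A homomorphism from the monoid of a chart which respects equality modulo the support of `x`
extends to germs. -/
theorem exists_stalk_lift (hc : c ∈ M.atlas) (hx : x ∈ c.2.source) {A : Type*} [AddMonoid A]
    (v : c.1 →+ A) (hv : ∀ s ∈ chartSupp c x, v s = 0) :
    ∃ w : Additive (M.BStalk x) →+ A, ∀ (β : M.BStalk x) (p : c.1), StalkMono c β p →
      w (Additive.ofMul β) = v p := by
  choose p hp using fun β : M.BStalk x => exists_stalkMono hc hx β
  have key : ∀ (β : M.BStalk x) (q : c.1), StalkMono c β q → v (p β) = v q := fun β q hq =>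
    ((hp β).relMod hx hq).map_eq v hv
  refine ⟨⟨⟨fun β => v (p β.toMul), ?_⟩, fun β β' => ?_⟩, key⟩
  · refine (key 1 0 ?_).trans (map_zero v)
    have := stalkMono_stalkCoord hc hx 0
    rwa [map_zero] at this
  · exact (key _ _ ((hp β.toMul).mul (hp β'.toMul))).trans (map_add v _ _)

theorem stalkMono_eq {A : Type*} [AddMonoid A] (hc : c ∈ M.atlas) (hx : x ∈ c.2.source)
    {K : M.Face} {T : AddSubmonoid c.1} (h : IsLocalFace K c x T)
    (w : Additive (M.BStalk x) →+ A)
    (hw : ∀ β β' : M.BStalk x, StalkRel K x β β' → w (Additive.ofMul β) = w (Additive.ofMul β'))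
    {β : M.BStalk x} {p : c.1} (hp : StalkMono c β p) :
    w (Additive.ofMul β) = w (stalkCoord hc hx p) :=
  hw _ _ ((h.stalkRel_iff hc hx hp (stalkMono_stalkCoord hc hx p)).2 (RelMod.refl T p))

/-- `v` identifies `B_x / T(H,x)` with `ℕ`; it is the order of vanishing along `H`. -/
structure IsOrder (H : M.Face) (x : M) (v : Additive (M.BStalk x) →+ ℕ) : Prop where
  surjective : Function.Surjective v
  eq_iff : ∀ β β' : M.BStalk x,
    v (Additive.ofMul β) = v (Additive.ofMul β') ↔ StalkRel H x β β'

theorem IsOrder.isFacetNormal (hc : c ∈ M.atlas) (hx : x ∈ c.2.source) {H : M.Face}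
    {T : AddSubmonoid c.1} (h : IsLocalFace H c x T) {v : Additive (M.BStalk x) →+ ℕ}
    (hv : IsOrder H x v) : IsFacetNormal T (v.comp (stalkCoord hc hx)) where
  surjective n := by
    obtain ⟨β, rfl⟩ := hv.surjective n
    obtain ⟨p, hp⟩ := exists_stalkMono hc hx β.toMul
    exact ⟨p, (stalkMono_eq hc hx h v (fun β β' => (hv.eq_iff β β').2) hp).symm⟩
  eq_iff p q := (hv.eq_iff _ _).trans
    (h.stalkRel_iff hc hx (stalkMono_stalkCoord hc hx p) (stalkMono_stalkCoord hc hx q))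

theorem IsOrder.apply_eq (hc : c ∈ M.atlas) (hx : x ∈ c.2.source) {H : M.Face}
    {T : AddSubmonoid c.1} (h : IsLocalFace H c x T) {v : Additive (M.BStalk x) →+ ℕ}
    (hv : IsOrder H x v) {w : c.1 →+ ℕ} (hw : IsFacetNormal T w) {β : M.BStalk x} {p : c.1}
    (hp : StalkMono c β p) : v (Additive.ofMul β) = w p := by
  rw [hw.unique (hv.isFacetNormal hc hx h)]
  exact stalkMono_eq hc hx h v (fun β β' => (hv.eq_iff β β').2) hp

theorem IsLocalFace.exists_isOrder (hc : c ∈ M.atlas) (hx : x ∈ c.2.source) {H : M.Face}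
    {T : AddSubmonoid c.1} (h : IsLocalFace H c x T) {w : c.1 →+ ℕ} (hw : IsFacetNormal T w) :
    ∃ v, IsOrder H x v := by
  obtain ⟨v, hv⟩ := exists_stalk_lift hc hx w fun s hs => by
    rw [← map_zero w, hw.eq_iff]
    exact ⟨0, T.zero_mem, s, h.le hs, by rw [add_zero, zero_add]⟩
  refine ⟨v, fun n => ?_, fun β β' => ?_⟩
  · obtain ⟨p, rfl⟩ := hw.surjective n
    exact ⟨stalkCoord hc hx p, hv _ p (stalkMono_stalkCoord hc hx p)⟩
  · obtain ⟨p, hp⟩ := exists_stalkMono hc hx β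
    obtain ⟨p', hp'⟩ := exists_stalkMono hc hx β'
    rw [hv β p hp, hv β' p' hp', hw.eq_iff, h.stalkRel_iff hc hx hp hp']

/-- A boundary hypersurface: a boundary face along which b-functions have orders of vanishing. -/
def IsHypersurface (H : M.Face) : Prop := ∀ x ∈ H.toSet, ∃ v, IsOrder H x v

/-- A boundary face is a hypersurface if it is one near one of its points. -/
theorem isHypersurface_of_isFacetNormal (hM : M.EmbeddedFaces) (hc : c ∈ M.atlas)
    (hx : x ∈ c.2.source) {H : M.Face} {T : AddSubmonoid c.1} (h : IsLocalFace H c x T)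
    {w : c.1 →+ ℕ} (hw : IsFacetNormal T w) : IsHypersurface H := by
  have key : ∀ y ∈ H.toSet, ∀ᶠ z in 𝓝[H.toSet] y,
      ((∃ v, IsOrder H y v) ↔ ∃ v, IsOrder H z v) := by
    intro y hy
    obtain ⟨c', hc', hy'⟩ := M.cover y
    obtain ⟨T', hT'⟩ := exists_isLocalFace hM hc' hy' hy
    rw [eventually_nhdsWithin_iff]
    filter_upwards [hT'.eventually_isLocalFace, c'.2.open_source.mem_nhds hy'] with z h1 hz' hz
    exact ⟨fun ⟨v, hv⟩ => (h1 hz).exists_isOrder hc' hz' (hv.isFacetNormal hc' hy' hT'),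
      fun ⟨v, hv⟩ => hT'.exists_isOrder hc' hy' (hv.isFacetNormal hc' hz' (h1 hz))⟩
  intro y hy
  exact (H.isPreconnected.induction₂ (fun y z => (∃ v, IsOrder H y v) ↔ ∃ v, IsOrder H z v) key
    (fun _ _ _ _ _ _ h h' => h.trans h') (fun _ _ _ _ h => h.symm) h.mem hy).1
      (h.exists_isOrder hc hx hw)

/-- The order of vanishing of germs at `x` along a hypersurface. -/
noncomputable def ord {H : M.Face} (hH : IsHypersurface H) (hx : x ∈ H.toSet) :
    Additive (M.BStalk x) →+ ℕ := (hH x hx).choose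

theorem isOrder_ord {H : M.Face} (hH : IsHypersurface H) (hx : x ∈ H.toSet) :
    IsOrder H x (ord hH hx) := (hH x hx).choose_spec

/-! ### The conormal monoid of a boundary face -/

/-- The hypersurfaces that contain `F`. -/
abbrev HypersurfaceAbove (F : M.Face) : Type u := {H : M.Face // IsHypersurface H ∧ F ≤ H}

/-- The orders of vanishing of germs at `x` along all hypersurfaces that contain `F`. -/
noncomputable def ordMap (F : M.Face) {x : M} (hx : x ∈ F.toSet) :
    Additive (M.BStalk x) →+ (HypersurfaceAbove F → ℕ) :=
  AddMonoidHom.pi fun H => ord H.2.1 (H.2.2 hx)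

theorem ordMap_apply (F : M.Face) (hx : x ∈ F.toSet) (β : Additive (M.BStalk x))
    (H : HypersurfaceAbove F) : ordMap F hx β H = ord H.2.1 (H.2.2 hx) β := rfl

/-- Germs are determined in `B_x / T(F,x)` by their orders along the hypersurfaces containing
`F`. -/
theorem ordMap_eq_iff (hM : M.EmbeddedFaces) {F : M.Face} (hxF : x ∈ F.toSet)
    (β β' : M.BStalk x) :
    ordMap F hxF (Additive.ofMul β) = ordMap F hxF (Additive.ofMul β') ↔ StalkRel F x β β' := by
  obtain ⟨c, hc, hx⟩ := M.cover x
  obtain ⟨T, hT⟩ := exists_isLocalFace hM hc hx hxF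
  obtain ⟨p, hp⟩ := exists_stalkMono hc hx β
  obtain ⟨p', hp'⟩ := exists_stalkMono hc hx β'
  rw [hT.stalkRel_iff hc hx hp hp']
  constructor
  · intro h
    refine c.1.toric.relMod_of_facetNormal hT.isFace fun T' v hT' hTT' hv => ?_
    obtain ⟨H, hH⟩ := exists_face_isLocalFace hM hc hx hT' (hT.le.trans hTT')
    have hHyp := isHypersurface_of_isFacetNormal hM hc hx hH hv
    have e := congrFun h ⟨H, hHyp, (hT.le_iff hM hx hH).2 hTT'⟩
    rw [ordMap_apply, ordMap_apply] at e
    rwa [(isOrder_ord hHyp _).apply_eq hc hx hH hv hp,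
      (isOrder_ord hHyp _).apply_eq hc hx hH hv hp'] at e
  · intro h
    funext ⟨H, hHyp, hFH⟩
    obtain ⟨T', hT'⟩ := exists_isLocalFace hM hc hx (hFH hxF)
    exact ((isOrder_ord hHyp (hFH hxF)).eq_iff β β').2 ((hT'.stalkRel_iff hc hx hp hp').2
      (h.mono ((hT.le_iff hM hx hT').1 hFH)))

/-- The orders of vanishing of a monomial of a chart are locally constant. -/
theorem eventually_ordMap_eq (hM : M.EmbeddedFaces) (hc : c ∈ M.atlas) (hx : x ∈ c.2.source)
    {F : M.Face} (hxF : x ∈ F.toSet) : ∀ᶠ y in 𝓝[F.toSet] x, ∃ hy : y ∈ F.toSet,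
      ∀ (p : c.1) (β : M.BStalk x) (β' : M.BStalk y), StalkMono c β p → StalkMono c β' p →
        ordMap F hy (Additive.ofMul β') = ordMap F hxF (Additive.ofMul β) := by
  have h1 : ∀ᶠ y in 𝓝 x, ∀ K ∈ {K : M.Face | x ∈ K.toSet}, y ∈ K.toSet →
      ∃ T, IsLocalFace K c x T ∧ IsLocalFace K c y T := by
    refine (eventually_all_finite (finite_faces_mem hM x)).2 fun K hK => ?_
    obtain ⟨T, hT⟩ := exists_isLocalFace hM hc hx hK
    filter_upwards [hT.eventually_isLocalFace] with y hy hyK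
    exact ⟨T, hT, hy hyK⟩
  rw [eventually_nhdsWithin_iff]
  filter_upwards [h1, c.2.open_source.mem_nhds hx] with y hy hys hyF
  refine ⟨hyF, fun p β β' hβ hβ' => funext fun ⟨H, hHyp, hFH⟩ => ?_⟩
  obtain ⟨T, hT, hT'⟩ := hy H (hFH hxF) (hFH hyF)
  have hn := (isOrder_ord hHyp (hFH hxF)).isFacetNormal hc hx hT
  rw [ordMap_apply, ordMap_apply, (isOrder_ord hHyp (hFH hxF)).apply_eq hc hx hT hn hβ,
    (isOrder_ord hHyp (hFH hyF)).apply_eq hc hys hT' hn hβ']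

theorem mrange_ordMap_eq (hM : M.EmbeddedFaces) (F : M.Face) {x y : M} (hx : x ∈ F.toSet)
    (hy : y ∈ F.toSet) :
    AddMonoidHom.mrange (ordMap F hx) = AddMonoidHom.mrange (ordMap F hy) := by
  refine F.isPreconnected.induction₂ (fun x y => ∀ (hx : x ∈ F.toSet) (hy : y ∈ F.toSet),
    AddMonoidHom.mrange (ordMap F hx) = AddMonoidHom.mrange (ordMap F hy)) (fun x hxF => ?_)
    (fun x y z _ hy _ h h' hx hz => (h hx hy).trans (h' hy hz))
    (fun x y _ _ h hy hx => (h hx hy).symm) hx hy hx hy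
  obtain ⟨c, hc, hx⟩ := M.cover x
  filter_upwards [eventually_ordMap_eq hM hc hx hxF,
    mem_nhdsWithin_of_mem_nhds (c.2.open_source.mem_nhds hx)] with y ⟨hyF, hy⟩ hys _ _
  ext w
  constructor
  · rintro ⟨β, rfl⟩
    obtain ⟨p, hp⟩ := exists_stalkMono hc hx β.toMul
    exact ⟨_, hy p _ _ hp (stalkMono_stalkCoord hc hys p)⟩
  · rintro ⟨β, rfl⟩
    obtain ⟨p, hp⟩ := exists_stalkMono hc hys β.toMul
    exact ⟨_, (hy p _ _ (stalkMono_stalkCoord hc hx p) hp).symm⟩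

/-- The conormal monoid `W(F)`: the possible orders of vanishing of germs at points of `F` along
the hypersurfaces that contain `F`.  It is defined with an arbitrary point of `F`. -/
noncomputable def conormal (F : M.Face) : AddSubmonoid (HypersurfaceAbove F → ℕ) :=
  AddMonoidHom.mrange (ordMap F (F.interior_subset F.interior_nonempty.some_mem))

/-- The projection `B_x → W(F)`. -/
noncomputable def conormalProj (hM : M.EmbeddedFaces) (F : M.Face) {x : M} (hx : x ∈ F.toSet) :
    Additive (M.BStalk x) →+ conormal F :=
  (ordMap F hx).codRestrict (conormal F) fun β => by
    rw [conormal, mrange_ordMap_eq hM F _ hx]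
    exact ⟨β, rfl⟩

theorem conormalProj_surjective (hM : M.EmbeddedFaces) (F : M.Face) (hx : x ∈ F.toSet) :
    Function.Surjective (conormalProj hM F hx) := by
  rintro ⟨w, hw⟩
  rw [conormal, mrange_ordMap_eq hM F _ hx] at hw
  obtain ⟨β, rfl⟩ := hw
  exact ⟨β, rfl⟩

theorem conormalProj_eq_iff (hM : M.EmbeddedFaces) (F : M.Face) (hx : x ∈ F.toSet)
    (β β' : M.BStalk x) :
    conormalProj hM F hx (Additive.ofMul β) = conormalProj hM F hx (Additive.ofMul β') ↔
      StalkRel F x β β' := by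
  rw [← ordMap_eq_iff hM hx, Subtype.ext_iff]
  rfl

theorem conormalProj_eq_zero_iff (hM : M.EmbeddedFaces) (F : M.Face) (hxF : x ∈ F.toSet)
    (β : M.BStalk x) : conormalProj hM F hxF (Additive.ofMul β) = 0 ↔ Tangential F x β := by
  obtain ⟨c, hc, hx⟩ := M.cover x
  obtain ⟨T, hT⟩ := exists_isLocalFace hM hc hx hxF
  obtain ⟨p, hp⟩ := exists_stalkMono hc hx β
  have h1 : StalkMono c (1 : M.BStalk x) 0 := by
    have := stalkMono_stalkCoord hc hx 0
    rwa [map_zero] at this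
  rw [← map_zero (conormalProj hM F hxF), ← ofMul_one, conormalProj_eq_iff,
    hT.stalkRel_iff hc hx hp h1, hT.tangential_iff hx hp]
  refine ⟨fun h => hT.isFace.mem_of_relMod h T.zero_mem, fun h => ?_⟩
  exact ⟨0, T.zero_mem, p, h, by rw [add_zero, zero_add]⟩

theorem eventually_conormalProj_eq (hM : M.EmbeddedFaces) (F : M.Face) (hxF : x ∈ F.toSet)
    {b : M → ℝ} (hb : M.BAt b x) : ∀ᶠ y in 𝓝[F.toSet] x, ∃ (hy : y ∈ F.toSet) (hb' : M.BAt b y),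
      conormalProj hM F hy (Additive.ofMul (germ b y hb')) =
        conormalProj hM F hxF (Additive.ofMul (germ b x hb)) := by
  obtain ⟨c, hc, hx⟩ := M.cover x
  obtain ⟨p, hp⟩ := (bAt_iff hc hx).1 hb
  filter_upwards [eventually_ordMap_eq hM hc hx hxF, mem_nhdsWithin_of_mem_nhds hb.eventually,
    mem_nhdsWithin_of_mem_nhds (hp.eventually hx)] with y ⟨hy, h⟩ hb' hp'
  exact ⟨hy, hb', Subtype.ext (h p _ _ ⟨b, hb, rfl, hp⟩ ⟨b, hb', rfl, hp'⟩)⟩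

/-- The monoid of a chart projects to the conormal monoid, with kernel the face corresponding to
`F`. -/
theorem conormalProj_stalkCoord_eq_iff (hM : M.EmbeddedFaces) (hc : c ∈ M.atlas)
    (hx : x ∈ c.2.source) {F : M.Face} {T : AddSubmonoid c.1} (h : IsLocalFace F c x T)
    (p q : c.1) : conormalProj hM F h.mem (stalkCoord hc hx p) =
      conormalProj hM F h.mem (stalkCoord hc hx q) ↔ RelMod T p q :=
  (conormalProj_eq_iff hM F h.mem _ _).trans
    (h.stalkRel_iff hc hx (stalkMono_stalkCoord hc hx p) (stalkMono_stalkCoord hc hx q))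

theorem conormalProj_stalkCoord_surjective (hM : M.EmbeddedFaces) (hc : c ∈ M.atlas)
    (hx : x ∈ c.2.source) {F : M.Face} {T : AddSubmonoid c.1} (h : IsLocalFace F c x T) :
    Function.Surjective ((conormalProj hM F h.mem).comp (stalkCoord hc hx)) := by
  intro w
  obtain ⟨β, rfl⟩ := conormalProj_surjective hM F h.mem w
  obtain ⟨p, hp⟩ := exists_stalkMono hc hx β.toMul
  exact ⟨p, (stalkMono_eq hc hx h _ (fun β β' => (conormalProj_eq_iff hM F h.mem β β').2) hp).symm⟩

theorem isToric_conormal (hM : M.EmbeddedFaces) (F : M.Face) : IsToric (conormal F) := by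
  obtain ⟨x, hxF⟩ := F.interior_nonempty
  obtain ⟨c, hc, hx⟩ := M.cover x
  obtain ⟨T, hT⟩ := exists_isLocalFace hM hc hx (F.interior_subset hxF)
  exact c.1.toric.of_quotient hT.isFace (conormalProj_stalkCoord_surjective hM hc hx hT)
    (conormalProj_stalkCoord_eq_iff hM hc hx hT)

end Orders

end PreManifold

theorem exists_comp_eq_of_surjective {A B C : Type*} [AddMonoid A] [AddMonoid B] [AddMonoid C]
    {π : A →+ B} (hπ : Function.Surjective π) (w : A →+ C) (h : ∀ a a', π a = π a' → w a = w a') :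
    ∃ w' : B →+ C, ∀ a, w' (π a) = w a := by
  choose s hs using hπ
  have key : ∀ a, w (s (π a)) = w a := fun a => h _ _ (hs _)
  refine ⟨⟨⟨fun b => w (s b), ?_⟩, fun b b' => ?_⟩, key⟩
  · exact (h _ 0 (by rw [hs, map_zero])).trans (map_zero w)
  · exact (h _ (s b + s b') (by rw [hs, map_add, hs, hs])).trans (map_add w _ _)

namespace PreManifold

/-! ### The complex of normal monoids -/

section NormalComplex

variable {M : PreManifold.{u}} {x : M}

/-- The restriction `W(G) → W(F)` to the hypersurfaces that contain `F`. -/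
noncomputable def conormalRes (hM : M.EmbeddedFaces) {F G : M.Face} (h : G ≤ F) :
    conormal G →+ conormal F where
  toFun w := ⟨fun H => w.1 ⟨H.1, H.2.1, Face.le_trans h H.2.2⟩, by
    obtain ⟨x, hx⟩ := G.interior_nonempty
    obtain ⟨β, rfl⟩ := conormalProj_surjective hM G (G.interior_subset hx) w
    exact (conormalProj hM F (h (G.interior_subset hx)) β).2⟩
  map_zero' := rfl
  map_add' _ _ := rfl

theorem conormalRes_proj (hM : M.EmbeddedFaces) {F G : M.Face} (h : G ≤ F) (hx : x ∈ G.toSet)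
    (β : Additive (M.BStalk x)) :
    conormalRes hM h (conormalProj hM G hx β) = conormalProj hM F (h hx) β := rfl

theorem conormalRes_surjective (hM : M.EmbeddedFaces) {F G : M.Face} (h : G ≤ F) :
    Function.Surjective (conormalRes hM h) := by
  obtain ⟨x, hx⟩ := G.interior_nonempty
  intro w
  obtain ⟨β, rfl⟩ := conormalProj_surjective hM F (h (G.interior_subset hx)) w
  exact ⟨_, conormalRes_proj hM h (G.interior_subset hx) β⟩

/-- A homomorphism on `B_x` that is trivial on the tangential germs factors through `W(F)`. -/
theorem eq_of_conormalProj_eq (hM : M.EmbeddedFaces) {F : M.Face} (hx : x ∈ F.toSet)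
    {A : Type*} [AddMonoid A] (v : Additive (M.BStalk x) →+ A)
    (hv : ∀ β : M.BStalk x, Tangential F x β → v (Additive.ofMul β) = 0)
    (β β' : Additive (M.BStalk x)) (h : conormalProj hM F hx β = conormalProj hM F hx β') :
    v β = v β' := by
  obtain ⟨t, t', ht, ht', e⟩ := (conormalProj_eq_iff hM F hx β.toMul β'.toMul).1 h
  have e' : v β + v (Additive.ofMul t) = v β' + v (Additive.ofMul t') := by
    rw [← map_add, ← map_add]
    exact congrArg (fun γ => v (Additive.ofMul γ)) e
  rwa [hv t ht, hv t' ht', add_zero, add_zero] at e'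

/-- The homomorphism `W(F)^∨ → W(G)^∨` dual to the restriction. -/
noncomputable def arrowHom (hM : M.EmbeddedFaces) {F G : M.Face} (h : G ≤ F) :
    (conormal F →+ ℕ) →+ (conormal G →+ ℕ) :=
  AddMonoidHom.compHom' (conormalRes hM h)

theorem arrowHom_apply (hM : M.EmbeddedFaces) {F G : M.Face} (h : G ≤ F) (w : conormal F →+ ℕ)
    (u : conormal G) : arrowHom hM h w u = w (conormalRes hM h u) := rfl

theorem arrowHom_injective (hM : M.EmbeddedFaces) {F G : M.Face} (h : G ≤ F) :
    Function.Injective (arrowHom hM h) := fun w w' e => AddMonoidHom.ext fun u => by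
  obtain ⟨u, rfl⟩ := conormalRes_surjective hM h u
  exact DFunLike.congr_fun e u

theorem mem_mrange_arrowHom_iff (hM : M.EmbeddedFaces) {F G : M.Face} (h : G ≤ F)
    (hx : x ∈ G.toSet) (w : conormal G →+ ℕ) : w ∈ AddMonoidHom.mrange (arrowHom hM h) ↔
      ∀ β : M.BStalk x, Tangential F x β → w (conormalProj hM G hx (Additive.ofMul β)) = 0 := by
  constructor
  · rintro ⟨w, rfl⟩ β hβ
    rw [arrowHom_apply, conormalRes_proj, (conormalProj_eq_zero_iff hM F (h hx) β).2 hβ, map_zero]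
  · intro hw
    obtain ⟨w', hw'⟩ := exists_comp_eq_of_surjective (conormalRes_surjective hM h) w
      fun u u' e => by
        obtain ⟨β, rfl⟩ := conormalProj_surjective hM G hx u
        obtain ⟨β', rfl⟩ := conormalProj_surjective hM G hx u'
        exact eq_of_conormalProj_eq hM (h hx) (w.comp (conormalProj hM G hx)) hw β β' e
    exact ⟨w', AddMonoidHom.ext hw'⟩

theorem isFace_mrange_arrowHom (hM : M.EmbeddedFaces) {F G : M.Face} (h : G ≤ F) :
    IsFace (AddMonoidHom.mrange (arrowHom hM h)) := by
  obtain ⟨x, hx⟩ := G.interior_nonempty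
  have hx := G.interior_subset hx
  intro w w' hw
  rw [mem_mrange_arrowHom_iff hM h hx] at hw ⊢
  rw [mem_mrange_arrowHom_iff hM h hx]
  have key : ∀ β, Tangential F x β → w (conormalProj hM G hx (Additive.ofMul β)) = 0 ∧
      w' (conormalProj hM G hx (Additive.ofMul β)) = 0 := fun β hβ =>
    Nat.add_eq_zero_iff.1 (hw β hβ)
  exact ⟨fun β hβ => (key β hβ).1, fun β hβ => (key β hβ).2⟩

/-- In terms of the monoid of a chart, the image of `W(F)^∨ → W(G)^∨` consists of the homomorphisms
that vanish on the face corresponding to `F`. -/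
theorem mem_mrange_arrowHom_iff_chart (hM : M.EmbeddedFaces) {F G : M.Face} (h : G ≤ F)
    {c : Chart M} (hc : c ∈ M.atlas) (hx : x ∈ c.2.source) (hxG : x ∈ G.toSet)
    {T : AddSubmonoid c.1} (hT : IsLocalFace F c x T) (w : conormal G →+ ℕ) :
    w ∈ AddMonoidHom.mrange (arrowHom hM h) ↔
      ∀ t ∈ T, w (conormalProj hM G hxG (stalkCoord hc hx t)) = 0 := by
  rw [mem_mrange_arrowHom_iff hM h hxG]
  constructor
  · intro hw t ht
    exact hw _ ((hT.tangential_iff hx (stalkMono_stalkCoord hc hx t)).2 ht)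
  · intro hw β hβ
    obtain ⟨p, hp⟩ := exists_stalkMono hc hx β
    obtain ⟨T', hT'⟩ := exists_isLocalFace hM hc hx hxG
    rw [stalkMono_eq hc hx hT' (conormalProj hM G hxG)
      (fun β β' => (conormalProj_eq_iff hM G hxG β β').2) hp]
    exact hw p ((hT.tangential_iff hx hp).1 hβ)

theorem exists_mrange_arrowHom_eq (hM : M.EmbeddedFaces) (G : M.Face)
    {S : AddSubmonoid (conormal G →+ ℕ)} (hS : IsFace S) :
    ∃ (F : M.Face) (h : G ≤ F), AddMonoidHom.mrange (arrowHom hM h) = S := by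
  obtain ⟨x, hx⟩ := G.interior_nonempty
  have hxG := G.interior_subset hx
  obtain ⟨c, hc, hx⟩ := M.cover x
  obtain ⟨T', hT'⟩ := exists_isLocalFace hM hc hx hxG
  let π : c.1 →+ conormal G := (conormalProj hM G hxG).comp (stalkCoord hc hx)
  have hπs : Function.Surjective π := conormalProj_stalkCoord_surjective hM hc hx hT'
  have hπ : ∀ p q, π p = π q ↔ RelMod T' p q := conormalProj_stalkCoord_eq_iff hM hc hx hT'
  have hfg := (isToric_conormal hM G).fg
  obtain ⟨w₀, hw₀S, hw₀⟩ := exists_mem_forall_vanishing hfg S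
  -- The face is the zero set of `w₀`, a general element of `S`.
  have hT : IsFace (AddMonoidHom.mker (w₀.comp π)) := isFace_kernel _ fun _ => zero_le
  have hT'T : T' ≤ AddMonoidHom.mker (w₀.comp π) := fun t ht => by
    have : π t = 0 := by
      rw [← map_zero π, hπ]
      exact ⟨0, T'.zero_mem, t, ht, by rw [add_zero, zero_add]⟩
    rw [AddMonoidHom.mem_mker, AddMonoidHom.comp_apply, this, map_zero]
  obtain ⟨F, hF⟩ := exists_face_isLocalFace hM hc hx hT (hT'.le.trans hT'T)
  refine ⟨F, (hT'.le_iff hM hx hF).2 hT'T, ?_⟩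
  ext w
  rw [mem_mrange_arrowHom_iff_chart hM _ hc hx hxG hF]
  constructor
  · intro hw
    refine mem_face_of_vanishing hfg hS hw₀S fun u hu => ?_
    obtain ⟨p, rfl⟩ := hπs u
    exact hw p hu
  · exact fun hw t ht => hw₀ _ ht w hw

theorem face_eq_of_mrange_arrowHom_eq (hM : M.EmbeddedFaces) {F F' G : M.Face} (h : G ≤ F)
    (h' : G ≤ F')
    (e : AddMonoidHom.mrange (arrowHom hM h) = AddMonoidHom.mrange (arrowHom hM h')) :
    F = F' := by
  obtain ⟨x, hx⟩ := G.interior_nonempty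
  have hxG := G.interior_subset hx
  obtain ⟨c, hc, hx⟩ := M.cover x
  obtain ⟨T₀, hT₀⟩ := exists_isLocalFace hM hc hx hxG
  have key : ∀ {F F' : M.Face} {T T' : AddSubmonoid c.1} (h : G ≤ F) (h' : G ≤ F'),
      AddMonoidHom.mrange (arrowHom hM h) = AddMonoidHom.mrange (arrowHom hM h') →
        IsLocalFace F c x T → IsLocalFace F' c x T' → T' ≤ T := by
    intro F F' T T' h h' e hT hT'
    obtain ⟨v, hv⟩ := c.1.toric.exists_kernel_eq hT.isFace
    obtain ⟨w, hw⟩ := exists_comp_eq_of_surjective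
      (conormalProj_stalkCoord_surjective hM hc hx hT₀) v fun p q hpq =>
        ((conormalProj_stalkCoord_eq_iff hM hc hx hT₀ p q).1 hpq).map_eq v fun t ht =>
          (hv t).2 ((hT₀.le_iff hM hx hT).1 h ht)
    have hwm : w ∈ AddMonoidHom.mrange (arrowHom hM h) :=
      (mem_mrange_arrowHom_iff_chart hM h hc hx hxG hT w).2 fun t ht =>
        (hw t).trans ((hv t).2 ht)
    rw [e, mem_mrange_arrowHom_iff_chart hM h' hc hx hxG hT'] at hwm
    exact fun t ht => (hv t).1 ((hw t).symm.trans (hwm t ht))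
  obtain ⟨T, hT⟩ := exists_isLocalFace hM hc hx (h hxG)
  obtain ⟨T', hT'⟩ := exists_isLocalFace hM hc hx (h' hxG)
  have hTT : T = T' := le_antisymm (key h' h e.symm hT' hT) (key h h' e hT hT')
  exact hT.face_unique hx (hTT ▸ hT')

theorem existsUnique_arrowHom (hM : M.EmbeddedFaces) (G : M.Face)
    (S : AddSubmonoid (conormal G →+ ℕ)) (hS : IsFace S) :
    ∃! i : (Σ F : M.Face, {i : (conormal F →+ ℕ) →+ (conormal G →+ ℕ) |
      ∃ h : G ≤ F, i = arrowHom hM h}), AddMonoidHom.mrange i.2.1 = S := by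
  obtain ⟨F, h, e⟩ := exists_mrange_arrowHom_eq hM G hS
  refine ⟨⟨F, arrowHom hM h, h, rfl⟩, e, ?_⟩
  rintro ⟨F', _, h', rfl⟩ e'
  obtain rfl := face_eq_of_mrange_arrowHom_eq hM h' h (e'.trans e.symm)
  rfl

/-- The trivialization `W(F)^∨ ≅ ᵇM_x F`. -/
noncomputable def normalTriv (hM : M.EmbeddedFaces) (F : M.Face) (hx : x ∈ F.toSet) :
    (conormal F →+ ℕ) ≃+ normalMonoid F x :=
  AddEquiv.ofBijective
    ((AddMonoidHom.compHom' (conormalProj hM F hx)).codRestrict (normalMonoid F x)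
      fun w β hβ => by
        show w (conormalProj hM F hx (Additive.ofMul β)) = 0
        rw [(conormalProj_eq_zero_iff hM F hx β).2 hβ, map_zero])
    ⟨fun w w' e => AddMonoidHom.ext fun u => by
      obtain ⟨β, rfl⟩ := conormalProj_surjective hM F hx u
      exact DFunLike.congr_fun (congrArg Subtype.val e) β,
    fun v => by
      obtain ⟨w, hw⟩ := exists_comp_eq_of_surjective (conormalProj_surjective hM F hx) v.1
        (eq_of_conormalProj_eq hM hx v.1 v.2)
      exact ⟨w, Subtype.ext (AddMonoidHom.ext hw)⟩⟩

theorem normalTriv_apply (hM : M.EmbeddedFaces) (F : M.Face) (hx : x ∈ F.toSet)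
    (w : conormal F →+ ℕ) :
    (normalTriv hM F hx w : StalkDual x) = w.comp (conormalProj hM F hx) := rfl

end NormalComplex

end PreManifold

open PreManifold

/-- The complex of the monoids `W(F)^∨`, with the duals of the restrictions as arrows. -/
noncomputable def normalComplex (M : Manifold.{u}) : MonoidalComplex.{u} where
  Obj := M.Face
  mon F := ⟨conormal F →+ ℕ, isToric_dual (isToric_conormal M.embedded F).fg⟩
  Arrow F G := {i | ∃ h : G ≤ F, i = arrowHom M.embedded h}
  id_mem F := ⟨F.le_refl, rfl⟩
  comp_mem := by
    rintro F G H _ _ ⟨h, rfl⟩ ⟨h', rfl⟩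
    exact ⟨Face.le_trans h' h, rfl⟩
  arrow_injective := by
    rintro F G _ ⟨h, rfl⟩
    exact arrowHom_injective M.embedded h
  arrow_isFace := by
    rintro F G _ ⟨h, rfl⟩
    exact isFace_mrange_arrowHom M.embedded h
  existsUnique_arrow := existsUnique_arrowHom M.embedded

/-- The complex of the monoids `W(F)^∨` is the complex of normal monoids of `M`. -/
noncomputable def normalComplexData (M : Manifold.{u}) :
    NormalComplexData M (normalComplex M) where
  face := Equiv.refl _
  W F := ⟨conormal (M := M.toPreManifold) F, isToric_conormal M.embedded F⟩
  proj F _ hx := conormalProj M.embedded F hx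
  proj_surjective F _ hx := conormalProj_surjective M.embedded F hx
  proj_eq_iff F _ hx := conormalProj_eq_iff M.embedded F hx
  proj_locallyConstant F _ hx _ hb := eventually_conormalProj_eq M.embedded F hx hb
  dual F := AddEquiv.refl _
  triv F _ hx := normalTriv M.embedded F hx
  triv_apply F _ hx := normalTriv_apply M.embedded F hx
  arrow_nonempty_iff _ _ := ⟨fun ⟨_, h, _⟩ => h, fun h => ⟨_, h, rfl⟩⟩
  arrow_apply := by
    rintro F G _ ⟨h, rfl⟩ x hx
    exact ⟨h hx, fun w => rfl⟩

namespace PreManifold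

/-! ### The maps of conormal monoids induced by an interior b-map -/

section InducedMaps

variable {M N : PreManifold.{u}} {f : M → N} {x : M}

theorem stalkPullback_germ (hf : IsIntBMap f) {b : N → ℝ} (hb : N.BAt b (f x)) :
    stalkPullback hf x (germ b (f x) hb) = germ (fun y => b (f y)) x (hf.bAt hb) := rfl

/-- Near `x`, the support of `f y` depends only on the support of `y`. -/
theorem IsIntBMap.eventually_chartSupp_eq (hf : IsIntBMap f) {c : Chart M} (hc : c ∈ M.atlas)
    (hx : x ∈ c.2.source) {c' : Chart N} (hc' : c' ∈ N.atlas) (hx' : f x ∈ c'.2.source) :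
    ∀ᶠ y in 𝓝 x, chartSupp c y = chartSupp c x → chartSupp c' (f y) = chartSupp c' (f x) := by
  obtain ⟨A, hA⟩ := c'.1.toric.exists_generators
  have h1 : ∀ᶠ y in 𝓝 x, ∀ a ∈ (A : Set c'.1), chartSupp c y = chartSupp c x →
      (a ∈ chartSupp c' (f y) ↔ a ∈ chartSupp c' (f x)) := by
    refine (eventually_all_finite A.finite_toSet).2 fun a _ => ?_
    obtain ⟨p, hp⟩ := (bAt_iff hc hx).1
      (hf.bAt ((bAt_iff hc' hx').2 ⟨a, hasMono_chartCoord hx' a⟩))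
    filter_upwards [hp.eventually hx, c.2.open_source.mem_nhds hx] with y hy hys e
    exact (hy.ne_zero_iff hys).trans (e ▸ (hp.ne_zero_iff hx).symm)
  filter_upwards [h1] with y hy e
  rw [(isFace_chartSupp c' (f y)).eq_closure_inter hA,
    (isFace_chartSupp c' (f x)).eq_closure_inter hA]
  congr 1
  ext a
  exact and_congr_right fun ha => hy a ha e

/-- An interior b-map takes the interior of a boundary face into the interior of one. -/
theorem IsIntBMap.exists_mapsTo_interior (hM : M.EmbeddedFaces) (hN : N.EmbeddedFaces)
    (hf : IsIntBMap f) (F : M.Face) : ∃ H : N.Face, MapsTo f F.interior H.interior := by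
  obtain ⟨x₀, hx₀⟩ := F.interior_nonempty
  refine ⟨faceOf (f x₀), fun y hy => ?_⟩
  have key := F.isPreconnected_interior.induction₂ (fun x y => faceOf (f x) = faceOf (f y))
    (fun x hxF => ?_) (fun _ _ _ _ _ _ h h' => h.trans h') (fun _ _ _ _ h => h.symm) hx₀ hy
  · rw [key]
    exact mem_interior_faceOf (f y)
  obtain ⟨c, hc, hx⟩ := M.cover x
  obtain ⟨c', hc', hx'⟩ := N.cover (f x)
  obtain ⟨T, hT⟩ := exists_isLocalFace hM hc hx (F.interior_subset hxF)
  have hxT := hT.eventually.self_of_nhds.1.1 hxF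
  obtain ⟨T', hT'⟩ := exists_isLocalFace hN hc' hx'
    ((faceOf (f x)).interior_subset (mem_interior_faceOf (f x)))
  have hxT' := hT'.eventually.self_of_nhds.1.1 (mem_interior_faceOf (f x))
  rw [eventually_nhdsWithin_iff]
  filter_upwards [hf.eventually_chartSupp_eq hc hx hc' hx', hT.eventually,
    hf.continuous.continuousAt.eventually hT'.eventually] with y h1 h2 h3 hyF
  refine Face.eq_of_mem_of_mem (h3.1.2 ?_) (mem_interior_faceOf (f y))
  rw [h1 ((h2.1.1 hyF).trans hxT.symm), hxT']

theorem mem_toSet_of_mapsTo (hf : Continuous f) {F : M.Face} {H : N.Face}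
    (h : MapsTo f F.interior H.interior) (hx : x ∈ F.toSet) : f x ∈ H.toSet :=
  map_mem_closure hf hx h

/-- Germs are tangential to `H` at `f x` if and only if their pull-backs are tangential to `F`
at `x`: they are nonzero at the points of `H° ⊇ f(F°)` near `f x`. -/
theorem tangential_stalkPullback_iff (hM : M.EmbeddedFaces) (hN : N.EmbeddedFaces)
    (hf : IsIntBMap f) {F : M.Face} {H : N.Face} (h : MapsTo f F.interior H.interior)
    (hxF : x ∈ F.toSet) (β : N.BStalk (f x)) :
    Tangential F x (stalkPullback hf x β) ↔ Tangential H (f x) β := by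
  obtain ⟨c, hc, hx⟩ := M.cover x
  obtain ⟨c', hc', hx'⟩ := N.cover (f x)
  obtain ⟨T, hT⟩ := exists_isLocalFace hM hc hx hxF
  obtain ⟨T', hT'⟩ := exists_isLocalFace hN hc' hx' (mem_toSet_of_mapsTo hf.continuous h hxF)
  obtain ⟨b, hb, rfl⟩ := exists_eq_germ β
  obtain ⟨q, hq⟩ := (bAt_iff hc' hx').1 hb
  obtain ⟨p, hp⟩ := (bAt_iff hc hx).1 (hf.bAt hb)
  rw [hT'.tangential_iff hx' ⟨b, hb, rfl, hq⟩, stalkPullback_germ,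
    hT.tangential_iff hx ⟨_, hf.bAt hb, rfl, hp⟩]
  have hs : ∀ᶠ y in 𝓝 x, y ∈ c.2.source := c.2.open_source.mem_nhds hx
  have hev : ∀ᶠ z in 𝓝 (f x), z ∈ c'.2.source ∧ HasMono c' b z q ∧
      (z ∈ H.interior → chartSupp c' z = T') := by
    filter_upwards [c'.2.open_source.mem_nhds hx', hq.eventually hx', hT'.eventually]
      with z h1 h2 h3
    exact ⟨h1, h2, h3.1.1⟩
  obtain ⟨y, ⟨hyF, hyT⟩, h1, h2, h3, h4, h5⟩ := ((hT.frequently hx).and_eventually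
    ((hp.eventually hx).and (hs.and (hf.continuous.continuousAt.eventually hev)))).exists
  rw [← hyT, ← h5 (h hyF), ← h1.ne_zero_iff h2, ← h4.ne_zero_iff h3]

/-- `φ` is the homomorphism `W(H) → W(F)` induced by the pull-back of germs at `f x`. -/
def InducesAt (hM : M.EmbeddedFaces) (hN : N.EmbeddedFaces) (hf : IsIntBMap f) {F : M.Face}
    {H : N.Face} (h : MapsTo f F.interior H.interior) (φ : conormal H →+ conormal F) (x : M) :
    Prop :=
  ∀ (hx : x ∈ F.toSet) (β : N.BStalk (f x)),
    φ (conormalProj hN H (mem_toSet_of_mapsTo hf.continuous h hx) (Additive.ofMul β)) =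
      conormalProj hM F hx (Additive.ofMul (stalkPullback hf x β))

theorem exists_inducesAt (hM : M.EmbeddedFaces) (hN : N.EmbeddedFaces) (hf : IsIntBMap f)
    {F : M.Face} {H : N.Face} (h : MapsTo f F.interior H.interior) (hx : x ∈ F.toSet) :
    ∃ φ, InducesAt hM hN hf h φ x := by
  have hfx := mem_toSet_of_mapsTo hf.continuous h hx
  obtain ⟨φ, hφ⟩ := exists_comp_eq_of_surjective (conormalProj_surjective hN H hfx)
    ((conormalProj hM F hx).comp (MonoidHom.toAdditive (stalkPullback hf x)))
    (eq_of_conormalProj_eq hN hfx _ fun β hβ => (conormalProj_eq_zero_iff hM F hx _).2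
      ((tangential_stalkPullback_iff hM hN hf h hx β).2 hβ))
  exact ⟨φ, fun _ β => hφ (Additive.ofMul β)⟩

/-- It suffices to consider generators of the monoid of a chart. -/
theorem inducesAt_iff (hM : M.EmbeddedFaces) (hN : N.EmbeddedFaces) (hf : IsIntBMap f)
    {F : M.Face} {H : N.Face} (h : MapsTo f F.interior H.interior) {φ : conormal H →+ conormal F}
    (hx : x ∈ F.toSet) {c : Chart N} (hc : c ∈ N.atlas) (hfx : f x ∈ c.2.source) {A : Finset c.1}
    (hA : AddSubmonoid.closure (A : Set c.1) = ⊤) : InducesAt hM hN hf h φ x ↔ ∀ a ∈ A,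
      φ (conormalProj hN H (mem_toSet_of_mapsTo hf.continuous h hx) (stalkCoord hc hfx a)) =
        conormalProj hM F hx
          (Additive.ofMul (stalkPullback hf x (stalkCoord hc hfx a).toMul)) := by
  refine ⟨fun hφ a _ => hφ hx _, fun hφ _ β => ?_⟩
  have hfxH := mem_toSet_of_mapsTo hf.continuous h hx
  obtain ⟨T, hT⟩ := exists_isLocalFace hN hc hfx hfxH
  let v := φ.comp (conormalProj hN H hfxH)
  let w := (conormalProj hM F hx).comp (MonoidHom.toAdditive (stalkPullback hf x))
  have e : v.comp (stalkCoord hc hfx) = w.comp (stalkCoord hc hfx) :=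
    AddMonoidHom.eq_of_eqOn_denseM hA hφ
  obtain ⟨p, hp⟩ := exists_stalkMono hc hfx β
  have hv : v (Additive.ofMul β) = v (stalkCoord hc hfx p) :=
    stalkMono_eq hc hfx hT v
      (fun β β' hr => congrArg φ ((conormalProj_eq_iff hN H hfxH β β').2 hr)) hp
  have hw : w (Additive.ofMul β) = w (stalkCoord hc hfx p) := by
    refine stalkMono_eq hc hfx hT w (fun β β' ⟨t, t', ht, ht', e⟩ => ?_) hp
    refine (conormalProj_eq_iff hM F hx _ _).2 ⟨stalkPullback hf x t, stalkPullback hf x t',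
      (tangential_stalkPullback_iff hM hN hf h hx t).2 ht,
      (tangential_stalkPullback_iff hM hN hf h hx t').2 ht', ?_⟩
    exact (map_mul _ _ _).symm.trans ((congrArg _ e).trans (map_mul _ _ _))
  exact hv.trans ((DFunLike.congr_fun e p).trans hw.symm)

/-- The homomorphism `W(H) → W(F)` induced by `f`; it does not depend on the point of `F`. -/
theorem exists_conormalMap (hM : M.EmbeddedFaces) (hN : N.EmbeddedFaces) (hf : IsIntBMap f)
    {F : M.Face} {H : N.Face} (h : MapsTo f F.interior H.interior) :
    ∃ φ, ∀ x, InducesAt hM hN hf h φ x := by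
  obtain ⟨x₀, hx₀⟩ := F.interior_nonempty
  have hx₀F := F.interior_subset hx₀
  obtain ⟨φ, hφ⟩ := exists_inducesAt hM hN hf h hx₀F
  refine ⟨φ, fun y hy => (F.isPreconnected.induction₂
    (fun x y => InducesAt hM hN hf h φ x ↔ InducesAt hM hN hf h φ y) (fun x hxF => ?_)
    (fun _ _ _ _ _ _ h h' => h.trans h') (fun _ _ _ _ h => h.symm) hx₀F hy).1 hφ hy⟩
  have hfxH := mem_toSet_of_mapsTo hf.continuous h hxF
  obtain ⟨c, hc, hfx⟩ := N.cover (f x)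
  obtain ⟨A, hA⟩ := c.1.toric.exists_generators
  have hb : ∀ {y : N} (hy : y ∈ c.2.source) (a : c.1), N.BAt (chartCoord c a) y := fun hy a =>
    (bAt_iff hc hy).2 ⟨a, hasMono_chartCoord hy a⟩
  have h1 : ∀ᶠ y in 𝓝[F.toSet] x, ∀ a ∈ (A : Set c.1), ∃ (hy : f y ∈ H.toSet)
      (hb' : N.BAt (chartCoord c a) (f y)),
      conormalProj hN H hy (Additive.ofMul (germ _ (f y) hb')) =
        conormalProj hN H hfxH (Additive.ofMul (germ _ (f x) (hb hfx a))) := by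
    refine (eventually_all_finite A.finite_toSet).2 fun a _ => ?_
    have ht : Tendsto f (𝓝[F.toSet] x) (𝓝[H.toSet] (f x)) :=
      hf.continuous.continuousAt.continuousWithinAt.tendsto_nhdsWithin fun y hy =>
        mem_toSet_of_mapsTo hf.continuous h hy
    exact ht.eventually (eventually_conormalProj_eq hN H hfxH (hb hfx a))
  have h2 : ∀ᶠ y in 𝓝[F.toSet] x, ∀ a ∈ (A : Set c.1), ∃ (hy : y ∈ F.toSet)
      (hb' : M.BAt (fun z => chartCoord c a (f z)) y),
      conormalProj hM F hy (Additive.ofMul (germ _ y hb')) =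
        conormalProj hM F hxF (Additive.ofMul (germ _ x (hf.bAt (hb hfx a)))) :=
    (eventually_all_finite A.finite_toSet).2 fun a _ =>
      eventually_conormalProj_eq hM F hxF (hf.bAt (hb hfx a))
  filter_upwards [h1, h2, self_mem_nhdsWithin, mem_nhdsWithin_of_mem_nhds
    (hf.continuous.continuousAt.preimage_mem_nhds (c.2.open_source.mem_nhds hfx))]
    with y hy1 hy2 hyF hys
  rw [inducesAt_iff hM hN hf h hxF hc hfx hA, inducesAt_iff hM hN hf h hyF hc hys hA]
  refine forall₂_congr fun a ha => ?_
  obtain ⟨_, _, e1⟩ := hy1 a ha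
  obtain ⟨_, _, e2⟩ := hy2 a ha
  exact Eq.congr (congrArg φ e1.symm) e2.symm

theorem comp_mem_monoidInterior (hM : M.EmbeddedFaces) (hN : N.EmbeddedFaces) (hf : IsIntBMap f)
    {F : M.Face} {H : N.Face} (h : MapsTo f F.interior H.interior) {φ : conormal H →+ conormal F}
    (hφ : ∀ x, InducesAt hM hN hf h φ x) {w : conormal F →+ ℕ}
    (hw : w ∈ monoidInterior (conormal F →+ ℕ)) :
    w.comp φ ∈ monoidInterior (conormal H →+ ℕ) := by
  rw [mem_monoidInterior_dual_iff (isToric_conormal hM F).fg] at hw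
  rw [mem_monoidInterior_dual_iff (isToric_conormal hN H).fg]
  intro u hu w'
  obtain ⟨x, hx⟩ := F.interior_nonempty
  have hxF := F.interior_subset hx
  have hfx := mem_toSet_of_mapsTo hf.continuous h hxF
  obtain ⟨β, rfl⟩ := conormalProj_surjective hN H hfx u
  have e := hφ x hxF β.toMul
  have h0 : conormalProj hM F hxF (Additive.ofMul (stalkPullback hf x β.toMul)) = 0 := by
    refine Subtype.ext (funext fun K => ?_)
    refine hw _ ((congrArg w e).symm.trans hu)
      ((Pi.evalAddMonoidHom (fun _ => ℕ) K).comp (conormal F).subtype)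
  rw [conormalProj_eq_zero_iff, tangential_stalkPullback_iff hM hN hf h hxF] at h0
  have h1 := (conormalProj_eq_zero_iff hN H hfx β.toMul).2 h0
  exact (congrArg w' h1).trans (map_zero w')

/-- The induced maps of conormal monoids commute with the restrictions. -/
theorem conormalMap_res (hM : M.EmbeddedFaces) (hN : N.EmbeddedFaces) (hf : IsIntBMap f)
    {F G : M.Face} {H K : N.Face} (h : MapsTo f F.interior H.interior)
    (h' : MapsTo f G.interior K.interior) {φ : conormal H →+ conormal F}
    {ψ : conormal K →+ conormal G} (hφ : ∀ x, InducesAt hM hN hf h φ x)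
    (hψ : ∀ x, InducesAt hM hN hf h' ψ x) (hGF : G ≤ F) (hKH : K ≤ H) :
    (conormalRes hM hGF).comp ψ = φ.comp (conormalRes hN hKH) := by
  obtain ⟨x, hx⟩ := G.interior_nonempty
  have hxG := G.interior_subset hx
  ext u : 1
  obtain ⟨β, rfl⟩ := conormalProj_surjective hN K (mem_toSet_of_mapsTo hf.continuous h' hxG) u
  rw [AddMonoidHom.comp_apply, AddMonoidHom.comp_apply, conormalRes_proj]
  have e1 := hψ x hxG β.toMul
  have e2 := hφ x (hGF hxG) β.toMul
  rw [ofMul_toMul] at e1 e2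
  rw [e1, conormalRes_proj, e2]

theorem le_of_mapsTo (hN : N.EmbeddedFaces) (hf : Continuous f) {F G : M.Face} {H K : N.Face}
    (h : MapsTo f F.interior H.interior) (h' : MapsTo f G.interior K.interior) (hGF : G ≤ F) :
    K ≤ H := by
  obtain ⟨x, hx⟩ := G.interior_nonempty
  exact Face.le_of_mem_of_mem hN (h' hx) (mem_toSet_of_mapsTo hf h (hGF (G.interior_subset hx)))

end InducedMaps

end PreManifold

open PreManifold

/-! ### Functoriality -/

theorem exists_isInducedBy {M N : Manifold.{u}} (f : M ⟶ N) :
    ∃ φ : normalComplex M ⟶ normalComplex N,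
      IsInducedBy f (normalComplexData M) (normalComplexData N) φ := by
  have hM := M.embedded
  have hN := N.embedded
  have hf := f.isIntBMap
  choose H hH using hf.exists_mapsTo_interior hM hN
  choose φ hφ using fun F => exists_conormalMap hM hN hf (hH F)
  let Φ : MonoidalComplex.Hom (normalComplex M) (normalComplex N) :=
    { obj := H
      hom := fun F => AddMonoidHom.compHom' (φ F)
      interior := fun F w hw => comp_mem_monoidInterior hM hN hf (hH F) (hφ F) hw
      comm := by
        rintro F G _ ⟨h, rfl⟩
        have hle := le_of_mapsTo hN hf.continuous (hH F) (hH G) h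
        refine ⟨arrowHom hN hle, ⟨hle, rfl⟩, AddMonoidHom.ext fun w => ?_⟩
        exact congrArg w.comp (conormalMap_res hM hN hf (hH F) (hH G) (hφ F) (hφ G) h hle) }
  refine ⟨Φ, hH, fun F x hx => ⟨mem_toSet_of_mapsTo hf.continuous (hH F) hx, fun w => ?_⟩⟩
  exact AddMonoidHom.ext fun β =>
    congrArg (show conormal F →+ ℕ from w) (hφ F x hx β.toMul)

/-- A morphism of complexes of normal monoids is determined by the map inducing it. -/
theorem IsInducedBy.unique {M N : Manifold.{u}} {P Q : MonoidalComplex.{u}} {f : M ⟶ N}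
    {A : NormalComplexData M P} {B : NormalComplexData N Q} {φ ψ : P ⟶ Q}
    (hφ : IsInducedBy f A B φ) (hψ : IsInducedBy f A B ψ) : φ = ψ := by
  have hobj : φ.obj = ψ.obj := by
    funext a
    obtain ⟨x, hx⟩ := (A.face a).interior_nonempty
    exact B.face.injective (Face.eq_of_mem_of_mem (hφ.mapsTo_interior a hx)
      (hψ.mapsTo_interior a hx))
  obtain ⟨o, h, i, k⟩ := φ
  obtain ⟨o', h', i', k'⟩ := ψ
  obtain rfl : o = o' := hobj
  obtain rfl : h = h' := by
    funext a
    refine AddMonoidHom.ext fun w => ?_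
    obtain ⟨x, hx⟩ := (A.face a).interior_nonempty
    have hx := (A.face a).interior_subset hx
    obtain ⟨hy, e⟩ := hφ.hom_apply a x hx
    obtain ⟨_, e'⟩ := hψ.hom_apply a x hx
    exact (B.triv (o a) (f.toFun x) hy).injective (Subtype.ext ((e w).trans (e' w).symm))
  rfl

theorem IsInducedBy.id {M : Manifold.{u}} {P : MonoidalComplex.{u}} (A : NormalComplexData M P) :
    IsInducedBy (𝟙 M) A A (𝟙 P) :=
  ⟨fun _ _ hx => hx, fun _ _ hx => ⟨hx, fun _ => AddMonoidHom.ext fun β => by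
    obtain ⟨_, b, rfl, hb⟩ := β
    rfl⟩⟩

theorem IsInducedBy.comp {M N K : Manifold.{u}} {P Q R : MonoidalComplex.{u}} {f : M ⟶ N}
    {g : N ⟶ K} {A : NormalComplexData M P} {B : NormalComplexData N Q}
    {C : NormalComplexData K R} {φ : P ⟶ Q} {ψ : Q ⟶ R} (hφ : IsInducedBy f A B φ)
    (hψ : IsInducedBy g B C ψ) : IsInducedBy (f ≫ g) A C (φ ≫ ψ) := by
  refine ⟨fun a x hx => hψ.mapsTo_interior _ (hφ.mapsTo_interior a hx), fun a x hx => ?_⟩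
  obtain ⟨hy, e⟩ := hφ.hom_apply a x hx
  obtain ⟨hz, e'⟩ := hψ.hom_apply (φ.obj a) (f.toFun x) hy
  refine ⟨hz, fun w => (e' (φ.hom a w)).trans ?_⟩
  rw [e w]
  refine AddMonoidHom.ext fun β => ?_
  obtain ⟨_, b, rfl, hb⟩ := β
  rfl

end GCorners

/-- There is a functor `M ↦ P_M`, `f ↦ f_♮` from manifolds with generalized corners and interior
b-maps to monoidal complexes, such that `P_M` is the complex of normal monoids `W(F)^∨` of the
boundary faces of `M` and `f_♮` is induced by the b-differential of `f`. -/
theorem theorem2p19 :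
    ∃ (P : CategoryTheory.Functor GCorners.Manifold.{u} GCorners.MonoidalComplex.{u})
      (A : ∀ M : GCorners.Manifold.{u}, GCorners.NormalComplexData M (P.obj M)),
      ∀ (M N : GCorners.Manifold.{u}) (f : M ⟶ N),
        GCorners.IsInducedBy f (A M) (A N) (P.map f) := by
  choose F hF using fun (M N : GCorners.Manifold.{u}) (f : M ⟶ N) => GCorners.exists_isInducedBy f
  exact ⟨{ obj := GCorners.normalComplex
           map := fun {M N} f => F M N f
           map_id := fun M => (hF M M (𝟙 M)).unique (GCorners.IsInducedBy.id _)
           map_comp := fun {M N K} f g =>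
             (hF M K (f ≫ g)).unique ((hF M N f).comp (hF N K g)) },
    GCorners.normalComplexData, hF⟩
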